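/- Let $k$ be a field. Let $Set_0$ be the category of finite sets, $\mathbf{Set}=\mathrm{Ind}(\mathrm{Pro}(Set_0))$, $\mathbb{S}et=\mathrm{Ind}(\mathrm{Pro}(\mathbf{Set}))$, let $Vect_0\subset Vect$ be the categories of finite-dimensional and of all vector spaces over $k$, and $\mathbb{V}ect=\mathrm{Pro}(Vect)$. Write $\mathcal{H}om(X\otimes V,W)$ for the set of families of maps $V\to W$ parametrised by $X$ (``action maps'' $X\times V\to W$), defined as follows. For $X\in Set_0$ and $V,W\in Vect_0$ it is $\mathrm{Map}(X,\mathrm{Hom}_k(V,W))$. For $\mathbf{X}="\varinjlim_j""\varprojlim_i"X_i^j\in\mathbf{Set}$ and $V=\varinjlim_m V_m$, $W=\varinjlim_n W_n$ in $Vect$ (with $V_m,W_n\in Vect_0$) it is $\varprojlim_j\varprojlim_m\varinjlim_n\varinjlim_i\mathcal{H}om(X_i^j\otimes V_m,W_n)$. For $\mathbb{X}="\varinjlim_k""\varprojlim_l"\mathbf{X}_l^k\in\mathbb{S}et$ and $\mathbb{V}="\varprojlim_n"V_n$, $\mathbb{W}="\varprojlim_m"W_m$ in $\mathbb{V}ect$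 it is $\varprojlim_k\varprojlim_m\varinjlim_n\varinjlim_l\mathcal{H}om(\mathbf{X}_l^k\otimes V_n,W_m)$. These sets are functorial in all arguments and come with composition maps $\mathcal{H}om(\mathbb{Y}\otimes\mathbb{W},\mathbb{U})\times\mathcal{H}om(\mathbb{X}\otimes\mathbb{V},\mathbb{W})\to\mathcal{H}om((\mathbb{Y}\times\mathbb{X})\otimes\mathbb{V},\mathbb{U})$ (the pseudo-action of $\mathbb{S}et$ on $\mathbb{V}ect$). For a group object $\mathbb{G}$ of $\mathbb{S}et$ let $\mathrm{Rep}(\mathbb{G})$ be the category of pairs $(\mathbb{V},\rho)$ with $\mathbb{V}\in\mathbb{V}ect$ and $\rho\in\mathcal{H}om(\mathbb{G}\otimes\mathbb{V},\mathbb{V})$ associative and unital with respect to the group law; morphisms are the maps in $\mathbb{V}ect$ compatible with the actions. A map $f:\mathbf{X}\to\mathbf{Y}$ in $\mathbf{Set}$ is weakly surjective if any two maps from $\mathbf{Y}$ to a finite set that agree after composition with $f$ are equal. An object of $\mathrm{Pro}(\mathbf{Set})$ is weakly strict if it can be represented as $"\varprojlim"\mathbf{X}_i$ with weakly surjective transition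 maps $\mathbf{X}_i\to\mathbf{X}_j$. An object of $\mathbb{S}et$ satisfies condition (**) if it can be represented as $"\varinjlim"\mathbb{X}_k$ with all $\mathbb{X}_k\in\mathrm{Pro}(\mathbf{Set})$ weakly strict. Proposition. Let $\mathbb{G}$ be a group object of $\mathbb{S}et$ that satisfies condition (**). Then: (1) the forgetful functor $\mathrm{Rep}(\mathbb{G})\to\mathbb{V}ect$ admits a left adjoint; (2) for every homomorphism $\mathbb{G}_1\to\mathbb{G}$ of group objects of $\mathbb{S}et$, the restriction functor $\mathrm{Rep}(\mathbb{G})\to\mathrm{Rep}(\mathbb{G}_1)$ admits a left adjoint; (3) the category $\mathrm{Rep}(\mathbb{G})$ has all (small) inductive limits. -/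

import Mathlib

open CategoryTheory Limits

universe u

namespace ProRep

/-! ### Pro-objects -/

section ProObjects

universe v' u'

/-- The pro-completion `Pro(C) = Ind(Cᵒᵖ)ᵒᵖ`. -/
abbrev Pro (C : Type u') [Category.{v'} C] : Type (max u' (v' + 1)) := (Ind Cᵒᵖ)ᵒᵖ

variable {C : Type u'} [Category.{v'} C]

/-- The embedding `C ⥤ Pro(C)`. -/
noncomputable def Pro.const : C ⥤ Pro C := (Ind.yoneda (C := Cᵒᵖ)).rightOp

instance : (Pro.const (C := C)).Full :=
  inferInstanceAs (Ind.yoneda (C := Cᵒᵖ)).rightOp.Full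

instance : (Pro.const (C := C)).Faithful :=
  inferInstanceAs (Ind.yoneda (C := Cᵒᵖ)).rightOp.Faithful

variable [HasFiniteLimits C]

noncomputable instance : PreservesFiniteLimits (Pro.const (C := C)) :=
  preservesFiniteLimits_rightOp _

/-- The map from a pro-object to the terminal object of `C`. -/
noncomputable def Pro.toTerminal (X : Pro C) : X ⟶ Pro.const.obj (⊤_ C) :=
  (IsTerminal.isTerminalObj Pro.const (⊤_ C) terminalIsTerminal).from X

theorem Pro.toTerminal_uniq {X : Pro C} (f g : X ⟶ Pro.const.obj (⊤_ C)) : f = g :=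
  (IsTerminal.isTerminalObj Pro.const (⊤_ C) terminalIsTerminal).hom_ext f g

/-- `Pro.const.obj (a ⨯ b)` is the product of `Pro.const.obj a` and `Pro.const.obj b`. -/
noncomputable def Pro.isLimit (a b : C) :
    IsLimit (BinaryFan.mk (Pro.const.map (prod.fst : a ⨯ b ⟶ a))
      (Pro.const.map (prod.snd : a ⨯ b ⟶ b))) :=
  mapIsLimitOfPreservesOfIsLimit Pro.const _ _ (prodIsProd a b)

/-- The map `X ⟶ a ⨯ b` with components `x` and `y`. -/
noncomputable def Pro.lift {X : Pro C} {a b : C} (x : X ⟶ Pro.const.obj a)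
    (y : X ⟶ Pro.const.obj b) : X ⟶ Pro.const.obj (a ⨯ b) :=
  (BinaryFan.IsLimit.lift' (Pro.isLimit a b) x y).1

@[simp] theorem Pro.lift_fst {X : Pro C} {a b : C} (x : X ⟶ Pro.const.obj a)
    (y : X ⟶ Pro.const.obj b) : Pro.lift x y ≫ Pro.const.map prod.fst = x :=
  (BinaryFan.IsLimit.lift' (Pro.isLimit a b) x y).2.1

@[simp] theorem Pro.lift_snd {X : Pro C} {a b : C} (x : X ⟶ Pro.const.obj a)
    (y : X ⟶ Pro.const.obj b) : Pro.lift x y ≫ Pro.const.map prod.snd = y :=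
  (BinaryFan.IsLimit.lift' (Pro.isLimit a b) x y).2.2

theorem Pro.prod_hom_ext {X : Pro C} {a b : C} {f g : X ⟶ Pro.const.obj (a ⨯ b)}
    (h₁ : f ≫ Pro.const.map prod.fst = g ≫ Pro.const.map prod.fst)
    (h₂ : f ≫ Pro.const.map prod.snd = g ≫ Pro.const.map prod.snd) : f = g :=
  BinaryFan.IsLimit.hom_ext (Pro.isLimit a b) h₁ h₂

theorem Pro.map_lift {X : Pro C} {a b c : C} (x : X ⟶ Pro.const.obj c) (f : c ⟶ a) (g : c ⟶ b) :
    x ≫ Pro.const.map (prod.lift f g) =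
      Pro.lift (x ≫ Pro.const.map f) (x ≫ Pro.const.map g) := by
  apply Pro.prod_hom_ext
  · rw [Category.assoc, ← Functor.map_comp, prod.lift_fst, Pro.lift_fst]
  · rw [Category.assoc, ← Functor.map_comp, prod.lift_snd, Pro.lift_snd]

end ProObjects

/-! ### Pseudo-actions -/

universe w v₁ u₁ v₂ u₂ v₃ u₃

/-- A pseudo-action of a category `A` on a category `C`: sets `Hom X V W` (to be thought of as
`Hom(X ⊗ V, W)`, or as families of maps `V ⟶ W` parametrised by `X`), contravariant in `X`,
together with the composition of two families over the same `X` and with the constant families.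
When `A` has finite products, the composition
`Hom(Y ⊗ W, U) × Hom(X ⊗ V, W) → Hom((Y × X) ⊗ V, U)` is recovered by first pulling back both
families to `Y × X`, and the functoriality in `V` and `W` is the composition with constant
families. -/
structure PseudoAction (A : Type u₁) [Category.{v₁} A] (C : Type u₂) [Category.{v₂} C] where
  Hom : A → C → C → Type w
  pull : ∀ {X Y : A} (_ : X ⟶ Y) {V W : C}, Hom Y V W → Hom X V W
  ofHom : ∀ (X : A) {V W : C}, (V ⟶ W) → Hom X V W
  comp : ∀ {X : A} {V W U : C}, Hom X V W → Hom X W U → Hom X V U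
  pull_id : ∀ {X : A} {V W : C} (h : Hom X V W), pull (𝟙 X) h = h
  pull_pull : ∀ {X Y Z : A} (f : X ⟶ Y) (g : Y ⟶ Z) {V W : C} (h : Hom Z V W),
    pull f (pull g h) = pull (f ≫ g) h
  pull_ofHom : ∀ {X Y : A} (f : X ⟶ Y) {V W : C} (a : V ⟶ W), pull f (ofHom Y a) = ofHom X a
  pull_comp : ∀ {X Y : A} (f : X ⟶ Y) {V W U : C} (g : Hom Y V W) (h : Hom Y W U),
    pull f (comp g h) = comp (pull f g) (pull f h)
  ofHom_comp : ∀ (X : A) {V W U : C} (a : V ⟶ W) (b : W ⟶ U),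
    ofHom X (a ≫ b) = comp (ofHom X a) (ofHom X b)
  id_comp : ∀ {X : A} {V W : C} (h : Hom X V W), comp (ofHom X (𝟙 V)) h = h
  comp_id : ∀ {X : A} {V W : C} (h : Hom X V W), comp h (ofHom X (𝟙 W)) = h
  assoc : ∀ {X : A} {V W U T : C} (f : Hom X V W) (g : Hom X W U) (h : Hom X U T),
    comp (comp f g) h = comp f (comp g h)

namespace PseudoAction

variable {A : Type u₁} [Category.{v₁} A] {C : Type u₂} [Category.{v₂} C]

/-! #### Pro-objects acting: `Hom("lim" X_i ⊗ V, W) = colim_i Hom(X_i ⊗ V, W)` -/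

section Pro

variable (P : PseudoAction.{w} A C)

/-- Representatives of families over a pro-object. -/
structure ProRepr (X : Pro A) (V W : C) where
  obj : A
  map : X ⟶ Pro.const.obj obj
  val : P.Hom obj V W

/-- The relation that computes the colimit over all maps from `X` to objects of `A`. -/
inductive ProRel (X : Pro A) (V W : C) : P.ProRepr X V W → P.ProRepr X V W → Prop
  | mk {a b : A} (x : X ⟶ Pro.const.obj a) (f : a ⟶ b) (h : P.Hom b V W) :
      ProRel X V W ⟨b, x ≫ Pro.const.map f, h⟩ ⟨a, x, P.pull f h⟩

/-- `colim_i Hom(X_i ⊗ V, W)`. -/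
abbrev ProHom (X : Pro A) (V W : C) := Quot (P.ProRel X V W)

variable {P}

theorem ProHom.sound {X : Pro A} {V W : C} {a b : A} (x : X ⟶ Pro.const.obj a)
    (y : X ⟶ Pro.const.obj b) (f : a ⟶ b) (hf : x ≫ Pro.const.map f = y) (h : P.Hom b V W)
    (h' : P.Hom a V W) (e : P.pull f h = h') :
    (Quot.mk _ ⟨b, y, h⟩ : P.ProHom X V W) = Quot.mk _ ⟨a, x, h'⟩ := by
  subst hf e
  exact Quot.sound (ProRel.mk x f h)

variable [HasFiniteLimits A]

variable (P) in
theorem assoc_aux {a b c : A} {V W U T : C} (f : P.Hom a V W) (g : P.Hom b W U)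
    (h : P.Hom c U T) :
    P.pull (prod.lift (prod.fst ≫ prod.fst) (prod.lift (prod.fst ≫ prod.snd) prod.snd) :
      (a ⨯ b) ⨯ c ⟶ a ⨯ (b ⨯ c)) (P.comp (P.pull prod.fst f)
        (P.pull prod.snd (P.comp (P.pull prod.fst g) (P.pull prod.snd h)))) =
    P.comp (P.pull prod.fst (P.comp (P.pull prod.fst f) (P.pull prod.snd g)))
      (P.pull prod.snd h) := by
  simp only [P.pull_comp, P.pull_pull, P.assoc, ← Category.assoc]
  rw [prod.lift_fst, prod.lift_snd, prod.lift_fst, prod.lift_snd]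

/-- Composition of representatives: pull both back to the product of their bases. -/
noncomputable def ProRepr.comp {X : Pro A} {V W U : C} (g : P.ProRepr X V W)
    (h : P.ProRepr X W U) : P.ProRepr X V U :=
  ⟨g.obj ⨯ h.obj, Pro.lift g.map h.map, P.comp (P.pull prod.fst g.val) (P.pull prod.snd h.val)⟩

theorem ProHom.comp_aux₁ {X : Pro A} {V W U : C} (g : P.ProRepr X V W) (h h' : P.ProRepr X W U)
    (r : P.ProRel X W U h h') :
    (Quot.mk _ (g.comp h) : P.ProHom X V U) = Quot.mk _ (g.comp h') := by
  cases r with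
  | mk x f h =>
    refine ProHom.sound _ _ (prod.map (𝟙 _) f) ?_ _ _ ?_
    · apply Pro.prod_hom_ext
      · rw [Category.assoc, ← Functor.map_comp, prod.map_fst, Category.comp_id]; simp
      · rw [Category.assoc, ← Functor.map_comp, prod.map_snd, Functor.map_comp, ← Category.assoc]
        simp
    · simp [P.pull_comp, P.pull_pull]

theorem ProHom.comp_aux₂ {X : Pro A} {V W U : C} (g g' : P.ProRepr X V W) (h : P.ProRepr X W U)
    (r : P.ProRel X V W g g') :
    (Quot.mk _ (g.comp h) : P.ProHom X V U) = Quot.mk _ (g'.comp h) := by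
  cases r with
  | mk x f g =>
    refine ProHom.sound _ _ (prod.map f (𝟙 _)) ?_ _ _ ?_
    · apply Pro.prod_hom_ext
      · rw [Category.assoc, ← Functor.map_comp, prod.map_fst, Functor.map_comp, ← Category.assoc]
        simp
      · rw [Category.assoc, ← Functor.map_comp, prod.map_snd, Category.comp_id]; simp
    · simp [P.pull_comp, P.pull_pull]

/-- Composition of families over a pro-object. -/
noncomputable def ProHom.comp {X : Pro A} {V W U : C} (g : P.ProHom X V W)
    (h : P.ProHom X W U) : P.ProHom X V U :=
  Quot.lift₂ (fun g h => (Quot.mk _ (ProRepr.comp g h) : P.ProHom X V U))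
    (fun g h h' r => ProHom.comp_aux₁ g h h' r) (fun g g' h r => ProHom.comp_aux₂ g g' h r) g h

variable (P)

/-- The pseudo-action of `Pro(A)` on `C` induced by a pseudo-action of `A` on `C`, where
`Hom("lim" X_i ⊗ V, W) = colim_i Hom(X_i ⊗ V, W)`. -/
noncomputable def pro : PseudoAction (Pro A) C where
  Hom X V W := P.ProHom X V W
  pull {X Y} f {V W} := Quot.lift (fun r => Quot.mk _ ⟨r.obj, f ≫ r.map, r.val⟩) (by
    rintro _ _ ⟨x, g, h⟩
    exact ProHom.sound _ _ g (by simp) _ _ rfl)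
  ofHom X V W a := Quot.mk _ ⟨⊤_ A, Pro.toTerminal X, P.ofHom _ a⟩
  comp g h := ProHom.comp g h
  pull_id h := by
    induction h using Quot.ind with | mk h => simp
  pull_pull f g V W h := by
    induction h using Quot.ind with | mk h => simp
  pull_ofHom f V W a :=
    ProHom.sound _ _ (𝟙 _) (Pro.toTerminal_uniq _ _) _ _ (P.pull_id _)
  pull_comp f V W U g h := by
    induction g using Quot.ind with | mk g => ?_
    induction h using Quot.ind with | mk h => ?_
    refine ProHom.sound _ _ (𝟙 _) ?_ _ _ (P.pull_id _)
    apply Pro.prod_hom_ext <;> simp [ProRepr.comp]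
  ofHom_comp X V W U a b := by
    refine (ProHom.sound _ _ (terminal.from _) (Pro.toTerminal_uniq _ _) _ _ ?_).trans rfl
    rw [P.pull_ofHom, P.pull_ofHom, P.pull_ofHom, P.ofHom_comp]
  id_comp {X V W} h := by
    induction h using Quot.ind with | mk h => ?_
    refine (ProHom.sound _ _ prod.snd ?_ _ _ ?_).symm
    · exact Pro.lift_snd _ _
    · simp [P.pull_ofHom, P.id_comp]
  comp_id {X V W} h := by
    induction h using Quot.ind with | mk h => ?_
    refine (ProHom.sound _ _ prod.fst ?_ _ _ ?_).symm
    · exact Pro.lift_fst _ _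
    · simp [P.pull_ofHom, P.comp_id]
  assoc f g h := by
    induction f using Quot.ind with | mk f => ?_
    induction g using Quot.ind with | mk g => ?_
    induction h using Quot.ind with | mk h => ?_
    refine (ProHom.sound _ _ (prod.lift (prod.fst ≫ prod.fst)
      (prod.lift (prod.fst ≫ prod.snd) prod.snd)) ?_ _ _ ?_).symm
    · simp only [ProRepr.comp, Pro.map_lift, Functor.map_comp, ← Category.assoc, Pro.lift_fst,
        Pro.lift_snd]
    · exact P.assoc_aux f.val g.val h.val

end Pro

/-! #### Ind-objects acting: `Hom("colim" X_j ⊗ V, W) = lim_j Hom(X_j ⊗ V, W)` -/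

/-- The pseudo-action of `Ind(A)` on `C` induced by a pseudo-action of `A` on `C`, where
`Hom("colim" X_j ⊗ V, W) = lim_j Hom(X_j ⊗ V, W)`, the limit being taken over all maps from
objects of `A` to the given ind-object. -/
noncomputable def ind (P : PseudoAction.{w} A C) : PseudoAction (Ind A) C where
  Hom X V W := {h : ∀ (a : A), (Ind.yoneda.obj a ⟶ X) → P.Hom a V W //
    ∀ (a b : A) (f : a ⟶ b) (x : Ind.yoneda.obj b ⟶ X),
      h a (Ind.yoneda.map f ≫ x) = P.pull f (h b x)}
  pull f V W h := ⟨fun a x => h.1 a (x ≫ f), fun a b g x => by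
    simp only [Category.assoc, h.2]⟩
  ofHom X V W φ := ⟨fun a _ => P.ofHom a φ, fun a b f x => (P.pull_ofHom f φ).symm⟩
  comp g h := ⟨fun a x => P.comp (g.1 a x) (h.1 a x), fun a b f x => by
    simp only [P.pull_comp, g.2, h.2]⟩
  pull_id h := by simp
  pull_pull f g V W h := by simp
  pull_ofHom f V W a := rfl
  pull_comp f V W U g h := rfl
  ofHom_comp X V W U a b := by simp [P.ofHom_comp]
  id_comp h := by simp [P.id_comp]
  comp_id h := by simp [P.comp_id]
  assoc f g h := by simp [P.assoc]

/-! #### Acting on ind-objects: `Hom(X ⊗ "colim" V_m, "colim" W_n) = lim_m colim_n Hom(X ⊗ V_m, W_n)`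
-/

section OnInd

variable (P : PseudoAction.{w} A C) {D : Type u₃} [Category.{v₃} D] (ι : C ⥤ D)

/-- Representatives of elements of `colim_n Hom(X ⊗ V, W_n)`. -/
structure OnIndRepr (X : A) (V : C) (W : D) where
  obj : C
  map : ι.obj obj ⟶ W
  val : P.Hom X V obj

/-- The relation that computes the colimit over all maps from objects of `C` to `W`. -/
inductive OnIndRel (X : A) (V : C) (W : D) : P.OnIndRepr ι X V W → P.OnIndRepr ι X V W → Prop
  | mk {c d : C} (f : c ⟶ d) (y : ι.obj d ⟶ W) (h : P.Hom X V c) :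
      OnIndRel X V W ⟨c, ι.map f ≫ y, h⟩ ⟨d, y, P.comp h (P.ofHom X f)⟩

/-- `colim_n Hom(X ⊗ V, W_n)`. -/
abbrev OnIndColim (X : A) (V : C) (W : D) := Quot (P.OnIndRel ι X V W)

variable {P ι}

/-- Pulling back along a map `X ⟶ Y` of the acting category. -/
def OnIndColim.pull {X Y : A} (f : X ⟶ Y) {V : C} {W : D} :
    P.OnIndColim ι Y V W → P.OnIndColim ι X V W :=
  Quot.lift (fun r => Quot.mk _ ⟨r.obj, r.map, P.pull f r.val⟩) (by
    rintro _ _ ⟨g, y, h⟩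
    simp only [P.pull_comp, P.pull_ofHom]
    exact Quot.sound ⟨g, y, P.pull f h⟩)

/-- Precomposition with a family in `C`. -/
def OnIndColim.precomp {X : A} {U V : C} (g : P.Hom X U V) {W : D} :
    P.OnIndColim ι X V W → P.OnIndColim ι X U W :=
  Quot.lift (fun r => Quot.mk _ ⟨r.obj, r.map, P.comp g r.val⟩) (by
    rintro _ _ ⟨f, y, h⟩
    simp only [← P.assoc]
    exact Quot.sound ⟨f, y, P.comp g h⟩)

variable (P ι) in
/-- `lim_m colim_n Hom(X ⊗ V_m, W_n)`, the limit being taken over all maps from objects of `C`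
to `V`. -/
abbrev OnIndHom (X : A) (V W : D) :=
  {h : ∀ (c : C), (ι.obj c ⟶ V) → P.OnIndColim ι X c W //
    ∀ (c d : C) (f : c ⟶ d) (v : ι.obj d ⟶ V),
      h c (ι.map f ≫ v) = (h d v).precomp (P.ofHom X f)}

/-- Substitution of a family `g` of maps `W ⟶ U` in an element of `colim_n Hom(X ⊗ V, W_n)`. -/
def OnIndColim.bind {X : A} {V : C} {W U : D} (r : P.OnIndColim ι X V W)
    (g : P.OnIndHom ι X W U) : P.OnIndColim ι X V U :=
  Quot.lift (fun r => (g.1 r.obj r.map).precomp r.val) (by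
    rintro _ _ ⟨f, y, h⟩
    simp only [g.2]
    induction g.1 _ y using Quot.ind with | mk s => ?_
    simp [OnIndColim.precomp, P.assoc]) r

variable (P ι)

/-- The pseudo-action of `A` on ind-objects induced by a pseudo-action of `A` on `C`, where
`Hom(X ⊗ "colim" V_m, "colim" W_n) = lim_m colim_n Hom(X ⊗ V_m, W_n)`. Here `D` is the category
of ind-objects of `C`, given with the embedding `ι` of `C`. -/
def onInd : PseudoAction A D where
  Hom X V W := P.OnIndHom ι X V W
  pull f V W h := ⟨fun c v => (h.1 c v).pull f, fun c d g v => by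
    simp only [h.2]
    induction h.1 _ v using Quot.ind with | mk s => ?_
    simp [OnIndColim.precomp, OnIndColim.pull, P.pull_comp, P.pull_ofHom]⟩
  ofHom X V W a := ⟨fun c v => Quot.mk _ ⟨c, v ≫ a, P.ofHom X (𝟙 c)⟩, fun c d f v => by
    simp only [OnIndColim.precomp, P.comp_id, Category.assoc]
    refine (Quot.sound ⟨f, v ≫ a, P.ofHom X (𝟙 c)⟩).trans ?_
    rw [P.id_comp]⟩
  comp g h := ⟨fun c v => (g.1 c v).bind h, fun c d f v => by
    simp only [g.2]
    induction g.1 _ v using Quot.ind with | mk s => ?_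
    simp only [OnIndColim.precomp, OnIndColim.bind]
    induction h.1 _ s.map using Quot.ind with | mk s => ?_
    simp [P.assoc]⟩
  pull_id h := by
    refine Subtype.ext (funext fun c => funext fun v => ?_)
    dsimp only
    induction h.1 c v using Quot.ind with | mk s => ?_
    simp [OnIndColim.pull, P.pull_id]
  pull_pull f g V W h := by
    refine Subtype.ext (funext fun c => funext fun v => ?_)
    dsimp only
    induction h.1 c v using Quot.ind with | mk s => ?_
    simp [OnIndColim.pull, P.pull_pull]
  pull_ofHom f V W a := by
    refine Subtype.ext (funext fun c => funext fun v => ?_)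
    simp [OnIndColim.pull, P.pull_ofHom]
  pull_comp f V W U g h := by
    refine Subtype.ext (funext fun c => funext fun v => ?_)
    dsimp only
    induction g.1 c v using Quot.ind with | mk s => ?_
    simp only [OnIndColim.pull, OnIndColim.bind, OnIndColim.precomp]
    induction h.1 _ s.map using Quot.ind with | mk s => ?_
    simp [P.pull_comp]
  ofHom_comp X V W U a b := by
    refine Subtype.ext (funext fun c => funext fun v => ?_)
    simp [OnIndColim.bind, OnIndColim.precomp, P.id_comp]
  id_comp h := by
    refine Subtype.ext (funext fun c => funext fun v => ?_)
    simp only [OnIndColim.bind, OnIndColim.precomp, Category.comp_id]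
    induction h.1 c v using Quot.ind with | mk s => ?_
    simp [P.id_comp]
  comp_id h := by
    refine Subtype.ext (funext fun c => funext fun v => ?_)
    dsimp only
    induction h.1 c v using Quot.ind with | mk s => ?_
    simp [OnIndColim.bind, OnIndColim.precomp, P.comp_id]
  assoc f g h := by
    refine Subtype.ext (funext fun c => funext fun v => ?_)
    dsimp only
    induction f.1 c v using Quot.ind with | mk s => ?_
    simp only [OnIndColim.bind, OnIndColim.precomp]
    induction g.1 _ s.map using Quot.ind with | mk s => ?_
    dsimp only
    induction h.1 _ s.map using Quot.ind with | mk s => ?_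
    simp [P.assoc]

end OnInd

/-! #### Acting on pro-objects: `Hom(X ⊗ "lim" V_n, "lim" W_k) = lim_k colim_n Hom(X ⊗ V_n, W_k)` -/

section OnPro

variable (P : PseudoAction.{w} A C)

/-- Representatives of elements of `colim_n Hom(X ⊗ V_n, W)`. -/
structure OnProRepr (X : A) (V : Pro C) (W : C) where
  obj : C
  map : V ⟶ Pro.const.obj obj
  val : P.Hom X obj W

/-- The relation that computes the colimit over all maps from `V` to objects of `C`. -/
inductive OnProRel (X : A) (V : Pro C) (W : C) :
    P.OnProRepr X V W → P.OnProRepr X V W → Prop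
  | mk {c d : C} (y : V ⟶ Pro.const.obj c) (f : c ⟶ d) (h : P.Hom X d W) :
      OnProRel X V W ⟨d, y ≫ Pro.const.map f, h⟩ ⟨c, y, P.comp (P.ofHom X f) h⟩

/-- `colim_n Hom(X ⊗ V_n, W)`. -/
abbrev OnProColim (X : A) (V : Pro C) (W : C) := Quot (P.OnProRel X V W)

variable {P}

/-- Pulling back along a map `X ⟶ Y` of the acting category. -/
def OnProColim.pull {X Y : A} (f : X ⟶ Y) {V : Pro C} {W : C} :
    P.OnProColim Y V W → P.OnProColim X V W :=
  Quot.lift (fun r => Quot.mk _ ⟨r.obj, r.map, P.pull f r.val⟩) (by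
    rintro _ _ ⟨y, g, h⟩
    simp only [P.pull_comp, P.pull_ofHom]
    exact Quot.sound ⟨y, g, P.pull f h⟩)

/-- Postcomposition with a family in `C`. -/
def OnProColim.postcomp {X : A} {V : Pro C} {W U : C} (r : P.OnProColim X V W)
    (g : P.Hom X W U) : P.OnProColim X V U :=
  Quot.lift (fun r => Quot.mk _ ⟨r.obj, r.map, P.comp r.val g⟩) (by
    rintro _ _ ⟨y, f, h⟩
    simp only [P.assoc]
    exact Quot.sound ⟨y, f, P.comp h g⟩) r

variable (P) in
/-- `lim_k colim_n Hom(X ⊗ V_n, W_k)`, the limit being taken over all maps from `W` to objects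
of `C`. -/
abbrev OnProHom (X : A) (V W : Pro C) :=
  {h : ∀ (c : C), (W ⟶ Pro.const.obj c) → P.OnProColim X V c //
    ∀ (c d : C) (f : c ⟶ d) (y : W ⟶ Pro.const.obj c),
      h d (y ≫ Pro.const.map f) = (h c y).postcomp (P.ofHom X f)}

/-- Substitution of a family `g` of maps `V ⟶ W` in an element of `colim_n Hom(X ⊗ W_n, U)`. -/
def OnProColim.bind {X : A} {V W : Pro C} {U : C} (r : P.OnProColim X W U)
    (g : P.OnProHom X V W) : P.OnProColim X V U :=
  Quot.lift (fun r => (g.1 r.obj r.map).postcomp r.val) (by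
    rintro _ _ ⟨y, f, h⟩
    simp only [g.2]
    induction g.1 _ y using Quot.ind with | mk s => ?_
    simp [OnProColim.postcomp, P.assoc]) r

variable (P)

/-- The pseudo-action of `A` on `Pro(C)` induced by a pseudo-action of `A` on `C`, where
`Hom(X ⊗ "lim" V_n, "lim" W_k) = lim_k colim_n Hom(X ⊗ V_n, W_k)`. -/
noncomputable def onPro : PseudoAction A (Pro C) where
  Hom X V W := P.OnProHom X V W
  pull f V W h := ⟨fun c y => (h.1 c y).pull f, fun c d g y => by
    simp only [h.2]
    induction h.1 _ y using Quot.ind with | mk s => ?_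
    simp [OnProColim.postcomp, OnProColim.pull, P.pull_comp, P.pull_ofHom]⟩
  ofHom X V W a := ⟨fun c y => Quot.mk _ ⟨c, a ≫ y, P.ofHom X (𝟙 c)⟩, fun c d f y => by
    simp only [OnProColim.postcomp, P.id_comp, ← Category.assoc]
    refine (Quot.sound ⟨a ≫ y, f, P.ofHom X (𝟙 d)⟩).trans ?_
    rw [P.comp_id]⟩
  comp g h := ⟨fun c y => (h.1 c y).bind g, fun c d f y => by
    simp only [h.2]
    induction h.1 _ y using Quot.ind with | mk s => ?_
    simp only [OnProColim.postcomp, OnProColim.bind]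
    induction g.1 _ s.map using Quot.ind with | mk s => ?_
    simp [P.assoc]⟩
  pull_id h := by
    refine Subtype.ext (funext fun c => funext fun y => ?_)
    dsimp only
    induction h.1 c y using Quot.ind with | mk s => ?_
    simp [OnProColim.pull, P.pull_id]
  pull_pull f g V W h := by
    refine Subtype.ext (funext fun c => funext fun y => ?_)
    dsimp only
    induction h.1 c y using Quot.ind with | mk s => ?_
    simp [OnProColim.pull, P.pull_pull]
  pull_ofHom f V W a := by
    refine Subtype.ext (funext fun c => funext fun y => ?_)
    simp [OnProColim.pull, P.pull_ofHom]
  pull_comp f V W U g h := by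
    refine Subtype.ext (funext fun c => funext fun y => ?_)
    dsimp only
    induction h.1 c y using Quot.ind with | mk s => ?_
    simp only [OnProColim.pull, OnProColim.bind, OnProColim.postcomp]
    induction g.1 _ s.map using Quot.ind with | mk s => ?_
    simp [P.pull_comp]
  ofHom_comp X V W U a b := by
    refine Subtype.ext (funext fun c => funext fun y => ?_)
    simp [OnProColim.bind, OnProColim.postcomp, P.id_comp]
  id_comp h := by
    refine Subtype.ext (funext fun c => funext fun y => ?_)
    dsimp only
    induction h.1 c y using Quot.ind with | mk s => ?_
    simp [OnProColim.bind, OnProColim.postcomp, P.id_comp]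
  comp_id h := by
    refine Subtype.ext (funext fun c => funext fun y => ?_)
    simp only [OnProColim.bind, OnProColim.postcomp, Category.id_comp]
    induction h.1 c y using Quot.ind with | mk s => ?_
    simp [P.comp_id]
  assoc f g h := by
    refine Subtype.ext (funext fun c => funext fun y => ?_)
    dsimp only
    induction h.1 c y using Quot.ind with | mk s => ?_
    simp only [OnProColim.bind, OnProColim.postcomp]
    induction g.1 _ s.map using Quot.ind with | mk s => ?_
    dsimp only
    induction f.1 _ s.map using Quot.ind with | mk s => ?_
    simp [P.assoc]

end OnPro

end PseudoAction

/-! ### The pseudo-action of `BSet` on pro-vector spaces -/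

/-- `Ind(Pro(Set₀))`, where `Set₀` is the category of finite sets. -/
abbrev IndProFin : Type (u + 1) := Ind (Pro FintypeCat.{u})

/-- `Ind(Pro(Ind(Pro(Set₀))))`. -/
abbrev BSet : Type (u + 1) := Ind (Pro IndProFin.{u})

noncomputable instance : CartesianMonoidalCategory BSet.{u} :=
  CartesianMonoidalCategory.ofHasFiniteProducts

/-- The category of pro-vector spaces. -/
abbrev ProVect (k : Type u) [Field k] : Type (u + 1) := Pro (ModuleCat.{u} k)

/-- The action of finite sets on finite-dimensional vector spaces: a family of maps parametrised
by a finite set `X` is a map from `X` to the set of linear maps. -/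
def finAction (k : Type u) [Field k] : PseudoAction FintypeCat.{u} (FGModuleCat.{u} k) where
  Hom X V W := X → (V ⟶ W)
  pull f V W h := fun x => h (f x)
  ofHom X V W a := fun _ => a
  comp g h := fun x => g x ≫ h x
  pull_id h := by simp
  pull_pull f g V W h := by simp
  pull_ofHom f V W a := rfl
  pull_comp f V W U g h := rfl
  ofHom_comp X V W U a b := rfl
  id_comp h := by simp
  comp_id h := by simp
  assoc f g h := by simp

/-- The pseudo-action of `Ind(Pro(Set₀))` on the category of vector spaces
(the latter being the category of ind-objects of finite-dimensional vector spaces):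
`Hom("colim_j" "lim_i" X_i^j ⊗ colim_m V_m, colim_n W_n)
  = lim_j lim_m colim_n colim_i Hom(X_i^j ⊗ V_m, W_n)`. -/
noncomputable def vectAction (k : Type u) [Field k] :
    PseudoAction IndProFin.{u} (ModuleCat.{u} k) :=
  ((finAction k).pro.onInd (ModuleCat.isFG k).ι).ind

/-- The pseudo-action of `BSet` on the category of pro-vector spaces:
`Hom("colim_j" "lim_l" X_l^j ⊗ "lim_n" V_n, "lim_m" W_m)
  = lim_j lim_m colim_n colim_l Hom(X_l^j ⊗ V_n, W_m)`. -/
noncomputable def bsetAction (k : Type u) [Field k] : PseudoAction BSet.{u} (ProVect k) :=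
  (vectAction k).pro.onPro.ind

/-! ### Condition (**) -/

/-- A map `f : X ⟶ Y` in `Ind(Pro(Set₀))` is weakly surjective if two maps from `Y` to a finite
set (that is, two locally constant functions on `Y` with values in a finite set) that agree on `X`
are equal. If `Y` is locally compact, this says that the image of `X` is dense in `Y`. -/
def WeaklySurjective {X Y : IndProFin.{u}} (f : X ⟶ Y) : Prop :=
  ∀ (Z : FintypeCat.{u}) (g h : Y ⟶ Ind.yoneda.obj (Pro.const.obj Z)), f ≫ g = f ≫ h → g = h

/-- An object of `Pro(Ind(Pro(Set₀)))` is weakly strict if it can be represented as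
`"lim" X_i` with weakly surjective transition maps. -/
def WeaklyStrict (X : Pro IndProFin.{u}) : Prop :=
  ∃ p : IndObjectPresentation ((Ind.inclusion _).obj X.unop),
    ∀ (i j : p.I) (f : i ⟶ j), WeaklySurjective (p.F.map f).unop

/-- Condition (**): `X` can be represented as `"colim" X_k` with all `X_k` weakly strict. -/
def ConditionStarStar (X : BSet.{u}) : Prop :=
  ∃ p : IndObjectPresentation ((Ind.inclusion _).obj X), ∀ i : p.I, WeaklyStrict (p.F.obj i)

/-! ### Representations -/

open CartesianMonoidalCategory MonObj

/-- A representation of the group object `G` of `BSet` on a pro-vector space: an action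
`ρ : G × V → V` in the sense of the pseudo-action, such that `g₁(g₂v) = (g₁g₂)v` as families
parametrised by `(g₁, g₂) ∈ G × G`, and `1v = v`. -/
structure Rep (k : Type u) [Field k] (G : BSet.{u}) [GrpObj G] where
  V : ProVect k
  ρ : (bsetAction k).Hom G V V
  mul_act : (bsetAction k).pull (mul : MonoidalCategory.tensorObj G G ⟶ G) ρ =
    (bsetAction k).comp ((bsetAction k).pull (snd G G) ρ) ((bsetAction k).pull (fst G G) ρ)
  one_act : (bsetAction k).pull (one : MonoidalCategory.tensorUnit BSet.{u} ⟶ G) ρ =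
    (bsetAction k).ofHom _ (𝟙 V)

namespace Rep

variable {k : Type u} [Field k] {G : BSet.{u}} [GrpObj G]

/-- A map of representations is a map of pro-vector spaces compatible with the actions. -/
@[ext]
structure Hom (M N : Rep k G) where
  hom : M.V ⟶ N.V
  comm : (bsetAction k).comp M.ρ ((bsetAction k).ofHom G hom) =
    (bsetAction k).comp ((bsetAction k).ofHom G hom) N.ρ

noncomputable instance : Category (Rep k G) where
  Hom M N := Hom M N
  id M := ⟨𝟙 M.V, by rw [PseudoAction.id_comp, PseudoAction.comp_id]⟩
  comp f g := ⟨f.hom ≫ g.hom, by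
    rw [PseudoAction.ofHom_comp, ← PseudoAction.assoc, f.comm, PseudoAction.assoc, g.comm,
      PseudoAction.assoc]⟩
  id_comp f := Hom.ext (Category.id_comp _)
  comp_id f := Hom.ext (Category.comp_id _)
  assoc f g h := Hom.ext (Category.assoc _ _ _)

variable (k G) in
/-- The forgetful functor to pro-vector spaces. -/
noncomputable def forget : Rep k G ⥤ ProVect k where
  obj M := M.V
  map f := f.hom

/-- Restriction of representations along a homomorphism of group objects. -/
noncomputable def restrict (k : Type u) [Field k] {G₁ G₂ : BSet.{u}} [GrpObj G₁] [GrpObj G₂]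
    (φ : G₁ ⟶ G₂) [IsMonHom φ] : Rep k G₂ ⥤ Rep k G₁ where
  obj M :=
    { V := M.V
      ρ := (bsetAction k).pull φ M.ρ
      mul_act := by
        simp only [PseudoAction.pull_pull, IsMonHom.mul_hom]
        rw [← PseudoAction.pull_pull, M.mul_act, PseudoAction.pull_comp,
          PseudoAction.pull_pull, PseudoAction.pull_pull, tensorHom_fst, tensorHom_snd]
      one_act := by
        rw [PseudoAction.pull_pull, IsMonHom.one_hom, M.one_act] }
  map f := ⟨f.hom, by
    have h := congrArg ((bsetAction k).pull φ) f.comm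
    simpa only [PseudoAction.pull_comp, PseudoAction.pull_ofHom] using h⟩
  map_id M := rfl
  map_comp f g := rfl

end Rep

end ProRep

/-! All three assertions come from the adjoint functor theorem. The second asks for a left adjoint
to restriction, and the third for left adjoints to the constant-diagram functors. Small limits in
`Rep k G` exist and are computed in `ProVect k`. The reason is that families parametrised by `X` on
`V` are corepresented by a pro-vector space `X ⊗ V` (`BFam.exists_tensor`), so a family of maps into
a limit is a compatible system of families. What remains is a solution set: for each `V`, a small
collection of maps `V ⟶ N i` through which every `V ⟶ M` factors (`Rep.exists_solutionSet`).

The natural candidate is the subrepresentation generated by the image of `f : V ⟶ M`. The family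
`(g, v) ↦ g (f v)` factors as an epimorphic family `τ` into some `I` followed by an embedding `I ⟶
M` (`exists_image`). The issue is whether `I` is stable under `G`. A map killing `I` kills `g₁ g₂ (f
v)`, that is, it kills `g₁` applied to the values of `τ`. To conclude that it kills `g₁` applied to
`I`, a family out of `I` parametrised by `G` must be determined by its composite with `τ` over `G ×
G`. This cancellation is `Fam.eq_of_bind_eq`, and it is the point where condition (**) enters. Two
families out of `I` live over a finite stage `b` and a quotient stage `d` of `I`. Their composites
with `τ` agree only over some later stage mapping to `b`. Weak surjectivity of the transition map
carries the agreement back to all of `b`. So `τ` takes values in the subspace of `d` where the two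
families coincide, and since `τ` is epimorphic, `I ⟶ d` factors through that subspace.

The arguments inside families are pointwise: over `Ind(Pro(Set₀))` a family of linear maps is a
function on points that is locally constant on each vector (`ev_injective`, `isLocConst_ev`,
`exists_ev`). Smallness comes from `BFam.exists_bound`: every family on `X` and `V` factors through
a quotient of one fixed vector space `K`. A generated representation is therefore determined by a
set of families valued in quotients of `K`.

The factorisation `V ⟶ N i ⟶ M` is arranged with `N i ⟶ M` an embedding. Equivariance of a map into
`N i` can then be tested in `M`, so the same collection yields solution sets for restriction and for
colimits. -/

namespace ProRep

/-! ### Generalities on ind-objects -/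

section IndObjects

universe v w u'

variable {C : Type u'} [Category.{v} C]

/-- Maps from an object of `C` to an ind-object are the elements of the corresponding presheaf. -/
noncomputable def indElt (X : Ind C) (c : C) :
    (Ind.yoneda.obj c ⟶ X) ≃ ((Ind.inclusion C).obj X).obj (Opposite.op c) :=
  (Ind.inclusion.fullyFaithful.homEquiv.trans
    ((Ind.yonedaCompInclusion.app c).homFromEquiv)).trans yonedaEquiv

theorem indElt_map {X : Ind C} {c d : C} (f : c ⟶ d) (x : Ind.yoneda.obj d ⟶ X) :
    indElt X c (Ind.yoneda.map f ≫ x) = ((Ind.inclusion C).obj X).map f.op (indElt X d x) := by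
  have h := Ind.yonedaCompInclusion.inv.naturality f
  simp only [Functor.comp_map] at h
  simp only [indElt, Equiv.trans_apply, Functor.FullyFaithful.homEquiv_apply, Functor.map_comp,
    Iso.homFromEquiv_apply, Iso.app_inv]
  rw [← Category.assoc, ← h, Category.assoc, yonedaEquiv_naturality]

theorem indElt_comp {X Y : Ind C} {c : C} (x : Ind.yoneda.obj c ⟶ X) (m : X ⟶ Y) :
    indElt Y c (x ≫ m) = ((Ind.inclusion C).map m).app _ (indElt X c x) := by
  simp only [indElt, Equiv.trans_apply, Functor.FullyFaithful.homEquiv_apply, Functor.map_comp,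
    Iso.homFromEquiv_apply, Iso.app_inv]
  rw [← Category.assoc, yonedaEquiv_comp]

theorem indElt_symm_map {X : Ind C} {c d : C} (f : c ⟶ d)
    (x : ((Ind.inclusion C).obj X).obj (Opposite.op d)) :
    Ind.yoneda.map f ≫ (indElt X d).symm x =
      (indElt X c).symm (((Ind.inclusion C).obj X).map f.op x) := by
  apply (indElt X c).injective
  rw [indElt_map, Equiv.apply_symm_apply, Equiv.apply_symm_apply]

theorem ind_hom_ext {X Y : Ind C} {f g : X ⟶ Y}
    (h : ∀ (c : C) (x : Ind.yoneda.obj c ⟶ X), x ≫ f = x ≫ g) : f = g := by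
  apply (Ind.inclusion C).map_injective
  ext c x
  obtain ⟨x, rfl⟩ := (indElt X c.unop).surjective x
  exact (indElt_comp x f).symm.trans ((congrArg _ (h _ x)).trans (indElt_comp x g))

/-- The inclusion of ind-objects into presheaves is full, and `indElt` identifies sections of the
presheaf with maps from objects of `C`. This allows maps to be built with no chosen presentation. -/
theorem ind_exists_hom {X Y : Ind C}
    (φ : ∀ c : C, (Ind.yoneda.obj c ⟶ X) → (Ind.yoneda.obj c ⟶ Y))
    (hφ : ∀ (c d : C) (f : c ⟶ d) (x : Ind.yoneda.obj d ⟶ X),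
      φ c (Ind.yoneda.map f ≫ x) = Ind.yoneda.map f ≫ φ d x) :
    ∃ m : X ⟶ Y, ∀ (c : C) (x : Ind.yoneda.obj c ⟶ X), x ≫ m = φ c x := by
  let η : (Ind.inclusion C).obj X ⟶ (Ind.inclusion C).obj Y :=
    { app := fun c => ↾(fun x => indElt Y c.unop (φ c.unop ((indElt X c.unop).symm x)))
      naturality := fun c d f => by
        ext x
        have h := hφ _ _ f.unop ((indElt X c.unop).symm x)
        rw [indElt_symm_map] at h
        have h' := congrArg (indElt Y _) h
        rw [indElt_map] at h'
        exact h' }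
  refine ⟨(Ind.inclusion C).preimage η, fun c x => (indElt Y c).injective ?_⟩
  rw [indElt_comp, Functor.map_preimage]
  change indElt Y c (φ c ((indElt X c).symm (indElt X c x))) = _
  rw [Equiv.symm_apply_apply]

/-- `X` is the filtered colimit of the objects `F i` of `C`, in terms of maps from objects of
`C`. -/
structure Presents {I : Type w} [Category.{w} I] (F : I ⥤ C) (X : Ind C)
    (ι : ∀ i, Ind.yoneda.obj (F.obj i) ⟶ X) : Prop where
  naturality : ∀ {i j : I} (f : i ⟶ j), Ind.yoneda.map (F.map f) ≫ ι j = ι i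
  exists_factor : ∀ {c : C} (x : Ind.yoneda.obj c ⟶ X),
    ∃ (i : I) (g : c ⟶ F.obj i), Ind.yoneda.map g ≫ ι i = x
  exists_eq : ∀ {c : C} {i : I} (g g' : c ⟶ F.obj i),
    Ind.yoneda.map g ≫ ι i = Ind.yoneda.map g' ≫ ι i → ∃ (j : I) (f : i ⟶ j),
      g ≫ F.map f = g' ≫ F.map f

namespace Presents

variable {I : Type w} [Category.{w} I] {F : I ⥤ C} {X : Ind C}
  {ι : ∀ i, Ind.yoneda.obj (F.obj i) ⟶ X}

theorem exists_desc [IsFiltered I] (h : Presents F X ι) {Y : Ind C}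
    (m : ∀ i, Ind.yoneda.obj (F.obj i) ⟶ Y)
    (hm : ∀ {i j : I} (f : i ⟶ j), Ind.yoneda.map (F.map f) ≫ m j = m i) :
    ∃ φ : X ⟶ Y, ∀ i, ι i ≫ φ = m i := by
  -- The value assigned to a map into `X` does not depend on the stage through which it is factored:
  -- two factorisations become equal at a common later stage.
  have key : ∀ {c : C} {i j : I} (g : c ⟶ F.obj i) (g' : c ⟶ F.obj j),
      Ind.yoneda.map g ≫ ι i = Ind.yoneda.map g' ≫ ι j →
        Ind.yoneda.map g ≫ m i = Ind.yoneda.map g' ≫ m j := by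
    intro c i j g g' e
    have e' : Ind.yoneda.map (g ≫ F.map (IsFiltered.leftToMax i j)) ≫ ι (IsFiltered.max i j) =
        Ind.yoneda.map (g' ≫ F.map (IsFiltered.rightToMax i j)) ≫ ι _ := by
      rw [Functor.map_comp, Functor.map_comp, Category.assoc, Category.assoc, h.naturality,
        h.naturality, e]
    obtain ⟨l, f, hf⟩ := h.exists_eq _ _ e'
    rw [← hm (IsFiltered.leftToMax i j), ← hm (IsFiltered.rightToMax i j), ← hm f]
    have e'' := congrArg (fun t => Ind.yoneda.map t ≫ m l) hf
    simpa only [Functor.map_comp, Category.assoc] using e''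
  choose i g hg using fun (c : C) (x : Ind.yoneda.obj c ⟶ X) => h.exists_factor x
  obtain ⟨φ, hφ⟩ := ind_exists_hom (Y := Y) (fun c x => Ind.yoneda.map (g c x) ≫ m (i c x))
    (fun c d f x => by
      rw [← Category.assoc, ← Functor.map_comp]
      apply key
      rw [hg, Functor.map_comp, Category.assoc, hg])
  refine ⟨φ, fun j => ?_⟩
  rw [hφ]
  refine (key _ (𝟙 _) ?_).trans ?_
  · rw [hg, CategoryTheory.Functor.map_id, Category.id_comp]
  · rw [CategoryTheory.Functor.map_id, Category.id_comp]

end Presents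

theorem _root_.CategoryTheory.Limits.IndObjectPresentation.presents {X : Ind C}
    (p : IndObjectPresentation ((Ind.inclusion C).obj X)) :
    Presents p.F X (fun i => (indElt X (p.F.obj i)).symm (yonedaEquiv (p.ι.app i))) where
  naturality {i j} f := by
    rw [indElt_symm_map]
    congr 1
    have h := congrArg (fun t => yonedaEquiv t) (p.ι.naturality f)
    refine (yonedaEquiv_naturality (p.ι.app j) (p.F.map f)).trans (h.trans ?_)
    simp
  exists_factor {c} x := by
    obtain ⟨i, y, hy⟩ := Types.jointly_surjective_of_isColimit
      (isColimitOfPreserves ((evaluation _ _).obj (Opposite.op c)) p.isColimit) (indElt X c x)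
    refine ⟨i, y, ?_⟩
    apply (indElt X c).injective
    rw [indElt_symm_map, Equiv.apply_symm_apply, ← hy]
    exact map_yonedaEquiv (p.ι.app i) y
  exists_eq {c i} g g' e := by
    have e' := congrArg (indElt X c) e
    rw [indElt_symm_map, Equiv.apply_symm_apply, indElt_symm_map, Equiv.apply_symm_apply] at e'
    have e'' := ((map_yonedaEquiv (p.ι.app i) g).symm.trans e').trans
      (map_yonedaEquiv (p.ι.app i) g')
    obtain ⟨k, f, f', h⟩ := (Types.FilteredColimit.isColimit_eq_iff _
      (isColimitOfPreserves ((evaluation _ _).obj (Opposite.op c)) p.isColimit)).1 e''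
    -- Equality in the filtered colimit supplies two possibly different transition maps;
    -- coequalizing them leaves a single one.
    refine ⟨IsFiltered.coeq f f', f ≫ IsFiltered.coeqHom f f', ?_⟩
    have h' : g ≫ p.F.map f = g' ≫ p.F.map f' := h
    rw [Functor.map_comp, ← Category.assoc, h', Category.assoc, ← Functor.map_comp,
      ← IsFiltered.coeq_condition, Functor.map_comp]

theorem exists_presents {I : Type v} [SmallCategory I] [IsFiltered I] (F : I ⥤ C) :
    ∃ (X : Ind C) (ι : ∀ i, Ind.yoneda.obj (F.obj i) ⟶ X), Presents F X ι := by
  let p := IndObjectPresentation.ofCocone (colimit.cocone (F ⋙ yoneda)) (colimit.isColimit _)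
  let X : Ind C := (Ind.equivalence C).inverse.obj ⟨_, .mk p⟩
  let e : colimit (F ⋙ yoneda) ≅ (Ind.inclusion C).obj X :=
    (ObjectProperty.ι _).mapIso ((Ind.equivalence C).counitIso.app ⟨_, .mk p⟩).symm
  exact ⟨X, _, (p.extend e.hom).presents⟩

/-- A functor is pro-representable as soon as its category of elements is cofiltered and has a
small weakly initial family. -/
theorem Pro.exists_corepresenting (Φ : C → Type w) (map : ∀ {c d : C}, (c ⟶ d) → Φ c → Φ d)
    (map_id : ∀ (c : C) (ξ : Φ c), map (𝟙 c) ξ = ξ)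
    (map_comp : ∀ {c d e : C} (f : c ⟶ d) (g : d ⟶ e) (ξ : Φ c),
      map (f ≫ g) ξ = map g (map f ξ))
    (nonempty : ∃ c : C, Nonempty (Φ c))
    (pair : ∀ {c d : C} (ξ : Φ c) (η : Φ d), ∃ (e : C) (ζ : Φ e) (f : e ⟶ c) (g : e ⟶ d),
      map f ζ = ξ ∧ map g ζ = η)
    (equalize : ∀ {c d : C} (f g : c ⟶ d) (ξ : Φ c), map f ξ = map g ξ →
      ∃ (e : C) (i : e ⟶ c) (ζ : Φ e), i ≫ f = i ≫ g ∧ map i ζ = ξ)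
    (small : ∃ (J : Type v) (c : J → C) (ξ : ∀ j, Φ (c j)), ∀ (d : C) (η : Φ d),
      ∃ (j : J) (f : c j ⟶ d), map f (ξ j) = η) :
    ∃ (T : Pro C) (e : ∀ c : C, (T ⟶ Pro.const.obj c) ≃ Φ c),
      ∀ {c d : C} (f : c ⟶ d) (t : T ⟶ Pro.const.obj c),
        e d (t ≫ Pro.const.map f) = map f (e c t) := by
  obtain ⟨J, cJ, ξJ, hJ⟩ := small
  have hsmall : ∀ d, Small.{v} (Φ d) := fun d =>
    small_of_surjective (f := fun (x : Σ j, (cJ j ⟶ d)) => map x.2 (ξJ x.1)) fun η => by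
      obtain ⟨j, f, h⟩ := hJ d η
      exact ⟨⟨j, f⟩, h⟩
  -- This is `Φ` as a presheaf on `Cᵒᵖ`, shrunk into the universe of the hom-sets. The weakly
  -- initial family is what makes its values small.
  let A : Cᵒᵖᵒᵖ ⥤ Type v :=
    { obj := fun c => Shrink.{v} (Φ c.unop.unop)
      map := fun f => ↾(fun x => equivShrink _ (map f.unop.unop ((equivShrink _).symm x)))
      map_id := fun c => by ext x; simp [map_id]
      map_comp := fun f g => by ext x; simp [map_comp] }
  have hmap : ∀ {c d : C} (f : c ⟶ d) (ξ : Φ c),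
      A.map f.op.op (equivShrink _ ξ) = equivShrink _ (map f ξ) := fun f ξ => by
    change equivShrink _ (map _ ((equivShrink _).symm _)) = _
    rw [Equiv.symm_apply_apply]
    rfl
  let el (c : C) (ξ : Φ c) : CostructuredArrow yoneda A :=
    CostructuredArrow.mk (Y := Opposite.op c)
      ((yonedaEquiv (X := Opposite.op c) (F := A)).symm (equivShrink (Φ c) ξ))
  have exists_el : ∀ x : CostructuredArrow yoneda A, ∃ ξ : Φ x.left.unop, x = el _ ξ := by
    intro x
    refine ⟨(equivShrink _).symm (yonedaEquiv x.hom), ?_⟩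
    have : (yonedaEquiv (X := x.left) (F := A)).symm
      (equivShrink (Φ x.left.unop) ((equivShrink _).symm (yonedaEquiv x.hom))) = x.hom := by
      rw [Equiv.apply_symm_apply, Equiv.symm_apply_apply]
    exact (CostructuredArrow.eq_mk x).trans (congrArg _ this.symm)
  have homEl : ∀ {c d : C} (ξ : Φ c) (η : Φ d) (f : d ⟶ c), map f η = ξ →
      ∃ g : el c ξ ⟶ el d η, g.left = f.op := by
    rintro c d _ η f rfl
    refine ⟨CostructuredArrow.homMk f.op ?_, rfl⟩
    apply yonedaEquiv.injective
    refine (yonedaEquiv_naturality _ _).symm.trans ?_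
    simp only [el, CostructuredArrow.mk_hom_eq_self, Equiv.apply_symm_apply]
    exact hmap f η
  have map_of_hom : ∀ {c d : C} (ξ : Φ c) (η : Φ d) (g : el c ξ ⟶ el d η),
      map g.left.unop η = ξ := by
    intro c d ξ η g
    have h := congrArg yonedaEquiv (CostructuredArrow.w g)
    have h' := (yonedaEquiv_naturality _ _).trans h
    simp only [el, CostructuredArrow.mk_hom_eq_self, Equiv.apply_symm_apply] at h'
    exact (equivShrink _).injective ((hmap g.left.unop η).symm.trans h')
  -- Filteredness here is `pair` and `equalize` read in the opposite category of elements.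
  have filt : IsFilteredOrEmpty (CostructuredArrow yoneda A) :=
    { cocone_objs := fun x y => by
        obtain ⟨ξ, hx⟩ := exists_el x
        obtain ⟨η, hy⟩ := exists_el y
        generalize x.left.unop = c at *
        generalize y.left.unop = d at *
        subst hx hy
        obtain ⟨e, ζ, f, g, hf, hg⟩ := pair ξ η
        obtain ⟨f', -⟩ := homEl _ _ f hf
        obtain ⟨g', -⟩ := homEl _ _ g hg
        exact ⟨_, f', g', trivial⟩
      cocone_maps := fun x y f g => by
        obtain ⟨ξ, hx⟩ := exists_el x
        obtain ⟨η, hy⟩ := exists_el y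
        generalize x.left.unop = c at *
        generalize y.left.unop = d at *
        subst hx hy
        obtain ⟨e, i, ζ, hi, hζ⟩ := equalize f.left.unop g.left.unop η
          ((map_of_hom ξ η f).trans (map_of_hom ξ η g).symm)
        obtain ⟨i', hi'⟩ := homEl η ζ i hζ
        refine ⟨_, i', ?_⟩
        ext
        simp only [CostructuredArrow.comp_left, hi']
        exact Quiver.Hom.unop_inj hi }
  have : IsFiltered (CostructuredArrow yoneda A) :=
    { nonempty := by
        obtain ⟨c, ⟨ξ⟩⟩ := nonempty
        exact ⟨el c ξ⟩ }
  have : FinallySmall.{v} (CostructuredArrow yoneda A) := by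
    refine finallySmall_of_small_weakly_terminal_set (Set.range fun j => el (cJ j) (ξJ j)) ?_
    intro x
    obtain ⟨ξ, hx⟩ := exists_el x
    generalize x.left.unop = c at *
    subst hx
    obtain ⟨j, f, h⟩ := hJ c ξ
    obtain ⟨g, -⟩ := homEl _ _ f h
    exact ⟨_, ⟨j, rfl⟩, ⟨g⟩⟩
  let X : Ind Cᵒᵖ := (Ind.equivalence Cᵒᵖ).inverse.obj
    ⟨A, isIndObject_of_isFiltered_of_finallySmall A⟩
  let i : (Ind.inclusion Cᵒᵖ).obj X ≅ A :=
    (ObjectProperty.ι _).mapIso ((Ind.equivalence Cᵒᵖ).counitIso.app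
      ⟨A, isIndObject_of_isFiltered_of_finallySmall A⟩)
  let E (c : C) : (Opposite.op X ⟶ Pro.const.obj c) ≃ Shrink.{v} (Φ c) :=
    ((opEquiv _ _).trans (indElt X (Opposite.op c))).trans
      (i.app (Opposite.op (Opposite.op c))).toEquiv
  have hE : ∀ {c d : C} (f : c ⟶ d) (t : Opposite.op X ⟶ Pro.const.obj c),
      E d (t ≫ Pro.const.map f) = A.map f.op.op (E c t) := fun f t =>
    (congrArg (i.app (Opposite.op (Opposite.op _))).hom (indElt_map f.op t.unop)).trans
      (ConcreteCategory.congr_hom (i.hom.naturality f.op.op) (indElt X _ t.unop))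
  refine ⟨Opposite.op X, fun c => (E c).trans (equivShrink (Φ c)).symm, fun {c d} f t => ?_⟩
  apply (equivShrink _).injective
  rw [Equiv.trans_apply, Equiv.trans_apply, Equiv.apply_symm_apply, ← hmap,
    Equiv.apply_symm_apply, hE]

end IndObjects

/-! ### Generalities on pro-objects -/

section ProGeneralities

universe v w u'

variable {C : Type u'} [Category.{v} C]

theorem Pro.hom_ext {X Y : Pro C} {f g : X ⟶ Y}
    (h : ∀ (c : C) (y : Y ⟶ Pro.const.obj c), f ≫ y = g ≫ y) : f = g :=
  Quiver.Hom.unop_inj (ind_hom_ext fun c x =>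
    Quiver.Hom.op_inj (h c.unop (Quiver.Hom.op x)))

theorem Pro.exists_hom {X Y : Pro C}
    (φ : ∀ c : C, (Y ⟶ Pro.const.obj c) → (X ⟶ Pro.const.obj c))
    (hφ : ∀ (c d : C) (f : c ⟶ d) (y : Y ⟶ Pro.const.obj c),
      φ d (y ≫ Pro.const.map f) = φ c y ≫ Pro.const.map f) :
    ∃ m : X ⟶ Y, ∀ (c : C) (y : Y ⟶ Pro.const.obj c), m ≫ y = φ c y := by
  obtain ⟨m, hm⟩ := ind_exists_hom (X := Y.unop) (Y := X.unop)
    (fun c x => (φ c.unop (Quiver.Hom.op x)).unop)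
    (fun c d f x => congrArg Quiver.Hom.unop (hφ _ _ f.unop (Quiver.Hom.op x)))
  exact ⟨m.op, fun c y => Quiver.Hom.unop_inj (hm _ y.unop)⟩

section

variable {I : Type w} [Category.{w} I] {F : I ⥤ Cᵒᵖ} {X : Pro C}
  {ι : ∀ i, Ind.yoneda.obj (F.obj i) ⟶ X.unop}

/-- The projections of a pro-object to the terms of a presentation. -/
noncomputable def Presents.proj (_ : Presents F X.unop ι) (i : I) :
    X ⟶ Pro.const.obj (F.obj i).unop :=
  Quiver.Hom.op (ι i)

theorem Presents.proj_map (h : Presents F X.unop ι) {i j : I} (f : i ⟶ j) :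
    h.proj j ≫ Pro.const.map (F.map f).unop = h.proj i :=
  Quiver.Hom.unop_inj (h.naturality f)

theorem Presents.exists_proj (h : Presents F X.unop ι) {c : C} (x : X ⟶ Pro.const.obj c) :
    ∃ (i : I) (g : (F.obj i).unop ⟶ c), h.proj i ≫ Pro.const.map g = x := by
  obtain ⟨i, g, hg⟩ := h.exists_factor (c := Opposite.op c) x.unop
  exact ⟨i, g.unop, Quiver.Hom.unop_inj hg⟩

theorem Presents.exists_proj_eq (h : Presents F X.unop ι) {c : C} {i : I}
    (g g' : (F.obj i).unop ⟶ c)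
    (e : h.proj i ≫ Pro.const.map g = h.proj i ≫ Pro.const.map g') :
    ∃ (j : I) (f : i ⟶ j), (F.map f).unop ≫ g = (F.map f).unop ≫ g' := by
  obtain ⟨j, f, hf⟩ := h.exists_eq g.op g'.op (congrArg Quiver.Hom.unop e)
  exact ⟨j, f, congrArg Quiver.Hom.unop hf⟩

theorem Presents.under [IsFiltered I] (h : Presents F X.unop ι) (i : I) :
    Presents (Under.forget i ⋙ F) X.unop (fun l => ι l.right) where
  naturality f := h.naturality f.right
  exists_factor x := by
    obtain ⟨j, g, rfl⟩ := h.exists_factor x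
    refine ⟨Under.mk (IsFiltered.leftToMax i j), g ≫ F.map (IsFiltered.rightToMax i j), ?_⟩
    change Ind.yoneda.map (g ≫ F.map (IsFiltered.rightToMax i j)) ≫ ι (IsFiltered.max i j) = _
    rw [Functor.map_comp, Category.assoc, h.naturality]
  exists_eq {c l} g g' e := by
    obtain ⟨j, f, hf⟩ := h.exists_eq g g' e
    exact ⟨Under.mk (l.hom ≫ f), Under.homMk f, hf⟩

theorem Presents.exists_proj_of_le [IsFiltered I] (h : Presents F X.unop ι) (i : I) {c : C}
    (x : X ⟶ Pro.const.obj c) :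
    ∃ (j : I) (_ : i ⟶ j) (g : (F.obj j).unop ⟶ c), h.proj j ≫ Pro.const.map g = x := by
  obtain ⟨j, g, rfl⟩ := h.exists_proj x
  refine ⟨_, IsFiltered.leftToMax i j, (F.map (IsFiltered.rightToMax i j)).unop ≫ g, ?_⟩
  rw [Functor.map_comp, ← Category.assoc, h.proj_map]

/-- If the composites of the projection `X ⟶ F i` with two maps agree, then they agree at any
sufficiently large stage, which may be chosen to dominate a given map from `X`. -/
theorem Presents.exists_proj_eq_of_factor [IsFiltered I] (h : Presents F X.unop ι) {b : C}
    {i : I} (x : X ⟶ Pro.const.obj b) (p : b ⟶ (F.obj i).unop)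
    (hp : x ≫ Pro.const.map p = h.proj i) :
    ∃ (j : I) (f : i ⟶ j) (g : (F.obj j).unop ⟶ b), h.proj j ≫ Pro.const.map g = x ∧
      g ≫ p = (F.map f).unop := by
  obtain ⟨j, f, g, hg⟩ := h.exists_proj_of_le i x
  obtain ⟨l, f', hf'⟩ := h.exists_proj_eq (g ≫ p) (F.map f).unop (by
    rw [Functor.map_comp, ← Category.assoc, hg, hp, h.proj_map])
  refine ⟨l, f ≫ f', (F.map f').unop ≫ g, ?_, ?_⟩
  · rw [Functor.map_comp, ← Category.assoc, h.proj_map, hg]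
  · rw [Category.assoc, hf', Functor.map_comp]; rfl

end

theorem Pro.exists_presents (X : Pro C) : ∃ (I : Type v) (_ : SmallCategory I) (_ : IsFiltered I)
    (F : I ⥤ Cᵒᵖ) (ι : ∀ i, Ind.yoneda.obj (F.obj i) ⟶ X.unop), Presents F X.unop ι :=
  ⟨_, _, inferInstance, _, _, X.unop.presentation.presents⟩

/-- No pullback in `C` is needed: a sufficiently late term of a presentation of `X` dominates both
maps and makes the square commute. -/
theorem Pro.exists_pullback {X : Pro C} {a b c : C} (x : X ⟶ Pro.const.obj a)
    (y : X ⟶ Pro.const.obj b) (f : a ⟶ c) (g : b ⟶ c)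
    (e : x ≫ Pro.const.map f = y ≫ Pro.const.map g) :
    ∃ (d : C) (z : X ⟶ Pro.const.obj d) (p : d ⟶ a) (q : d ⟶ b),
      z ≫ Pro.const.map p = x ∧ z ≫ Pro.const.map q = y ∧ p ≫ f = q ≫ g := by
  obtain ⟨I, _, _, F, ι, h⟩ := X.exists_presents
  obtain ⟨i, p, rfl⟩ := h.exists_proj x
  obtain ⟨j, l, q, rfl⟩ := h.exists_proj_of_le i y
  rw [← h.proj_map l, Category.assoc, Category.assoc, Category.assoc, ← Functor.map_comp,
    ← Functor.map_comp, ← Functor.map_comp] at e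
  obtain ⟨m, l', h'⟩ := h.exists_proj_eq _ _ e
  refine ⟨_, h.proj m, (F.map l').unop ≫ (F.map l).unop ≫ p, (F.map l').unop ≫ q, ?_, ?_, ?_⟩
  · rw [Functor.map_comp, Functor.map_comp, ← Category.assoc, ← Category.assoc, h.proj_map,
      h.proj_map]
  · rw [Functor.map_comp, ← Category.assoc, h.proj_map]
  · simpa only [Category.assoc] using h'

theorem Pro.exists_pair {X : Pro C} {a b : C} (x : X ⟶ Pro.const.obj a)
    (y : X ⟶ Pro.const.obj b) : ∃ (d : C) (z : X ⟶ Pro.const.obj d) (p : d ⟶ a) (q : d ⟶ b),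
      z ≫ Pro.const.map p = x ∧ z ≫ Pro.const.map q = y := by
  obtain ⟨I, _, _, F, ι, h⟩ := X.exists_presents
  obtain ⟨i, p, rfl⟩ := h.exists_proj x
  obtain ⟨j, l, q, rfl⟩ := h.exists_proj_of_le i y
  refine ⟨_, h.proj j, (F.map l).unop ≫ p, q, ?_, rfl⟩
  rw [Functor.map_comp, ← Category.assoc, h.proj_map]

theorem Pro.exists_family {X : Pro C} {n : ℕ} (a : Fin n → C)
    (x : ∀ i, X ⟶ Pro.const.obj (a i)) : ∃ (d : C) (z : X ⟶ Pro.const.obj d)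
      (f : ∀ i, d ⟶ a i), ∀ i, z ≫ Pro.const.map (f i) = x i := by
  induction n with
  | zero =>
    obtain ⟨I, _, _, F, ι, h⟩ := X.exists_presents
    obtain ⟨i⟩ := IsFiltered.nonempty (C := I)
    exact ⟨_, h.proj i, fun i => i.elim0, fun i => i.elim0⟩
  | succ n ih =>
    obtain ⟨d, z, f, hf⟩ := ih (fun i => a i.succ) (fun i => x i.succ)
    obtain ⟨d', z', p, q, hp, rfl⟩ := Pro.exists_pair (x 0) z
    refine ⟨d', z', Fin.cases p (fun i => q ≫ f i), Fin.cases hp fun i => ?_⟩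
    simp only [Fin.cases_succ]
    rw [← hf i, Functor.map_comp, Category.assoc]

theorem Pro.exists_equalize {X : Pro C} {a b : C} (x : X ⟶ Pro.const.obj a) (f g : a ⟶ b)
    (e : x ≫ Pro.const.map f = x ≫ Pro.const.map g) :
    ∃ (d : C) (z : X ⟶ Pro.const.obj d) (i : d ⟶ a),
      z ≫ Pro.const.map i = x ∧ i ≫ f = i ≫ g := by
  obtain ⟨I, _, _, F, ι, h⟩ := X.exists_presents
  obtain ⟨i, p, rfl⟩ := h.exists_proj x
  rw [Category.assoc, Category.assoc, ← Functor.map_comp, ← Functor.map_comp] at e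
  obtain ⟨j, l, h'⟩ := h.exists_proj_eq _ _ e
  refine ⟨_, h.proj j, (F.map l).unop ≫ p, ?_, by simpa only [Category.assoc] using h'⟩
  rw [Functor.map_comp, ← Category.assoc, h.proj_map]

end ProGeneralities

/-! ### Equality of classes in the colimits defining families -/

namespace PseudoAction

universe w v₁ u₁ v₂ u₂

variable {A : Type u₁} [Category.{v₁} A] {C : Type u₂} [Category.{v₂} C]
  {P : PseudoAction.{w} A C}

/-- Having a common refinement on which the representatives agree is already an equivalence
relation. Transitivity is the only real point, and `Pro.exists_pullback` supplies the joint
refinement. -/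
theorem ProHom.mk_eq_mk_iff {X : Pro A} {V W : C} (r r' : P.ProRepr X V W) :
    (Quot.mk _ r : P.ProHom X V W) = Quot.mk _ r' ↔ ∃ (a : A) (x : X ⟶ Pro.const.obj a)
      (f : a ⟶ r.obj) (f' : a ⟶ r'.obj), x ≫ Pro.const.map f = r.map ∧
        x ≫ Pro.const.map f' = r'.map ∧ P.pull f r.val = P.pull f' r'.val := by
  constructor
  · intro h
    replace h := Quot.eqvGen_exact h
    induction h with
    | rel _ _ h =>
      obtain ⟨x, f, h⟩ := h
      exact ⟨_, x, f, 𝟙 _, rfl, by simp, by rw [P.pull_id]⟩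
    | refl r => exact ⟨_, r.map, 𝟙 _, 𝟙 _, by simp, by simp, rfl⟩
    | symm _ _ _ ih =>
      obtain ⟨a, x, f, f', h₁, h₂, h₃⟩ := ih
      exact ⟨a, x, f', f, h₂, h₁, h₃.symm⟩
    | trans _ _ _ _ _ ih ihh =>
      obtain ⟨a, x, f, f', h₁, h₂, h₃⟩ := ih
      obtain ⟨b, y, g, g', h₁', h₂', h₃'⟩ := ihh
      obtain ⟨d, z, p, q, rfl, rfl, e⟩ := Pro.exists_pullback x y f' g (h₂.trans h₁'.symm)
      refine ⟨d, z, p ≫ f, q ≫ g', ?_, ?_, ?_⟩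
      · rw [← h₁, Functor.map_comp, Category.assoc]
      · rw [← h₂', Functor.map_comp, Category.assoc]
      · rw [← P.pull_pull, h₃, P.pull_pull, e, ← P.pull_pull, h₃', P.pull_pull]
  · rintro ⟨a, x, f, f', h₁, h₂, h₃⟩
    exact (ProHom.sound x _ f h₁ _ _ h₃).trans (ProHom.sound x _ f' h₂ _ _ rfl).symm

theorem OnProColim.mk_eq_mk_iff {X : A} {V : Pro C} {W : C} (r r' : P.OnProRepr X V W) :
    (Quot.mk _ r : P.OnProColim X V W) = Quot.mk _ r' ↔ ∃ (c : C) (y : V ⟶ Pro.const.obj c)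
      (f : c ⟶ r.obj) (f' : c ⟶ r'.obj), y ≫ Pro.const.map f = r.map ∧
        y ≫ Pro.const.map f' = r'.map ∧
          P.comp (P.ofHom X f) r.val = P.comp (P.ofHom X f') r'.val := by
  constructor
  · intro h
    replace h := Quot.eqvGen_exact h
    induction h with
    | rel _ _ h =>
      obtain ⟨x, f, h⟩ := h
      exact ⟨_, x, f, 𝟙 _, rfl, by simp, by rw [P.id_comp]⟩
    | refl r => exact ⟨_, r.map, 𝟙 _, 𝟙 _, by simp, by simp, rfl⟩
    | symm _ _ _ ih =>
      obtain ⟨a, x, f, f', h₁, h₂, h₃⟩ := ih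
      exact ⟨a, x, f', f, h₂, h₁, h₃.symm⟩
    | trans _ _ _ _ _ ih ihh =>
      obtain ⟨a, x, f, f', h₁, h₂, h₃⟩ := ih
      obtain ⟨b, y, g, g', h₁', h₂', h₃'⟩ := ihh
      obtain ⟨d, z, p, q, rfl, rfl, e⟩ := Pro.exists_pullback x y f' g (h₂.trans h₁'.symm)
      refine ⟨d, z, p ≫ f, q ≫ g', ?_, ?_, ?_⟩
      · rw [← h₁, Functor.map_comp, Category.assoc]
      · rw [← h₂', Functor.map_comp, Category.assoc]
      · rw [P.ofHom_comp, P.assoc, h₃, ← P.assoc, ← P.ofHom_comp, e, P.ofHom_comp, P.assoc, h₃',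
          P.ofHom_comp, P.assoc]
  · rintro ⟨c, y, f, f', h₁, h₂, h₃⟩
    obtain ⟨d, x, h⟩ := r
    obtain ⟨d', x', h'⟩ := r'
    dsimp only at f f' h₁ h₂ h₃
    subst h₁ h₂
    refine (Quot.sound (OnProRel.mk y f h)).trans ?_
    rw [h₃]
    exact (Quot.sound (OnProRel.mk y f' h')).symm

end PseudoAction

/-! ### Families over objects of `Ind(Pro(Set₀))` as functions on points -/

/-- The point, as a profinite set. -/
noncomputable abbrev proPt : Pro FintypeCat.{u} := Pro.const.obj (FintypeCat.of PUnit.{u + 1})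

/-- The point, as an object of `Ind(Pro(Set₀))`. -/
noncomputable abbrev pt : IndProFin.{u} := Ind.yoneda.obj proPt

/-- The value of a map to a finite set at a point. -/
noncomputable def evalPt {p : Pro FintypeCat.{u}} (t : proPt ⟶ p) {s : FintypeCat.{u}}
    (q : p ⟶ Pro.const.obj s) : s :=
  (Pro.const.preimage (t ≫ q)) PUnit.unit

theorem evalPt_map {p : Pro FintypeCat.{u}} (t : proPt ⟶ p) {s s' : FintypeCat.{u}}
    (q : p ⟶ Pro.const.obj s) (f : s ⟶ s') : evalPt t (q ≫ Pro.const.map f) = f (evalPt t q) := by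
  have h : Pro.const.preimage (t ≫ q ≫ Pro.const.map f) = Pro.const.preimage (t ≫ q) ≫ f := by
    apply Pro.const.map_injective
    simp
  rw [evalPt, h]
  rfl

theorem evalPt_comp {p p' : Pro FintypeCat.{u}} (t : proPt ⟶ p) (f : p ⟶ p') {s : FintypeCat.{u}}
    (q : p' ⟶ Pro.const.obj s) : evalPt (t ≫ f) q = evalPt t (f ≫ q) := by
  simp only [evalPt, Category.assoc]

/-- This is compactness of profinite sets. If two maps differ, the finite sets where they differ are
nonempty at every later stage, so their inverse limit contains a point of `p` where they differ. -/
theorem evalPt_injective {p : Pro FintypeCat.{u}} {s : FintypeCat.{u}} {q q' : p ⟶ Pro.const.obj s}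
    (h : ∀ t : proPt ⟶ p, evalPt t q = evalPt t q') : q = q' := by
  obtain ⟨I, _, _, F, ι, hp⟩ := p.exists_presents
  obtain ⟨i, g, rfl⟩ := hp.exists_proj q
  obtain ⟨j, f, g', rfl⟩ := hp.exists_proj_of_le i q'
  rw [← hp.proj_map f, Category.assoc, ← Functor.map_comp] at h ⊢
  generalize (F.map f).unop ≫ g = g at h ⊢
  by_contra hne
  -- the points at which the two maps differ, at all later stages
  let K : (Under j)ᵒᵖ ⥤ Type u :=
    { obj := fun l => {x : (F.obj l.unop.right).unop //
        g ((F.map l.unop.hom).unop x) ≠ g' ((F.map l.unop.hom).unop x)}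
      map := fun {l l'} a => ↾(fun x => ⟨(F.map a.unop.right).unop x.1, by
        have e := congrArg (fun t => (F.map t).unop x.1) (Under.w a.unop)
        simp only [Functor.map_comp, unop_comp, FintypeCat.comp_apply] at e
        rw [e]
        exact x.2⟩)
      map_id := fun l => by ext x; simp
      map_comp := fun a b => by ext x; simp }
  have : ∀ l, Finite (K.obj l) := fun l =>
    inferInstanceAs (Finite {x : (F.obj l.unop.right).unop // _})
  have : ∀ l, Nonempty (K.obj l) := by
    intro l
    by_contra hl
    apply hne
    have e : (F.map l.unop.hom).unop ≫ g = (F.map l.unop.hom).unop ≫ g' := by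
      ext x
      by_contra hx
      exact hl ⟨⟨x, hx⟩⟩
    have e' := congrArg (fun t => hp.proj _ ≫ Pro.const.map t) e
    simpa only [Functor.map_comp, ← Category.assoc, hp.proj_map] using e'
  obtain ⟨σ, hσ⟩ := nonempty_sections_of_finite_cofiltered_system K
  have hm : ∀ {l l' : Under j} (f : l ⟶ l'), (F.map f.right).unop (σ (Opposite.op l')).1 =
      (σ (Opposite.op l)).1 := fun f => congrArg Subtype.val (hσ f.op)
  -- The compatible system `σ` is assembled into an actual point of `p`, in the opposite category.
  obtain ⟨m, hm'⟩ := (hp.under j).exists_desc (Y := proPt.unop)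
    (fun l => Ind.yoneda.map (Quiver.Hom.op
      (FintypeCat.homMk (fun _ : PUnit.{u + 1} => (σ (Opposite.op l)).1))))
    (fun {l l'} f => by
      refine (Functor.map_comp _ _ _).symm.trans
        (congrArg (fun t => Ind.yoneda.map t) (Quiver.Hom.unop_inj ?_))
      ext x
      exact hm f)
  have hev : evalPt m.op (hp.proj j) = (σ (Opposite.op (Under.mk (𝟙 j)))).1 := by
    have : m.op ≫ hp.proj j = Pro.const.map
      (FintypeCat.homMk (fun _ : PUnit.{u + 1} => (σ (Opposite.op (Under.mk (𝟙 j)))).1)) :=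
      Quiver.Hom.unop_inj (hm' (Under.mk (𝟙 j)))
    rw [evalPt, this, Functor.preimage_map]
    rfl
  refine (σ (Opposite.op (Under.mk (𝟙 j)))).2 ?_
  have := h m.op
  rw [evalPt_map, evalPt_map, hev] at this
  simpa using this

/-! ### Values at points of families over profinite sets -/

section Evaluation

variable {k : Type u} [Field k]

/-- The value at a point of a family of maps of finite-dimensional spaces parametrised by a
profinite set. -/
noncomputable def evPro {p : Pro FintypeCat.{u}} {e e' : FGModuleCat.{u} k}
    (h : (finAction k).pro.Hom p e e') (t : proPt ⟶ p) : e ⟶ e' :=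
  Quot.lift (fun r => r.val (evalPt t r.map)) (by
    rintro _ _ ⟨x, f, h⟩
    change h _ = h (f _)
    rw [evalPt_map]) h

theorem evPro_ofHom {p : Pro FintypeCat.{u}} {e e' : FGModuleCat.{u} k} (f : e ⟶ e')
    (t : proPt ⟶ p) : evPro ((finAction k).pro.ofHom p f) t = f := rfl

theorem evPro_comp {p : Pro FintypeCat.{u}} {e e' e'' : FGModuleCat.{u} k}
    (g : (finAction k).pro.Hom p e e') (h : (finAction k).pro.Hom p e' e'') (t : proPt ⟶ p) :
    evPro ((finAction k).pro.comp g h) t = evPro g t ≫ evPro h t := by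
  induction h using Quot.ind with | mk h => ?_
  induction g using Quot.ind with | mk g => ?_
  change g.val ((prod.fst : g.obj ⨯ h.obj ⟶ _) (evalPt t (Pro.lift g.map h.map))) ≫
    h.val ((prod.snd : g.obj ⨯ h.obj ⟶ _) (evalPt t (Pro.lift g.map h.map))) =
      g.val (evalPt t g.map) ≫ h.val (evalPt t h.map)
  rw [← evalPt_map, ← evalPt_map, Pro.lift_fst, Pro.lift_snd]

theorem evPro_pull {p p' : Pro FintypeCat.{u}} {e e' : FGModuleCat.{u} k} (f : p' ⟶ p)
    (h : (finAction k).pro.Hom p e e') (t : proPt ⟶ p') :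
    evPro ((finAction k).pro.pull f h) t = evPro h (t ≫ f) := by
  induction h using Quot.ind with | mk h => ?_
  change h.val (evalPt t (f ≫ h.map)) = h.val (evalPt (t ≫ f) h.map)
  rw [evalPt_comp]

theorem evPro_injective {p : Pro FintypeCat.{u}} {e e' : FGModuleCat.{u} k}
    {g h : (finAction k).pro.Hom p e e'} (H : ∀ t, evPro g t = evPro h t) : g = h := by
  classical
  induction g using Quot.ind with | mk g => ?_
  induction h using Quot.ind with | mk h => ?_
  obtain ⟨s, x, f, f', hf, hf'⟩ := Pro.exists_pair g.map h.map
  -- Agreement of the two families is a map to the finite set of truth values. It equals the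
  -- constant `True` at every point, hence as a map on `p`, hence already at a finite stage.
  let χ : s ⟶ FintypeCat.of (ULift.{u} Prop) :=
    FintypeCat.homMk fun a => ULift.up (g.val (f a) = h.val (f' a))
  let τ : s ⟶ FintypeCat.of (ULift.{u} Prop) := FintypeCat.homMk fun _ => ULift.up True
  have e : x ≫ Pro.const.map χ = x ≫ Pro.const.map τ := by
    refine evalPt_injective fun t => ?_
    rw [evalPt_map, evalPt_map]
    refine congrArg ULift.up (eq_true ?_)
    rw [← evalPt_map, ← evalPt_map, hf, hf']
    exact H t
  obtain ⟨d, z, i, rfl, hi⟩ := Pro.exists_equalize x χ τ e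
  refine (PseudoAction.ProHom.mk_eq_mk_iff _ _).2 ⟨d, z, i ≫ f, i ≫ f', ?_, ?_, ?_⟩
  · rw [Functor.map_comp, ← Category.assoc, hf]
  · rw [Functor.map_comp, ← Category.assoc, hf']
  · funext a
    exact of_eq_true (congrArg ULift.down (ConcreteCategory.congr_hom hi a))

variable (k) in
/-- The pseudo-action of profinite sets on vector spaces. -/
noncomputable abbrev profinAction : PseudoAction (Pro FintypeCat.{u}) (ModuleCat.{u} k) :=
  (finAction k).pro.onInd (ModuleCat.isFG k).ι

/-- The value at a point of an element of `colim_n Hom(p ⊗ e, W_n)`. -/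
noncomputable def evColim {p : Pro FintypeCat.{u}} {e : FGModuleCat.{u} k} {c : ModuleCat.{u} k}
    (h : (finAction k).pro.OnIndColim (ModuleCat.isFG k).ι p e c) (t : proPt ⟶ p) :
    (ModuleCat.isFG k).ι.obj e ⟶ c :=
  Quot.lift (fun r => (ModuleCat.isFG k).ι.map (evPro r.val t) ≫ r.map) (by
    rintro _ _ ⟨f, y, h⟩
    dsimp only
    rw [evPro_comp, evPro_ofHom, Functor.map_comp, Category.assoc]) h

theorem evColim_pull {p p' : Pro FintypeCat.{u}} {e : FGModuleCat.{u} k} {c : ModuleCat.{u} k}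
    (f : p' ⟶ p) (h : (finAction k).pro.OnIndColim (ModuleCat.isFG k).ι p e c) (t : proPt ⟶ p') :
    evColim (h.pull f) t = evColim h (t ≫ f) := by
  induction h using Quot.ind with | mk h => ?_
  change (ModuleCat.isFG k).ι.map (evPro _ t) ≫ _ = _
  rw [evPro_pull]
  rfl

theorem evColim_precomp {p : Pro FintypeCat.{u}} {e e' : FGModuleCat.{u} k} {c : ModuleCat.{u} k}
    (g : (finAction k).pro.Hom p e' e)
    (h : (finAction k).pro.OnIndColim (ModuleCat.isFG k).ι p e c) (t : proPt ⟶ p) :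
    evColim (h.precomp g) t = (ModuleCat.isFG k).ι.map (evPro g t) ≫ evColim h t := by
  induction h using Quot.ind with | mk h => ?_
  change (ModuleCat.isFG k).ι.map (evPro _ t) ≫ _ = _
  rw [evPro_comp, Functor.map_comp, Category.assoc]
  rfl

/-- The map `k ⟶ d` with value `v`. -/
noncomputable def toSpan {d : ModuleCat.{u} k} (v : d) :
    (ModuleCat.isFG k).ι.obj (FGModuleCat.of k k) ⟶ d :=
  ModuleCat.ofHom (LinearMap.toSpanSingleton k d v)

/-- Compatibility along `k ⟶ e`, `1 ↦ v`, shows that the value depends only on the vector `y v` of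
`d`. The values on finite-dimensional spaces therefore glue to one function on `d`, which `evLin`
turns into a linear map. -/
theorem evColim_apply {p : Pro FintypeCat.{u}} {d c : ModuleCat.{u} k}
    (h : (profinAction k).Hom p d c) (t : proPt ⟶ p) (e : FGModuleCat.{u} k)
    (y : (ModuleCat.isFG k).ι.obj e ⟶ d) (v : (ModuleCat.isFG k).ι.obj e) :
    evColim (h.1 e y) t v = evColim (h.1 _ (toSpan (y v))) t (1 : k) := by
  let σ : FGModuleCat.of k k ⟶ e := FGModuleCat.ofHom (LinearMap.toSpanSingleton k _ v)
  have e : toSpan (y v) = (ModuleCat.isFG k).ι.map σ ≫ y := by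
    ext
    change (1 : k) • y v = y ((1 : k) • v)
    simp
  rw [e, h.2, evColim_precomp, evPro_ofHom]
  change _ = evColim (h.1 _ y) t ((1 : k) • v)
  rw [one_smul]

/-- The value at a point of a family of linear maps parametrised by a profinite set. -/
noncomputable def evLin {p : Pro FintypeCat.{u}} {d c : ModuleCat.{u} k}
    (h : (profinAction k).Hom p d c) (t : proPt ⟶ p) : d ⟶ c :=
  ModuleCat.ofHom
    { toFun := fun v => evColim (h.1 _ (toSpan v)) t (1 : k)
      map_add' := fun v w => by
        -- Additivity is checked on a plane mapping onto the span of `v` and `w`, where the value is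
        -- linear by construction.
        let y : (ModuleCat.isFG k).ι.obj (FGModuleCat.of k (k × k)) ⟶ d :=
          ModuleCat.ofHom ((LinearMap.toSpanSingleton k d v).coprod
            (LinearMap.toSpanSingleton k d w))
        have hv : y ((1, 0) : k × k) = v := by simp [y]
        have hw : y ((0, 1) : k × k) = w := by simp [y]
        have hvw : y (((1, 0) : k × k) + ((0, 1) : k × k)) = v + w := by simp [y]
        have := evColim_apply h t _ y (((1, 0) : k × k) + ((0, 1) : k × k))
        rw [hvw] at this
        rw [← this]
        conv_rhs => rw [← hv, ← hw, ← evColim_apply, ← evColim_apply]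
        exact map_add _ _ _
      map_smul' := fun a v => by
        have := evColim_apply h t _ (toSpan v) (a • (1 : k))
        have h1 : toSpan v (a • (1 : k)) = a • v := by simp [toSpan]
        rw [h1] at this
        rw [← this]
        exact map_smul _ _ _ }

theorem evColim_eq {p : Pro FintypeCat.{u}} {d c : ModuleCat.{u} k}
    (h : (profinAction k).Hom p d c) (t : proPt ⟶ p) (e : FGModuleCat.{u} k)
    (y : (ModuleCat.isFG k).ι.obj e ⟶ d) : evColim (h.1 e y) t = y ≫ evLin h t := by
  ext v
  exact evColim_apply h t e y v

theorem evLin_ext {p : Pro FintypeCat.{u}} {d c : ModuleCat.{u} k}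
    {h : (profinAction k).Hom p d c} {t : proPt ⟶ p} {f : d ⟶ c}
    (H : ∀ (e : FGModuleCat.{u} k) (y : (ModuleCat.isFG k).ι.obj e ⟶ d),
      evColim (h.1 e y) t = y ≫ f) : evLin h t = f := by
  ext v
  have := ConcreteCategory.congr_hom (H _ (toSpan v)) (1 : k)
  refine Eq.trans this ?_
  change f ((1 : k) • v) = f v
  rw [one_smul]

theorem evLin_pull {p p' : Pro FintypeCat.{u}} {d c : ModuleCat.{u} k} (f : p' ⟶ p)
    (h : (profinAction k).Hom p d c) (t : proPt ⟶ p') :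
    evLin ((profinAction k).pull f h) t = evLin h (t ≫ f) :=
  evLin_ext fun e y => (evColim_pull f (h.1 e y) t).trans (evColim_eq h _ e y)

theorem evLin_ofHom {p : Pro FintypeCat.{u}} {d c : ModuleCat.{u} k} (f : d ⟶ c)
    (t : proPt ⟶ p) : evLin ((profinAction k).ofHom p f) t = f :=
  evLin_ext fun e y => by
    change (ModuleCat.isFG k).ι.map (evPro _ t) ≫ y ≫ f = _
    rw [evPro_ofHom, CategoryTheory.Functor.map_id, Category.id_comp]

theorem evLin_comp {p : Pro FintypeCat.{u}} {d c b : ModuleCat.{u} k}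
    (g : (profinAction k).Hom p d c) (h : (profinAction k).Hom p c b) (t : proPt ⟶ p) :
    evLin ((profinAction k).comp g h) t = evLin g t ≫ evLin h t :=
  evLin_ext fun e y => by
    rw [← Category.assoc, ← evColim_eq g]
    change evColim ((g.1 e y).bind h) t = _
    induction g.1 e y using Quot.ind with | mk r => ?_
    refine (evColim_precomp r.val (h.1 r.obj r.map) t).trans ?_
    rw [evColim_eq, ← Category.assoc]
    rfl

/-- The inclusion of a subspace. -/
def incl {c : ModuleCat.{u} k} (N : Submodule k c) : ModuleCat.of k N ⟶ c :=
  ModuleCat.ofHom N.subtype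

/-- Elements of `colim_n Hom(p ⊗ e, W_n)` are determined by their values at points. -/
theorem evColim_injective {p : Pro FintypeCat.{u}} {e : FGModuleCat.{u} k} {c : ModuleCat.{u} k}
    {g h : (finAction k).pro.OnIndColim (ModuleCat.isFG k).ι p e c}
    (H : ∀ t, evColim g t = evColim h t) : g = h := by
  induction g using Quot.ind with | mk g => ?_
  induction h using Quot.ind with | mk h => ?_
  have : Module.Finite k ((ModuleCat.isFG k).ι.obj g.obj) := g.obj.2
  have : Module.Finite k ((ModuleCat.isFG k).ι.obj h.obj) := h.obj.2
  -- Both representatives move to one finite-dimensional subspace of `c`. Its inclusion is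
  -- injective, so equality of values can be tested there.
  let N : Submodule k c := LinearMap.range g.map.hom ⊔ LinearMap.range h.map.hom
  have : Module.Finite k N := Submodule.finite_sup _ _
  let N' : FGModuleCat.{u} k := FGModuleCat.of k N
  let i : (ModuleCat.isFG k).ι.obj N' ⟶ c := incl N
  have hi : ∀ (r : (finAction k).pro.OnIndRepr (ModuleCat.isFG k).ι p e c),
      LinearMap.range r.map.hom ≤ N → ∃ r' : (finAction k).pro.Hom p e N',
        (Quot.mk _ r : (finAction k).pro.OnIndColim (ModuleCat.isFG k).ι p e c) =
          Quot.mk _ ⟨N', i, r'⟩ := by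
    rintro ⟨e', y, r⟩ hr
    let f : e' ⟶ N' := FGModuleCat.ofHom (LinearMap.codRestrict N y.hom
      fun v => hr (LinearMap.mem_range_self _ v))
    exact ⟨_, Quot.sound (.mk f i r)⟩
  obtain ⟨g', hg⟩ := hi g le_sup_left
  obtain ⟨h', hh⟩ := hi h le_sup_right
  rw [hg, hh] at H ⊢
  congr 2
  refine evPro_injective fun t => ?_
  have := H t
  apply (ModuleCat.isFG k).ι.map_injective
  ext v
  apply Subtype.ext
  exact ConcreteCategory.congr_hom this v

theorem evLin_injective {p : Pro FintypeCat.{u}} {d c : ModuleCat.{u} k}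
    {g h : (profinAction k).Hom p d c} (H : ∀ t, evLin g t = evLin h t) : g = h :=
  Subtype.ext (funext fun e => funext fun y => evColim_injective fun t => by
    rw [evColim_eq, evColim_eq, H])

end Evaluation

/-! ### Families over `Ind(Pro(Set₀))` and locally constant functions -/

section VectEvaluation

variable {k : Type u} [Field k]

/-- The value at a point of a family of linear maps parametrised by an object of
`Ind(Pro(Set₀))`. -/
noncomputable def ev {b : IndProFin.{u}} {d c : ModuleCat.{u} k} (h : (vectAction k).Hom b d c)
    (β : pt ⟶ b) : d ⟶ c :=
  evLin (h.1 proPt β) (𝟙 _)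

theorem evLin_eq_ev {b : IndProFin.{u}} {d c : ModuleCat.{u} k} (h : (vectAction k).Hom b d c)
    {p : Pro FintypeCat.{u}} (x : Ind.yoneda.obj p ⟶ b) (t : proPt ⟶ p) :
    evLin (h.1 p x) t = ev h (Ind.yoneda.map t ≫ x) := by
  rw [ev, h.2, evLin_pull, Category.id_comp]

theorem ev_injective {b : IndProFin.{u}} {d c : ModuleCat.{u} k} {g h : (vectAction k).Hom b d c}
    (H : ∀ β, ev g β = ev h β) : g = h :=
  Subtype.ext (funext fun p => funext fun x => evLin_injective fun t => by
    rw [evLin_eq_ev, evLin_eq_ev, H])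

theorem ev_pull {b b' : IndProFin.{u}} {d c : ModuleCat.{u} k} (f : b' ⟶ b)
    (h : (vectAction k).Hom b d c) (β : pt ⟶ b') :
    ev ((vectAction k).pull f h) β = ev h (β ≫ f) := rfl

theorem ev_ofHom {b : IndProFin.{u}} {d c : ModuleCat.{u} k} (f : d ⟶ c) (β : pt ⟶ b) :
    ev ((vectAction k).ofHom b f) β = f :=
  evLin_ofHom f _

theorem ev_comp {b : IndProFin.{u}} {d c a : ModuleCat.{u} k} (g : (vectAction k).Hom b d c)
    (h : (vectAction k).Hom b c a) (β : pt ⟶ b) :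
    ev ((vectAction k).comp g h) β = ev g β ≫ ev h β :=
  evLin_comp _ _ _

/-- A function on the points of `b` is locally constant if its restriction to every profinite set
factors through a finite set. -/
def IsLocConst {b : IndProFin.{u}} {T : Type*} (h : (pt ⟶ b) → T) : Prop :=
  ∀ (p : Pro FintypeCat.{u}) (x : Ind.yoneda.obj p ⟶ b), ∃ (s : FintypeCat.{u})
    (q : p ⟶ Pro.const.obj s) (g : s → T), ∀ t, h (Ind.yoneda.map t ≫ x) = g (evalPt t q)

/-- Restricted to the line through `v` and to a profinite set, a family is represented over a finite
set. Local constancy is claimed only vector by vector, since the finite stage depends on `v`. -/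
theorem isLocConst_ev {b : IndProFin.{u}} {d c : ModuleCat.{u} k} (h : (vectAction k).Hom b d c)
    (v : d) : IsLocConst fun β => ev h β v := by
  intro p x
  have key : ∀ t : proPt ⟶ p, ev h (Ind.yoneda.map t ≫ x) v =
      evColim ((h.1 p x).1 _ (toSpan v)) t (1 : k) := fun t => by
    rw [← evLin_eq_ev]
    rfl
  simp only [key]
  induction (h.1 p x).1 _ (toSpan v) using Quot.ind with | mk r => ?_
  obtain ⟨e, y, r⟩ := r
  induction r using Quot.ind with | mk r => ?_
  exact ⟨r.obj, r.map, fun a => y ((ModuleCat.isFG k).ι.map (r.val a) (1 : k)), fun t => rfl⟩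

/-- Families of linear maps are the locally constant functions on points. -/
theorem exists_ev {b : IndProFin.{u}} {d c : ModuleCat.{u} k} (h : (pt ⟶ b) → (d ⟶ c))
    (hh : ∀ v, IsLocConst fun β => h β v) : ∃ H : (vectAction k).Hom b d c, ∀ β, ev H β = h β := by
  have key : ∀ (p : Pro FintypeCat.{u}) (x : Ind.yoneda.obj p ⟶ b) (e : FGModuleCat.{u} k)
      (y : (ModuleCat.isFG k).ι.obj e ⟶ d),
      ∃ ξ : (finAction k).pro.OnIndColim (ModuleCat.isFG k).ι p e c,
        ∀ t, evColim ξ t = y ≫ h (Ind.yoneda.map t ≫ x) := by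
    intro p x e y
    have : Module.Finite k ((ModuleCat.isFG k).ι.obj e) := e.2
    -- Only the values on finitely many basis vectors matter. One finite stage `S` handles all of
    -- them, and the finitely many values so obtained span the finite-dimensional target `N`.
    let B := Module.finBasis k ((ModuleCat.isFG k).ι.obj e)
    choose s q g hg using fun i => hh (y (B i)) p x
    obtain ⟨S, z, f, hf⟩ := Pro.exists_family s q
    let N : Submodule k c := Submodule.span k (Set.range fun a : S × Fin _ => g a.2 (f a.2 a.1))
    have : Module.Finite k N := Module.Finite.span_of_finite k (Set.finite_range _)
    let N' : FGModuleCat.{u} k := FGModuleCat.of k N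
    let L : S → (e ⟶ N') := fun a => FGModuleCat.ofHom (V := e.obj) (B.constr k
      fun i => (⟨g i (f i a), Submodule.subset_span ⟨(a, i), rfl⟩⟩ : N))
    refine ⟨Quot.mk _ ⟨N', incl N, Quot.mk _ ⟨S, z, L⟩⟩, fun t => ?_⟩
    apply ModuleCat.hom_ext
    refine B.ext fun i => ?_
    change ((B.constr k _ (B i) : N) : c) = h _ (y (B i))
    rw [Module.Basis.constr_basis]
    refine Eq.trans ?_ (hg i t).symm
    rw [← hf, evalPt_map]
  choose ξ hξ using key
  refine ⟨⟨fun p x => ⟨fun e y => ξ p x e y, fun e e' f y => ?_⟩, fun p p' f x => ?_⟩, fun β => ?_⟩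
  · refine evColim_injective fun t => ?_
    rw [evColim_precomp, evPro_ofHom, hξ, hξ, Category.assoc]
  · refine Subtype.ext (funext fun e => funext fun y => evColim_injective fun t => ?_)
    refine (hξ _ _ _ _ _).trans (Eq.trans ?_ (evColim_pull f (ξ p' x e y) t).symm)
    rw [hξ, Functor.map_comp, Category.assoc]
  · refine evLin_ext fun e y => ?_
    refine (hξ _ _ _ _ _).trans ?_
    rw [CategoryTheory.Functor.map_id, Category.id_comp]

theorem hom_ext_of_points {b : IndProFin.{u}} {Z : FintypeCat.{u}}
    {m m' : b ⟶ Ind.yoneda.obj (Pro.const.obj Z)} (h : ∀ β : pt ⟶ b, β ≫ m = β ≫ m') : m = m' := by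
  refine ind_hom_ext fun p x => ?_
  obtain ⟨r, hr⟩ := Ind.yoneda.map_surjective (x ≫ m)
  obtain ⟨r', hr'⟩ := Ind.yoneda.map_surjective (x ≫ m')
  rw [← hr, ← hr']
  congr 1
  refine evalPt_injective fun t => ?_
  have : t ≫ r = t ≫ r' := by
    apply Ind.yoneda.map_injective
    rw [Functor.map_comp, Functor.map_comp, hr, hr', ← Category.assoc, ← Category.assoc, h]
  rw [evalPt, evalPt, this]

theorem exists_hom_of_isLocConst {b : IndProFin.{u}} {Z : FintypeCat.{u}} (h : (pt ⟶ b) → Z)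
    (hh : IsLocConst h) : ∃ m : b ⟶ Ind.yoneda.obj (Pro.const.obj Z), ∀ β : pt ⟶ b,
      β ≫ m = Ind.yoneda.map (Pro.const.map (FintypeCat.homMk fun _ : PUnit.{u + 1} => h β)) := by
  have key : ∀ (p : Pro FintypeCat.{u}) (x : Ind.yoneda.obj p ⟶ b), ∃ r : p ⟶ Pro.const.obj Z,
      ∀ t, evalPt t r = h (Ind.yoneda.map t ≫ x) := by
    intro p x
    obtain ⟨s, q, g, hg⟩ := hh p x
    exact ⟨q ≫ Pro.const.map (FintypeCat.homMk g), fun t => by rw [evalPt_map, hg]; rfl⟩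
  choose r hr using key
  obtain ⟨m, hm⟩ := ind_exists_hom (X := b) (Y := Ind.yoneda.obj (Pro.const.obj Z))
    (fun p x => Ind.yoneda.map (r p x)) (fun p p' f x => by
      rw [← Functor.map_comp]
      congr 1
      refine evalPt_injective fun t => ?_
      rw [hr, ← evalPt_comp, hr, Functor.map_comp, Category.assoc])
  refine ⟨m, fun β => ?_⟩
  rw [hm]
  congr 1
  obtain ⟨r', hr'⟩ := Pro.const.map_surjective (r proPt β)
  rw [← hr']
  congr 1
  ext ⟨⟩
  have := hr proPt β (𝟙 _)
  rw [CategoryTheory.Functor.map_id, Category.id_comp, ← hr', evalPt, Category.id_comp,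
    Functor.preimage_map] at this
  exact this

/-- Locally constant functions on the target of a weakly surjective map that agree on the source
are equal. -/
theorem WeaklySurjective.eq_of_comp_eq {b b' : IndProFin.{u}} {f : b' ⟶ b}
    (hf : WeaklySurjective f) {T : Type*} {h h' : (pt ⟶ b) → T} (hh : IsLocConst h)
    (hh' : IsLocConst h') (e : ∀ β : pt ⟶ b', h (β ≫ f) = h' (β ≫ f)) : h = h' := by
  funext β
  -- `T` may be infinite, whereas weak surjectivity concerns finite targets. The functions are
  -- therefore replaced by the truth values of being equal to the fixed element `h β`.
  let Z := FintypeCat.of (ULift.{u} Prop)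
  have comp : ∀ {g : (pt ⟶ b) → T}, IsLocConst g →
      IsLocConst fun γ => (ULift.up (g γ = h β) : ULift.{u} Prop) := by
    intro g hg p x
    obtain ⟨s, q, φ, hφ⟩ := hg p x
    exact ⟨s, q, fun a => ULift.up (φ a = h β),
      fun t => congrArg (fun a => ULift.up (a = h β)) (hφ t)⟩
  obtain ⟨m, hm⟩ := exists_hom_of_isLocConst (Z := Z) (fun γ => ULift.up (h γ = h β)) (comp hh)
  obtain ⟨m', hm'⟩ := exists_hom_of_isLocConst (Z := Z) (fun γ => ULift.up (h' γ = h β)) (comp hh')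
  have key : m = m' := hf Z m m' (hom_ext_of_points fun γ => by
    rw [← Category.assoc, ← Category.assoc, hm, hm', e])
  have := (hm β).symm.trans ((congrArg (β ≫ ·) key).trans (hm' β))
  have := ConcreteCategory.congr_hom (Pro.const.map_injective (Ind.yoneda.map_injective this))
    PUnit.unit
  have := congrArg ULift.down this
  exact (of_eq_true (this.symm.trans (eq_self (h β)))).symm

end VectEvaluation

theorem IsLocConst.comp {b : IndProFin.{u}} {T T' : Type*} {h : (pt ⟶ b) → T} (hh : IsLocConst h)
    (φ : T → T') : IsLocConst fun β => φ (h β) := fun p x => by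
  obtain ⟨s, q, g, hg⟩ := hh p x
  exact ⟨s, q, fun a => φ (g a), fun t => congrArg φ (hg t)⟩

theorem IsLocConst.prodMk {b : IndProFin.{u}} {T T' : Type*} {h : (pt ⟶ b) → T}
    {h' : (pt ⟶ b) → T'} (hh : IsLocConst h) (hh' : IsLocConst h') :
    IsLocConst fun β => (h β, h' β) := fun p x => by
  obtain ⟨s, q, g, hg⟩ := hh p x
  obtain ⟨s', q', g', hg'⟩ := hh' p x
  obtain ⟨d, z, f, f', rfl, rfl⟩ := Pro.exists_pair q q'
  refine ⟨d, z, fun a => (g (f a), g' (f' a)), fun t => ?_⟩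
  refine congrArg₂ Prod.mk ((hg t).trans ?_) ((hg' t).trans ?_)
  · rw [evalPt_map]
  · rw [evalPt_map]

variable {k : Type u} [Field k]

/-- Families of linear maps lift along injective linear maps. -/
theorem exists_lift_of_injective {b : IndProFin.{u}} {d c c₀ : ModuleCat.{u} k}
    (h : (vectAction k).Hom b d c) (i : c₀ ⟶ c) (hi : Function.Injective i)
    (H : ∀ β v, ∃ w, i w = ev h β v) :
    ∃ h₀ : (vectAction k).Hom b d c₀, ∀ β, ev h₀ β ≫ i = ev h β := by
  let e := LinearEquiv.ofInjective i.hom hi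
  let φ : (pt ⟶ b) → (d ⟶ c₀) := fun β => ModuleCat.ofHom
    (e.symm.toLinearMap ∘ₗ (LinearMap.codRestrict _ (ev h β).hom (H β)))
  have hφ : ∀ β v, i (φ β v) = ev h β v := fun β v =>
    congrArg Subtype.val (e.apply_symm_apply ⟨ev h β v, H β v⟩)
  -- The lift is obtained from the given values by a fixed set-theoretic left inverse of `i`, so it
  -- is again locally constant on each vector.
  obtain ⟨h₀, hh₀⟩ := exists_ev φ (fun v => by
    have := (isLocConst_ev h v).comp (Function.invFun i)
    convert this using 2 with β
    rw [← hφ, Function.leftInverse_invFun hi])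
  refine ⟨h₀, fun β => ?_⟩
  ext v
  rw [hh₀]
  exact hφ β v

/-! ### Families over pro-objects: stages and left exactness in the target -/

variable (k) in
/-- `colim Hom("lim" b_l ⊗ "lim" d_n, c)`. -/
abbrev Fam (a : Pro IndProFin.{u}) (V : ProVect k) (c : ModuleCat.{u} k) :=
  (vectAction k).pro.OnProColim a V c

namespace Fam

variable {a : Pro IndProFin.{u}} {V : ProVect k}

/-- The family given by a family at a finite stage. -/
def mk {d : ModuleCat.{u} k} (y : V ⟶ Pro.const.obj d) {b : IndProFin.{u}}
    (x : a ⟶ Pro.const.obj b) {c : ModuleCat.{u} k} (h : (vectAction k).Hom b d c) : Fam k a V c :=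
  Quot.mk _ ⟨d, y, Quot.mk _ ⟨b, x, h⟩⟩

/-- Composition with a linear map. -/
noncomputable def post {c c' : ModuleCat.{u} k} (ξ : Fam k a V c) (f : c ⟶ c') : Fam k a V c' :=
  ξ.postcomp ((vectAction k).pro.ofHom a f)

theorem pro_mk_eq {b b' : IndProFin.{u}} {x : a ⟶ Pro.const.obj b} {x' : a ⟶ Pro.const.obj b'}
    {d c : ModuleCat.{u} k} {h : (vectAction k).Hom b d c} {h' : (vectAction k).Hom b' d c}
    (f : b' ⟶ b) (hf : x' ≫ Pro.const.map f = x) (e : ∀ β, ev h (β ≫ f) = ev h' β) :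
    (Quot.mk _ ⟨b, x, h⟩ : (vectAction k).ProHom a d c) = Quot.mk _ ⟨b', x', h'⟩ :=
  PseudoAction.ProHom.sound _ _ f hf _ _ (ev_injective e)

theorem mk_comp_ofHom {b : IndProFin.{u}} (x : a ⟶ Pro.const.obj b) {d c c' : ModuleCat.{u} k}
    (h : (vectAction k).Hom b d c) (g : c ⟶ c') :
    (vectAction k).pro.comp (Quot.mk _ ⟨b, x, h⟩) ((vectAction k).pro.ofHom a g) =
      Quot.mk _ ⟨b, x, (vectAction k).comp h ((vectAction k).ofHom b g)⟩ := by
  refine (PseudoAction.ProHom.sound _ _ prod.fst (Pro.lift_fst _ _) _ _ ?_).symm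
  rw [(vectAction k).pull_comp, (vectAction k).pull_ofHom, (vectAction k).pull_ofHom]

theorem ofHom_comp_mk {b : IndProFin.{u}} (x : a ⟶ Pro.const.obj b) {d d' c : ModuleCat.{u} k}
    (f : d' ⟶ d) (h : (vectAction k).Hom b d c) :
    (vectAction k).pro.comp ((vectAction k).pro.ofHom a f) (Quot.mk _ ⟨b, x, h⟩) =
      Quot.mk _ ⟨b, x, (vectAction k).comp ((vectAction k).ofHom b f) h⟩ := by
  refine (PseudoAction.ProHom.sound _ _ prod.snd (Pro.lift_snd _ _) _ _ ?_).symm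
  rw [(vectAction k).pull_comp, (vectAction k).pull_ofHom, (vectAction k).pull_ofHom]

theorem post_mk {d : ModuleCat.{u} k} (y : V ⟶ Pro.const.obj d) {b : IndProFin.{u}}
    (x : a ⟶ Pro.const.obj b) {c c' : ModuleCat.{u} k} (h : (vectAction k).Hom b d c)
    (f : c ⟶ c') : (mk y x h).post f = mk y x ((vectAction k).comp h ((vectAction k).ofHom b f)) :=
  congrArg (fun t => (Quot.mk _ ⟨d, y, t⟩ : Fam k a V c')) (mk_comp_ofHom x h f)

theorem post_post {c c' c'' : ModuleCat.{u} k} (ξ : Fam k a V c) (f : c ⟶ c') (g : c' ⟶ c'') :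
    (ξ.post f).post g = ξ.post (f ≫ g) := by
  induction ξ using Quot.ind with | mk r => ?_
  refine congrArg (fun t => (Quot.mk _ ⟨r.obj, r.map, t⟩ : Fam k a V c'')) ?_
  rw [(vectAction k).pro.assoc, ← (vectAction k).pro.ofHom_comp]

theorem post_id {c : ModuleCat.{u} k} (ξ : Fam k a V c) : ξ.post (𝟙 c) = ξ := by
  induction ξ using Quot.ind with | mk r => ?_
  exact congrArg (fun t => (Quot.mk _ ⟨r.obj, r.map, t⟩ : Fam k a V c))
    ((vectAction k).pro.comp_id _)

theorem pull_post {a' : Pro IndProFin.{u}} (f : a' ⟶ a) {c c' : ModuleCat.{u} k}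
    (ξ : Fam k a V c) (g : c ⟶ c') :
    PseudoAction.OnProColim.pull f (ξ.post g) = post (PseudoAction.OnProColim.pull f ξ) g := by
  induction ξ using Quot.ind with | mk r => ?_
  refine congrArg (fun t => (Quot.mk _ ⟨r.obj, r.map, t⟩ : Fam k a' V c')) ?_
  rw [(vectAction k).pro.pull_comp, (vectAction k).pro.pull_ofHom]

/-- A family at a finite stage may be replaced by a later stage. -/
theorem mk_eq {d d' : ModuleCat.{u} k} {y : V ⟶ Pro.const.obj d} {y' : V ⟶ Pro.const.obj d'}
    {b b' : IndProFin.{u}} {x : a ⟶ Pro.const.obj b} {x' : a ⟶ Pro.const.obj b'}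
    {c : ModuleCat.{u} k} {h : (vectAction k).Hom b d c} {h' : (vectAction k).Hom b' d' c}
    (f : d' ⟶ d) (g : b' ⟶ b) (hf : y' ≫ Pro.const.map f = y) (hg : x' ≫ Pro.const.map g = x)
    (e : ∀ β, f ≫ ev h (β ≫ g) = ev h' β) : mk y x h = mk y' x' h' := by
  subst hf
  refine (Quot.sound (PseudoAction.OnProRel.mk y' f _)).trans ?_
  rw [ofHom_comp_mk]
  exact congrArg (fun t => (Quot.mk _ ⟨d', y', t⟩ : Fam k a V c))
    (pro_mk_eq g hg fun β => by rw [ev_comp, ev_ofHom, e])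

theorem exists_stage {I J : Type u} [SmallCategory I] [SmallCategory J] [IsFiltered I]
    [IsFiltered J] {F : I ⥤ (ModuleCat.{u} k)ᵒᵖ} {ι : ∀ i, Ind.yoneda.obj (F.obj i) ⟶ V.unop}
    (hV : Presents F V.unop ι) {G : J ⥤ IndProFin.{u}ᵒᵖ}
    {κ : ∀ j, Ind.yoneda.obj (G.obj j) ⟶ a.unop} (ha : Presents G a.unop κ)
    {c : ModuleCat.{u} k} (ξ : Fam k a V c) : ∃ (i : I) (j : J)
      (h : (vectAction k).Hom (G.obj j).unop (F.obj i).unop c),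
      ξ = mk (hV.proj i) (ha.proj j) h := by
  induction ξ using Quot.ind with | mk r => ?_
  obtain ⟨d, y, r⟩ := r
  induction r using Quot.ind with | mk r => ?_
  obtain ⟨b, x, h⟩ := r
  obtain ⟨i, f, hf⟩ := hV.exists_proj y
  obtain ⟨j, g, hg⟩ := ha.exists_proj x
  exact ⟨i, j, (vectAction k).comp ((vectAction k).ofHom _ f) ((vectAction k).pull g h),
    mk_eq f g hf hg fun β => by rw [ev_comp, ev_ofHom, ev_pull]⟩

theorem exists_mk {c : ModuleCat.{u} k} (ξ : Fam k a V c) : ∃ (d : ModuleCat.{u} k)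
    (y : V ⟶ Pro.const.obj d) (b : IndProFin.{u}) (x : a ⟶ Pro.const.obj b)
    (h : (vectAction k).Hom b d c), ξ = mk y x h := by
  induction ξ using Quot.ind with | mk r => ?_
  obtain ⟨d, y, r⟩ := r
  induction r using Quot.ind with | mk r => ?_
  exact ⟨_, y, _, r.map, r.val, rfl⟩

theorem exists_mk_mk {c c' : ModuleCat.{u} k} (ξ : Fam k a V c) (ξ' : Fam k a V c') :
    ∃ (d : ModuleCat.{u} k) (y : V ⟶ Pro.const.obj d) (b : IndProFin.{u}) (x : a ⟶ Pro.const.obj b)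
      (h : (vectAction k).Hom b d c) (h' : (vectAction k).Hom b d c'),
        ξ = mk y x h ∧ ξ' = mk y x h' := by
  obtain ⟨d, y, b, x, h, rfl⟩ := ξ.exists_mk
  obtain ⟨d', y', b', x', h', rfl⟩ := ξ'.exists_mk
  obtain ⟨d'', y'', f, f', hf, hf'⟩ := Pro.exists_pair y y'
  obtain ⟨b'', x'', g, g', hg, hg'⟩ := Pro.exists_pair x x'
  exact ⟨d'', y'', b'', x'',
    (vectAction k).comp ((vectAction k).ofHom _ f) ((vectAction k).pull g h),
    (vectAction k).comp ((vectAction k).ofHom _ f') ((vectAction k).pull g' h'),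
    mk_eq f g hf hg fun β => by rw [ev_comp, ev_ofHom, ev_pull],
    mk_eq f' g' hf' hg' fun β => by rw [ev_comp, ev_ofHom, ev_pull]⟩

theorem mk_eq_mk_iff {d : ModuleCat.{u} k} (y : V ⟶ Pro.const.obj d) {b : IndProFin.{u}}
    (x : a ⟶ Pro.const.obj b) {c : ModuleCat.{u} k} (h h' : (vectAction k).Hom b d c) :
    mk y x h = mk y x h' ↔ ∃ (d' : ModuleCat.{u} k) (y' : V ⟶ Pro.const.obj d') (f : d' ⟶ d)
      (b' : IndProFin.{u}) (x' : a ⟶ Pro.const.obj b') (g : b' ⟶ b),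
      y' ≫ Pro.const.map f = y ∧ x' ≫ Pro.const.map g = x ∧
        ∀ β, f ≫ ev h (β ≫ g) = f ≫ ev h' (β ≫ g) := by
  constructor
  · intro e
    obtain ⟨d₁, y₁, f, f', hf, hf', e⟩ := (PseudoAction.OnProColim.mk_eq_mk_iff _ _).1 e
    -- `f` and `f'` both lift `y` but may differ; a further stage equalizes them, so that a single
    -- refinement remains. The parameter stage is treated in the same way below.
    obtain ⟨d₂, y₂, j, rfl, hj⟩ := Pro.exists_equalize y₁ f f' (hf.trans hf'.symm)
    rw [ofHom_comp_mk, ofHom_comp_mk] at e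
    obtain ⟨b₁, x₁, g, g', hg, hg', e⟩ := (PseudoAction.ProHom.mk_eq_mk_iff _ _).1 e
    obtain ⟨b₂, x₂, l, rfl, hl⟩ := Pro.exists_equalize x₁ g g' (hg.trans hg'.symm)
    refine ⟨d₂, y₂, j ≫ f, b₂, x₂, l ≫ g, ?_, ?_, fun β => ?_⟩
    · rw [Functor.map_comp, ← Category.assoc, hf]
    · rw [Functor.map_comp, ← Category.assoc, hg]
    · have := congrArg (fun t => j ≫ ev t (β ≫ l)) e
      simp only [ev_pull, ev_comp, ev_ofHom, Category.assoc, ← hl] at this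
      refine (Category.assoc _ _ _).trans (this.trans ?_)
      exact ((Category.assoc _ _ _).symm.trans (congrArg (· ≫ _) hj.symm))
  · rintro ⟨d', y', f, b', x', g, hf, hg, e⟩
    exact (mk_eq f g hf hg (h' := (vectAction k).comp ((vectAction k).ofHom _ f)
      ((vectAction k).pull g h)) fun β => by rw [ev_comp, ev_ofHom, ev_pull]).trans
        (mk_eq f g hf hg fun β => by rw [ev_comp, ev_ofHom, ev_pull, e]).symm

/-- The two equalities hold at different stages; at a common refinement both hold pointwise, and
`hf` applies to each value. The main use is with the two projections of a product. -/
theorem post_jointly_injective {c c₁ c₂ : ModuleCat.{u} k} {f₁ : c ⟶ c₁} {f₂ : c ⟶ c₂}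
    (hf : ∀ v w, f₁ v = f₁ w → f₂ v = f₂ w → v = w) {ξ ξ' : Fam k a V c}
    (h₁ : ξ.post f₁ = ξ'.post f₁) (h₂ : ξ.post f₂ = ξ'.post f₂) : ξ = ξ' := by
  obtain ⟨d, y, b, x, h, h', rfl, rfl⟩ := ξ.exists_mk_mk ξ'
  simp only [post_mk] at h₁ h₂
  obtain ⟨d₁, y₁, p, b₁, x₁, g, rfl, rfl, e⟩ := (mk_eq_mk_iff _ _ _ _).1 h₁
  obtain ⟨d₂, y₂, p', b₂, x₂, g', hp, hg, e'⟩ := (mk_eq_mk_iff _ _ _ _).1 h₂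
  obtain ⟨d₃, y₃, q, q', rfl, rfl, hq⟩ := Pro.exists_pullback y₁ y₂ p p' hp.symm
  obtain ⟨b₃, x₃, l, l', rfl, rfl, hl⟩ := Pro.exists_pullback x₁ x₂ g g' hg.symm
  refine (mk_eq_mk_iff _ _ _ _).2 ⟨d₃, y₃, q ≫ p, b₃, x₃, l ≫ g, ?_, ?_, fun β => ?_⟩
  · rw [Functor.map_comp, Category.assoc]
  · rw [Functor.map_comp, Category.assoc]
  · ext v
    refine hf _ _ ?_ ?_
    · have := ConcreteCategory.congr_hom (e (β ≫ l)) (q v)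
      simpa [ev_comp, ev_ofHom] using this
    · rw [hl, hq]
      have := ConcreteCategory.congr_hom (e' (β ≫ l')) (q' v)
      simpa [ev_comp, ev_ofHom] using this

theorem post_injective {c c₁ : ModuleCat.{u} k} {f : c ⟶ c₁} (hf : Function.Injective f) :
    Function.Injective fun ξ : Fam k a V c => ξ.post f := fun _ _ h =>
  post_jointly_injective (fun _ _ h _ => hf h) h h

/-- This is preservation of equalizers in the target: at a late enough stage all values lie in the
image of `i`, and the family lifts pointwise. -/
theorem exists_post_eq {c c₀ c' : ModuleCat.{u} k} (i : c₀ ⟶ c) (hi : Function.Injective i)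
    {f g : c ⟶ c'} (hfg : ∀ v, f v = g v → ∃ w, i w = v) (ξ : Fam k a V c)
    (h : ξ.post f = ξ.post g) : ∃ ξ₀ : Fam k a V c₀, ξ₀.post i = ξ := by
  obtain ⟨d, y, b, x, η, rfl⟩ := ξ.exists_mk
  simp only [post_mk] at h
  obtain ⟨d', y', p, b', x', q, rfl, rfl, e⟩ := (mk_eq_mk_iff _ _ _ _).1 h
  obtain ⟨η₀, hη₀⟩ := exists_lift_of_injective
    ((vectAction k).comp ((vectAction k).ofHom _ p) ((vectAction k).pull q η)) i hi (fun β v => by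
      refine hfg _ ?_
      have := ConcreteCategory.congr_hom (e β) v
      simpa [ev_comp, ev_ofHom, ev_pull] using this)
  refine ⟨mk y' x' η₀, ?_⟩
  rw [post_mk]
  refine (mk_eq p q rfl rfl fun β => ?_).symm
  rw [ev_comp, ev_ofHom, hη₀, ev_comp, ev_ofHom, ev_pull]

theorem exists_pair {c c' : ModuleCat.{u} k} (ξ : Fam k a V c) (ξ' : Fam k a V c') :
    ∃ ζ : Fam k a V (ModuleCat.of k (c × c')),
      ζ.post (ModuleCat.ofHom (LinearMap.fst k c c')) = ξ ∧
        ζ.post (ModuleCat.ofHom (LinearMap.snd k c c')) = ξ' := by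
  obtain ⟨d, y, b, x, h, h', rfl, rfl⟩ := ξ.exists_mk_mk ξ'
  obtain ⟨H, hH⟩ := exists_ev
    (fun β => (ModuleCat.ofHom ((ev h β).hom.prod (ev h' β).hom) : d ⟶ ModuleCat.of k (c × c')))
    (fun v => (isLocConst_ev h v).prodMk (isLocConst_ev h' v))
  refine ⟨mk y x H, ?_, ?_⟩
  · rw [post_mk]
    congr 1
    refine ev_injective fun β => ?_
    rw [ev_comp, ev_ofHom, hH]
    rfl
  · rw [post_mk]
    congr 1
    refine ev_injective fun β => ?_
    rw [ev_comp, ev_ofHom, hH]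
    rfl

instance (b : IndProFin.{u}) (d c : ModuleCat.{u} k) : Small.{u} ((vectAction k).Hom b d c) :=
  small_of_injective (f := fun h => ev h) fun _ _ e => ev_injective fun β => congrFun e β

instance (a : Pro IndProFin.{u}) (V : ProVect k) (c : ModuleCat.{u} k) :
    Small.{u} (Fam k a V c) := by
  obtain ⟨I, _, _, F, ι, hV⟩ := V.exists_presents
  obtain ⟨J, _, _, G, κ, ha⟩ := a.exists_presents
  exact small_of_surjective (f := fun (z : Σ (i : I) (j : J),
    (vectAction k).Hom (G.obj j).unop (F.obj i).unop c) => mk (hV.proj z.1) (ha.proj z.2.1) z.2.2)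
    fun ξ => by
      obtain ⟨i, j, h, rfl⟩ := exists_stage hV ha ξ
      exact ⟨⟨i, j, h⟩, rfl⟩

end Fam

/-! ### Families over objects of `BSet`, and their corepresentability -/

variable (k) in
/-- `lim_j colim_n colim_l Hom(X_l^j ⊗ V_n, c)`. -/
def BFam (X : BSet.{u}) (V : ProVect k) (c : ModuleCat.{u} k) :=
  {h : ∀ a : Pro IndProFin.{u}, (Ind.yoneda.obj a ⟶ X) → Fam k a V c //
    ∀ (a b : Pro IndProFin.{u}) (f : a ⟶ b) (x : Ind.yoneda.obj b ⟶ X),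
      h a (Ind.yoneda.map f ≫ x) = PseudoAction.OnProColim.pull f (h b x)}

namespace BFam

variable {X : BSet.{u}} {V W : ProVect k}

theorem ext {c : ModuleCat.{u} k} {ξ ξ' : BFam k X V c}
    (h : ∀ (a : Pro IndProFin.{u}) (x : Ind.yoneda.obj a ⟶ X), ξ.1 a x = ξ'.1 a x) : ξ = ξ' :=
  Subtype.ext (funext fun a => funext fun x => h a x)

/-- Composition with a linear map. -/
noncomputable def post {c c' : ModuleCat.{u} k} (ξ : BFam k X V c) (f : c ⟶ c') : BFam k X V c' :=
  ⟨fun a x => Fam.post (ξ.1 a x) f, fun a b g x =>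
    (congrArg (fun t => Fam.post t f) (ξ.2 a b g x)).trans (Fam.pull_post _ _ _).symm⟩

theorem post_post {c c' c'' : ModuleCat.{u} k} (ξ : BFam k X V c) (f : c ⟶ c') (g : c' ⟶ c'') :
    (ξ.post f).post g = ξ.post (f ≫ g) :=
  ext fun _ _ => Fam.post_post _ _ _

theorem post_id {c : ModuleCat.{u} k} (ξ : BFam k X V c) : ξ.post (𝟙 c) = ξ :=
  ext fun _ _ => Fam.post_id _

theorem post_jointly_injective {c c₁ c₂ : ModuleCat.{u} k} {f₁ : c ⟶ c₁} {f₂ : c ⟶ c₂}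
    (hf : ∀ v w, f₁ v = f₁ w → f₂ v = f₂ w → v = w) {ξ ξ' : BFam k X V c}
    (h₁ : ξ.post f₁ = ξ'.post f₁) (h₂ : ξ.post f₂ = ξ'.post f₂) : ξ = ξ' :=
  ext fun a x => Fam.post_jointly_injective hf (congrFun (congrFun (congrArg Subtype.val h₁) a) x)
    (congrFun (congrFun (congrArg Subtype.val h₂) a) x)

/-- Lifts along an injection are unique, so those chosen separately over each pro-object are
automatically compatible. -/
theorem exists_lift {c c₀ : ModuleCat.{u} k} (i : c₀ ⟶ c) (hi : Function.Injective i)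
    (ξ : BFam k X V c) (h : ∀ (a : Pro IndProFin.{u}) (x : Ind.yoneda.obj a ⟶ X),
      ∃ ζ : Fam k a V c₀, ζ.post i = ξ.1 a x) : ∃ ξ₀ : BFam k X V c₀, ξ₀.post i = ξ := by
  choose ζ hζ using h
  exact ⟨⟨ζ, fun a b f x => Fam.post_injective hi (by
    dsimp only
    rw [hζ, ξ.2, ← hζ, Fam.pull_post])⟩, ext hζ⟩

theorem exists_post_eq {c c₀ c' : ModuleCat.{u} k} (i : c₀ ⟶ c) (hi : Function.Injective i)
    {f g : c ⟶ c'} (hfg : ∀ v, f v = g v → ∃ w, i w = v) (ξ : BFam k X V c)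
    (h : ξ.post f = ξ.post g) : ∃ ξ₀ : BFam k X V c₀, ξ₀.post i = ξ :=
  exists_lift i hi ξ fun a x => Fam.exists_post_eq i hi hfg (ξ.1 a x)
    (congrFun (congrFun (congrArg Subtype.val h) a) x)

theorem exists_pair {c c' : ModuleCat.{u} k} (ξ : BFam k X V c) (ξ' : BFam k X V c') :
    ∃ ζ : BFam k X V (ModuleCat.of k (c × c')),
      ζ.post (ModuleCat.ofHom (LinearMap.fst k c c')) = ξ ∧
        ζ.post (ModuleCat.ofHom (LinearMap.snd k c c')) = ξ' := by
  choose ζ h h' using fun a x => Fam.exists_pair (ξ.1 a x) (ξ'.1 a x)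
  refine ⟨⟨ζ, fun a b f x => Fam.post_jointly_injective
    (f₁ := ModuleCat.ofHom (LinearMap.fst k c c')) (f₂ := ModuleCat.ofHom (LinearMap.snd k c c'))
    (fun v w => Prod.ext) ?_ ?_⟩, ext h, ext h'⟩
  · rw [h, ξ.2, ← h, Fam.pull_post]
  · rw [h', ξ'.2, ← h', Fam.pull_post]

theorem eq_of_presents {I : Type u} [SmallCategory I] {F : I ⥤ Pro IndProFin.{u}}
    {ι : ∀ i, Ind.yoneda.obj (F.obj i) ⟶ X} (hX : Presents F X ι) {c : ModuleCat.{u} k}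
    {ξ ξ' : BFam k X V c} (h : ∀ i, ξ.1 _ (ι i) = ξ'.1 _ (ι i)) : ξ = ξ' :=
  ext fun a x => by
    obtain ⟨i, g, rfl⟩ := hX.exists_factor x
    rw [ξ.2, ξ'.2, h]

instance (X : BSet.{u}) (V : ProVect k) (c : ModuleCat.{u} k) : Small.{u} (BFam k X V c) :=
  small_of_injective (f := fun (ξ : BFam k X V c) (i : X.presentation.I) => ξ.1 _
    ((indElt X (X.presentation.F.obj i)).symm (yonedaEquiv (X.presentation.ι.app i))))
    fun _ _ h => eq_of_presents X.presentation.presents fun i => congrFun h i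

/-- The families parametrised by `X` are defined over subspaces of bounded dimension. -/
theorem exists_bound (X : BSet.{u}) (V : ProVect k) : ∃ K : ModuleCat.{u} k,
    ∀ (c : ModuleCat.{u} k) (ξ : BFam k X V c), ∃ (N : Submodule k K)
      (i : ModuleCat.of k (K ⧸ N) ⟶ c) (_ : Function.Injective i)
      (ξ₀ : BFam k X V (ModuleCat.of k (K ⧸ N))), ξ₀.post i = ξ := by
  obtain ⟨I, _, _, F, ι, hV⟩ := V.exists_presents
  choose J hJ hJ' G κ hG using fun i => (X.presentation.F.obj i).exists_presents
  let ιX := fun i => (indElt X (X.presentation.F.obj i)).symm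
    (yonedaEquiv (X.presentation.ι.app i))
  have hX : Presents X.presentation.F X ιX := X.presentation.presents
  -- The stages at which a family is defined depend on the family. The free space on pairs of a
  -- point and a vector at all stages is independent of it, yet maps onto the span of the values of
  -- any family.
  let T : (Σ i : X.presentation.I, I × J i) → Type u := fun z =>
    (pt ⟶ ((G z.1).obj z.2.2).unop) × (F.obj z.2.1).unop
  refine ⟨ModuleCat.of k ((Σ z, T z) →₀ k), fun c ξ => ?_⟩
  choose n l h hh using fun i => Fam.exists_stage hV (hG i) (ξ.1 _ (ιX i))
  -- Generators at stages other than those chosen for `ξ` are sent to `0`.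
  have : ∃ φ : (Σ z, T z) → c, ∀ i β v, φ ⟨⟨i, n i, l i⟩, β, v⟩ = ev (h i) β v := by
    classical
    refine ⟨fun z => if e : z.1 = ⟨z.1.1, n z.1.1, l z.1.1⟩ then
      ev (h z.1.1) (e ▸ z.2 : T ⟨z.1.1, n z.1.1, l z.1.1⟩).1
        (e ▸ z.2 : T ⟨z.1.1, n z.1.1, l z.1.1⟩).2 else 0, fun i β v => ?_⟩
    simp
  obtain ⟨φ, hφ⟩ := this
  let f := Finsupp.linearCombination k φ
  let i : ModuleCat.of k (((Σ z, T z) →₀ k) ⧸ LinearMap.ker f) ⟶ c :=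
    ModuleCat.ofHom ((LinearMap.ker f).liftQ f le_rfl)
  have hi : Function.Injective i := by
    refine LinearMap.ker_eq_bot.1 ?_
    exact Submodule.ker_liftQ_eq_bot _ _ _ le_rfl
  refine ⟨LinearMap.ker f, i, hi, exists_lift i hi ξ fun a x => ?_⟩
  obtain ⟨j, g, rfl⟩ := hX.exists_factor x
  obtain ⟨h₀, hh₀⟩ := exists_lift_of_injective (h j) i hi fun β v =>
    ⟨Submodule.Quotient.mk (Finsupp.single ⟨⟨j, n j, l j⟩, β, v⟩ 1), by
      change f _ = _
      rw [Finsupp.linearCombination_single, one_smul, hφ]⟩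
  refine ⟨PseudoAction.OnProColim.pull g (Fam.mk (hV.proj (n j)) ((hG j).proj (l j)) h₀), ?_⟩
  rw [ξ.2, ← Fam.pull_post, Fam.post_mk, hh]
  congr 2
  exact ev_injective fun β => by rw [ev_comp, ev_ofHom, hh₀]

/-- The component of a family of maps to a pro-vector space. -/
def comp (H : (bsetAction k).Hom X V W) {c : ModuleCat.{u} k} (y : W ⟶ Pro.const.obj c) :
    BFam k X V c :=
  ⟨fun a x => (H.1 a x).1 c y, fun a b f x => congrFun (congrFun (congrArg Subtype.val
    (H.2 a b f x)) c) y⟩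

theorem comp_map (H : (bsetAction k).Hom X V W) {c c' : ModuleCat.{u} k} (y : W ⟶ Pro.const.obj c)
    (f : c ⟶ c') : comp H (y ≫ Pro.const.map f) = (comp H y).post f :=
  ext fun a x => (H.1 a x).2 _ _ f y

theorem hom_ext {H H' : (bsetAction k).Hom X V W}
    (h : ∀ (c : ModuleCat.{u} k) (y : W ⟶ Pro.const.obj c), comp H y = comp H' y) : H = H' :=
  Subtype.ext (funext fun a => funext fun x => Subtype.ext (funext fun c => funext fun y =>
    congrFun (congrFun (congrArg Subtype.val (h c y)) a) x))

theorem exists_hom (ξ : ∀ c : ModuleCat.{u} k, (W ⟶ Pro.const.obj c) → BFam k X V c)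
    (hξ : ∀ (c c' : ModuleCat.{u} k) (f : c ⟶ c') (y : W ⟶ Pro.const.obj c),
      ξ c' (y ≫ Pro.const.map f) = (ξ c y).post f) :
    ∃ H : (bsetAction k).Hom X V W, ∀ (c : ModuleCat.{u} k) (y : W ⟶ Pro.const.obj c),
      comp H y = ξ c y :=
  ⟨⟨fun a x => ⟨fun c y => (ξ c y).1 a x, fun c c' f y =>
    congrFun (congrFun (congrArg Subtype.val (hξ c c' f y)) a) x⟩, fun a b f x =>
      Subtype.ext (funext fun c => funext fun y => (ξ c y).2 a b f x)⟩, fun _ _ => rfl⟩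

theorem comp_comp_ofHom {U : ProVect k} (H : (bsetAction k).Hom X V W) (m : W ⟶ U)
    {c : ModuleCat.{u} k} (y : U ⟶ Pro.const.obj c) :
    comp ((bsetAction k).comp H ((bsetAction k).ofHom X m)) y = comp H (m ≫ y) :=
  post_id (comp H (m ≫ y))

/-- Subfunctors of the functor of families that are closed under products and under lifting along
injective maps are representable. -/
theorem exists_corepresenting (X : BSet.{u}) (V : ProVect k)
    (S : ∀ c : ModuleCat.{u} k, BFam k X V c → Prop)
    (nonempty : ∃ c ξ, S c ξ)
    (map : ∀ {c c' : ModuleCat.{u} k} (f : c ⟶ c') (ξ : BFam k X V c), S c ξ → S c' (ξ.post f))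
    (pair : ∀ {c c' : ModuleCat.{u} k} (ζ : BFam k X V (ModuleCat.of k (c × c'))),
      S _ (ζ.post (ModuleCat.ofHom (LinearMap.fst k c c'))) →
        S _ (ζ.post (ModuleCat.ofHom (LinearMap.snd k c c'))) → S _ ζ)
    (lift : ∀ {c c₀ : ModuleCat.{u} k} (i : c₀ ⟶ c) (ξ : BFam k X V c₀), Function.Injective i →
      S _ (ξ.post i) → S _ ξ) :
    ∃ (I : ProVect k) (θ : (bsetAction k).Hom X V I),
      (∀ (c : ModuleCat.{u} k) (g g' : I ⟶ Pro.const.obj c), comp θ g = comp θ g' → g = g') ∧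
      ∀ (c : ModuleCat.{u} k) (ξ : BFam k X V c), S c ξ ↔
        ∃ g : I ⟶ Pro.const.obj c, comp θ g = ξ := by
  obtain ⟨I, e, he⟩ := Pro.exists_corepresenting
    (fun c : ModuleCat.{u} k => {ξ : BFam k X V c // S c ξ})
    (fun f ξ => ⟨ξ.1.post f, map f ξ.1 ξ.2⟩)
    (fun c ξ => Subtype.ext (post_id ξ.1))
    (fun f g ξ => Subtype.ext (post_post ξ.1 f g).symm)
    (by
      obtain ⟨c, ξ, h⟩ := nonempty
      exact ⟨c, ⟨ξ, h⟩⟩)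
    (fun {c c'} ξ η => by
      obtain ⟨ζ, h, h'⟩ := exists_pair ξ.1 η.1
      exact ⟨_, ⟨ζ, pair ζ (h ▸ ξ.2) (h' ▸ η.2)⟩, _, _, Subtype.ext h, Subtype.ext h'⟩)
    (fun {c c'} f g ξ h => by
      -- The equalizer of `f` and `g`; `lift` keeps the restricted family inside `S`.
      let N := LinearMap.ker (f.hom - g.hom)
      have hN : Function.Injective (incl N) := Subtype.val_injective
      obtain ⟨ξ₀, h₀⟩ := exists_post_eq (incl N) hN (f := f) (g := g)
        (fun v hv => ⟨⟨v, sub_eq_zero.2 hv⟩, rfl⟩) ξ.1 (congrArg Subtype.val h)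
      refine ⟨ModuleCat.of k N, incl N, ⟨ξ₀, lift _ ξ₀ hN (h₀ ▸ ξ.2)⟩, ?_, Subtype.ext h₀⟩
      ext v
      exact sub_eq_zero.1 v.2)
    (by
      obtain ⟨K, hK⟩ := exists_bound X V
      -- By the bound, families valued in quotients of `K` are weakly initial among the elements of
      -- `S`. There is only a small set of them, since each set of families is small.
      let J := Σ N : Submodule k K, {ξ : BFam k X V (ModuleCat.of k (K ⧸ N)) // S _ ξ}
      refine ⟨Shrink.{u} J, fun j => ModuleCat.of k (K ⧸ ((equivShrink J).symm j).1),
        fun j => ((equivShrink J).symm j).2, fun c η => ?_⟩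
      obtain ⟨N, i, hi, ξ₀, h₀⟩ := hK c η.1
      obtain ⟨j, hj⟩ := (equivShrink J).symm.surjective ⟨N, ξ₀, lift i ξ₀ hi (h₀ ▸ η.2)⟩
      have key : ∀ z : J, z = ⟨N, ξ₀, lift i ξ₀ hi (h₀ ▸ η.2)⟩ →
          ∃ f : ModuleCat.of k (K ⧸ z.1) ⟶ c, z.2.1.post f = η.1 := by
        rintro _ rfl
        exact ⟨i, h₀⟩
      obtain ⟨f, hf⟩ := key _ hj
      exact ⟨j, f, Subtype.ext hf⟩)
  obtain ⟨θ, hθ⟩ := exists_hom (W := I) (fun c y => (e c y).1)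
    (fun c c' f y => congrArg Subtype.val (he f y))
  refine ⟨I, θ, fun c g g' h => ?_, fun c ξ => ⟨fun h => ?_, ?_⟩⟩
  · rw [hθ, hθ] at h
    exact (e c).injective (Subtype.ext h)
  · obtain ⟨g, hg⟩ := (e c).surjective ⟨ξ, h⟩
    exact ⟨g, by rw [hθ, hg]⟩
  · rintro ⟨g, rfl⟩
    rw [hθ]
    exact (e c g).2

/-- The tensor product `X ⊗ V`. -/
theorem exists_tensor (X : BSet.{u}) (V : ProVect k) :
    ∃ (T : ProVect k) (θ : (bsetAction k).Hom X V T), ∀ W : ProVect k, Function.Bijective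
      fun m : T ⟶ W => (bsetAction k).comp θ ((bsetAction k).ofHom X m) := by
  -- With no condition imposed, the corepresenting object receives every family, so it is `X ⊗ V`.
  obtain ⟨T, θ, h, h'⟩ := exists_corepresenting X V (fun _ _ => True)
    (by
      obtain ⟨I, _, _, F, ι, hV⟩ := V.exists_presents
      obtain ⟨i⟩ := IsFiltered.nonempty (C := I)
      exact ⟨_, comp ((bsetAction k).ofHom X (𝟙 V)) (hV.proj i), trivial⟩)
    (fun _ _ _ => trivial) (fun _ _ _ => trivial) (fun _ _ _ _ => trivial)
  refine ⟨T, θ, fun W => ⟨fun m m' e => Pro.hom_ext fun c y => h c _ _ ?_, fun H => ?_⟩⟩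
  · rw [← comp_comp_ofHom, ← comp_comp_ofHom]
    exact congrArg (fun t => comp t y) e
  · choose g hg using fun c y => (h' c (comp H y)).1 trivial
    obtain ⟨m, hm⟩ := Pro.exists_hom (X := T) (Y := W) (fun c y => g c y)
      (fun c c' f y => h _ _ _ (by rw [hg, comp_map, comp_map, hg]))
    exact ⟨m, hom_ext fun c y => by rw [comp_comp_ofHom, hm, hg]⟩

end BFam

/-! ### Products of pro-objects -/

section Products

universe v u'

variable {C : Type u'} [Category.{v} C]

theorem Presents.of_fst {I J : Type v} [SmallCategory I] [SmallCategory J] [IsFiltered J]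
    {F : I ⥤ C} {X : Ind C} {ι : ∀ i, Ind.yoneda.obj (F.obj i) ⟶ X} (h : Presents F X ι) :
    Presents (CategoryTheory.Prod.fst I J ⋙ F) X (fun z => ι z.1) where
  naturality f := h.naturality f.1
  exists_factor x := by
    obtain ⟨i, g, hg⟩ := h.exists_factor x
    obtain ⟨j⟩ := IsFiltered.nonempty (C := J)
    exact ⟨(i, j), g, hg⟩
  exists_eq {c z} g g' e := by
    obtain ⟨i, f, hf⟩ := h.exists_eq g g' e
    exact ⟨(i, z.2), (f, 𝟙 _), hf⟩

theorem Presents.of_snd {I J : Type v} [SmallCategory I] [SmallCategory J] [IsFiltered I]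
    {F : J ⥤ C} {X : Ind C} {ι : ∀ i, Ind.yoneda.obj (F.obj i) ⟶ X} (h : Presents F X ι) :
    Presents (CategoryTheory.Prod.snd I J ⋙ F) X (fun z => ι z.2) where
  naturality f := h.naturality f.2
  exists_factor x := by
    obtain ⟨j, g, hg⟩ := h.exists_factor x
    obtain ⟨i⟩ := IsFiltered.nonempty (C := I)
    exact ⟨(i, j), g, hg⟩
  exists_eq {c z} g g' e := by
    obtain ⟨j, f, hf⟩ := h.exists_eq g g' e
    exact ⟨(z.1, j), (𝟙 _, f), hf⟩

variable [HasFiniteLimits C]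

/-- The products of the terms of two pro-systems. -/
noncomputable def prodDiagram {I J : Type v} [SmallCategory I] [SmallCategory J] (F : I ⥤ Cᵒᵖ)
    (G : J ⥤ Cᵒᵖ) : I × J ⥤ Cᵒᵖ where
  obj z := Opposite.op ((F.obj z.1).unop ⨯ (G.obj z.2).unop)
  map f := (prod.map (F.map f.1).unop (G.map f.2).unop).op
  map_id z := by simp
  map_comp f g := by
    rw [← op_comp, prod.map_map]
    simp

/-- `Z` is the formal limit of the termwise products. Its universal property is not needed, only its
presentation by those products and the compatible projections. -/
theorem exists_prodDiagram_presents {I J : Type v} [SmallCategory I] [SmallCategory J]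
    [IsFiltered I] [IsFiltered J] {F : I ⥤ Cᵒᵖ} {G : J ⥤ Cᵒᵖ} {X Y : Pro C}
    {ι : ∀ i, Ind.yoneda.obj (F.obj i) ⟶ X.unop} {κ : ∀ j, Ind.yoneda.obj (G.obj j) ⟶ Y.unop}
    (hX : Presents F X.unop ι) (hY : Presents G Y.unop κ) :
    ∃ (Z : Pro C) (l : ∀ z, Ind.yoneda.obj ((prodDiagram F G).obj z) ⟶ Z.unop)
      (hZ : Presents (prodDiagram F G) Z.unop l) (p : Z ⟶ X) (q : Z ⟶ Y), ∀ i j,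
        p ≫ hX.proj i = hZ.proj (i, j) ≫ Pro.const.map prod.fst ∧
          q ≫ hY.proj j = hZ.proj (i, j) ≫ Pro.const.map prod.snd := by
  obtain ⟨Z, l, hZ⟩ := exists_presents (prodDiagram F G)
  have hZ' : Presents (prodDiagram F G) (Opposite.op Z).unop l := hZ
  obtain ⟨p, hp⟩ := (hX.of_fst (J := J)).exists_desc (Y := Z)
    (fun z => (hZ'.proj z ≫ Pro.const.map prod.fst).unop) (fun {z z'} f => by
      apply Quiver.Hom.op_inj
      change (hZ'.proj z' ≫ Pro.const.map prod.fst) ≫ Pro.const.map (F.map f.1).unop =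
        hZ'.proj z ≫ Pro.const.map prod.fst
      rw [← hZ'.proj_map f, Category.assoc, Category.assoc]
      exact congrArg (hZ'.proj z' ≫ ·) ((Functor.map_comp _ _ _).symm.trans
        ((congrArg (fun t => Pro.const.map t) (prod.map_fst _ _).symm).trans
          (Functor.map_comp _ _ _))))
  obtain ⟨q, hq⟩ := (hY.of_snd (I := I)).exists_desc (Y := Z)
    (fun z => (hZ'.proj z ≫ Pro.const.map prod.snd).unop) (fun {z z'} f => by
      apply Quiver.Hom.op_inj
      change (hZ'.proj z' ≫ Pro.const.map prod.snd) ≫ Pro.const.map (G.map f.2).unop =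
        hZ'.proj z ≫ Pro.const.map prod.snd
      rw [← hZ'.proj_map f, Category.assoc, Category.assoc]
      exact congrArg (hZ'.proj z' ≫ ·) ((Functor.map_comp _ _ _).symm.trans
        ((congrArg (fun t => Pro.const.map t) (prod.map_snd _ _).symm).trans
          (Functor.map_comp _ _ _))))
  exact ⟨Opposite.op Z, l, hZ, p.op, q.op, fun i j =>
    ⟨Quiver.Hom.unop_inj (hp (i, j)), Quiver.Hom.unop_inj (hq (i, j))⟩⟩

/-- The product of two pro-objects; maps from it to objects of `C` factor through the products of
the terms. -/
theorem exists_product {I J : Type v} [SmallCategory I] [SmallCategory J]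
    [IsFiltered I] [IsFiltered J] {F : I ⥤ Cᵒᵖ} {G : J ⥤ Cᵒᵖ} {X Y : Pro C}
    {ι : ∀ i, Ind.yoneda.obj (F.obj i) ⟶ X.unop} {κ : ∀ j, Ind.yoneda.obj (G.obj j) ⟶ Y.unop}
    (hX : Presents F X.unop ι) (hY : Presents G Y.unop κ) :
    ∃ (Z : Pro C) (p : Z ⟶ X) (q : Z ⟶ Y), ∀ (i : I) (j : J) (B : C) (z : Z ⟶ Pro.const.obj B)
      (u : B ⟶ (F.obj i).unop) (v : B ⟶ (G.obj j).unop),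
      z ≫ Pro.const.map u = p ≫ hX.proj i → z ≫ Pro.const.map v = q ≫ hY.proj j →
        ∃ (i' : I) (f : i ⟶ i') (j' : J) (g : j ⟶ j')
          (r : (F.obj i').unop ⨯ (G.obj j').unop ⟶ B),
          r ≫ u = prod.fst ≫ (F.map f).unop ∧ r ≫ v = prod.snd ≫ (G.map g).unop := by
  obtain ⟨Z, l, hZ, p, q, hpq⟩ := exists_prodDiagram_presents hX hY
  refine ⟨Z, p, q, fun i j B z u v hu hv => ?_⟩
  -- The hypotheses say that `z` followed by `(u, v)` is the projection to the `(i, j)` term, so a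
  -- later term dominates `B` compatibly with the transition maps.
  obtain ⟨⟨i', j'⟩, f, r, -, hr⟩ := hZ.exists_proj_eq_of_factor (i := (i, j)) z (prod.lift u v) (by
    apply Pro.prod_hom_ext
    · refine Eq.trans ?_ (hu.trans (hpq i j).1)
      exact (Category.assoc _ _ _).trans (congrArg (z ≫ ·)
        ((Functor.map_comp _ _ _).symm.trans (congrArg (fun t => Pro.const.map t)
          (prod.lift_fst _ _))))
    · refine Eq.trans ?_ (hv.trans (hpq i j).2)
      exact (Category.assoc _ _ _).trans (congrArg (z ≫ ·)
        ((Functor.map_comp _ _ _).symm.trans (congrArg (fun t => Pro.const.map t)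
          (prod.lift_snd _ _)))))
  have hr' : r ≫ prod.lift u v = prod.map (F.map f.1).unop (G.map f.2).unop := hr
  refine ⟨i', f.1, j', f.2, r, ?_, ?_⟩
  · have := congrArg (· ≫ prod.fst) hr'
    dsimp only at this
    rw [Category.assoc, prod.lift_fst] at this
    exact this.trans (prod.map_fst _ _)
  · have := congrArg (· ≫ prod.snd) hr'
    dsimp only at this
    rw [Category.assoc, prod.lift_snd] at this
    exact this.trans (prod.map_snd _ _)

end Products

/-! ### Cancelling an epimorphic family under weak strictness -/

namespace Fam

theorem pull_mk {a a' : Pro IndProFin.{u}} {V : ProVect k} (f : a' ⟶ a) {d : ModuleCat.{u} k}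
    (y : V ⟶ Pro.const.obj d) {b : IndProFin.{u}} (x : a ⟶ Pro.const.obj b) {c : ModuleCat.{u} k}
    (h : (vectAction k).Hom b d c) :
    PseudoAction.OnProColim.pull f (mk y x h) = mk y (f ≫ x) h := rfl

/-- The composition with a family whose source is a pro-object. -/
noncomputable def bind {a : Pro IndProFin.{u}} {V I : ProVect k} {c : ModuleCat.{u} k}
    (ξ : Fam k a I c) (θ : (vectAction k).pro.OnProHom a V I) : Fam k a V c :=
  PseudoAction.OnProColim.bind ξ θ

theorem mk_bind {a : Pro IndProFin.{u}} {V I : ProVect k} {d e c : ModuleCat.{u} k}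
    {y : I ⟶ Pro.const.obj d} {b : IndProFin.{u}} {x : a ⟶ Pro.const.obj b}
    {h : (vectAction k).Hom b d c} {θ : (vectAction k).pro.OnProHom a V I}
    {v : V ⟶ Pro.const.obj e} {b' : IndProFin.{u}} {x' : a ⟶ Pro.const.obj b'}
    {t : (vectAction k).Hom b' e d} (ht : θ.1 d y = mk v x' t) :
    bind (mk y x h) θ = mk v (Pro.lift x' x)
      ((vectAction k).comp ((vectAction k).pull prod.fst t) ((vectAction k).pull prod.snd h)) := by
  change PseudoAction.OnProColim.postcomp (θ.1 d y)
    (Quot.mk _ ⟨b, x, h⟩ : (vectAction k).pro.Hom a d c) = _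
  rw [ht]
  rfl

end Fam

/-- If a family of maps `V ⟶ I` parametrised by `X` is an epimorphism, and `Y` is weakly strict,
then families of maps from `I` parametrised by `Y` are determined by their composition with it. -/
theorem Fam.eq_of_bind_eq {X : BSet.{u}} {V I : ProVect k}
    (θ : (bsetAction k).Hom X V I)
    (hθ : ∀ (c : ModuleCat.{u} k) (g g' : I ⟶ Pro.const.obj c),
      BFam.comp θ g = BFam.comp θ g' → g = g')
    {a : Pro IndProFin.{u}} (ha : WeaklyStrict a) {c : ModuleCat.{u} k} (ξ ξ' : Fam k a I c)
    (e : ∀ (z a' : Pro IndProFin.{u}) (p : z ⟶ a) (q : z ⟶ a') (x : Ind.yoneda.obj a' ⟶ X),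
      Fam.bind (PseudoAction.OnProColim.pull p ξ) (θ.1 z (Ind.yoneda.map q ≫ x)) =
        Fam.bind (PseudoAction.OnProColim.pull p ξ') (θ.1 z (Ind.yoneda.map q ≫ x))) :
    ξ = ξ' := by
  obtain ⟨pa, hpa⟩ := ha
  have hA := pa.presents
  obtain ⟨d, y, b, x, h, h', rfl, rfl⟩ := ξ.exists_mk_mk ξ'
  obtain ⟨j, g, rfl⟩ := hA.exists_proj x
  have h_eq : ∀ η : (vectAction k).Hom b d c, Fam.mk y (hA.proj j ≫ Pro.const.map g) η =
      Fam.mk y (hA.proj j) ((vectAction k).pull g η) := fun η =>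
    Fam.mk_eq (𝟙 _) g (by simp) rfl fun β => by rw [Category.id_comp, ev_pull]
  rw [h_eq, h_eq] at e ⊢
  generalize (vectAction k).pull g h = h at e ⊢
  generalize (vectAction k).pull g h' = h' at e ⊢
  -- the subspace on which the two families agree
  let d₀ : Submodule k d := ⨅ β, LinearMap.ker ((ev h β).hom - (ev h' β).hom)
  have mem_d₀ : ∀ v, v ∈ d₀ ↔ ∀ β, ev h β v = ev h' β v := fun v => by
    simp only [d₀, Submodule.mem_iInf, LinearMap.mem_ker, LinearMap.sub_apply, sub_eq_zero]
  let π : d ⟶ ModuleCat.of k (d ⧸ d₀) := ModuleCat.ofHom d₀.mkQ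
  -- It suffices that `I ⟶ d` lands in `d₀`. Since `θ` is epimorphic, this can be checked on the
  -- values of `θ`.
  have key : y ≫ Pro.const.map π = y ≫ Pro.const.map 0 := by
    refine hθ _ _ _ (BFam.ext fun a' x' => ?_)
    rw [BFam.comp_map, BFam.comp_map]
    change Fam.post ((θ.1 a' x').1 d y) π = Fam.post ((θ.1 a' x').1 d y) 0
    obtain ⟨K, _, _, F, ι, hV⟩ := V.exists_presents
    obtain ⟨J, _, _, G, κ, hA'⟩ := a'.exists_presents
    obtain ⟨n, l, t, ht⟩ := Fam.exists_stage hV hA' ((θ.1 a' x').1 d y)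
    obtain ⟨Z, p, q, hZ⟩ := exists_product hA hA'
    have ht' : (θ.1 Z (Ind.yoneda.map q ≫ x')).1 d y =
        Fam.mk (hV.proj n) (q ≫ hA'.proj l) t := by
      rw [θ.2, ← Fam.pull_mk, ← ht]
      rfl
    have e' := e Z a' p q x'
    rw [Fam.pull_mk, Fam.pull_mk, Fam.mk_bind ht', Fam.mk_bind ht'] at e'
    obtain ⟨d', v', f, B, xB, gB, hf, hgB, H⟩ := (Fam.mk_eq_mk_iff _ _ _ _).1 e'
    -- The stage `B` where the composites agree is dominated by a product of later stages of `a` and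
    -- `a'`. The agreement can thus be evaluated at independently chosen points `β` and `γ`.
    obtain ⟨m, φ, m', φ', r, hr, hr'⟩ := hZ j l B xB (gB ≫ prod.snd) (gB ≫ prod.fst)
      (by rw [Functor.map_comp, ← Category.assoc, hgB, Pro.lift_snd])
      (by rw [Functor.map_comp, ← Category.assoc, hgB, Pro.lift_fst])
    obtain ⟨t', ht'⟩ : ∃ t' : (vectAction k).Hom (G.obj m').unop d' d,
        ∀ γ, ev t' γ = f ≫ ev t (γ ≫ (G.map φ').unop) :=
      ⟨(vectAction k).comp ((vectAction k).ofHom _ f) ((vectAction k).pull (G.map φ').unop t),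
        fun γ => by rw [ev_comp, ev_ofHom, ev_pull]⟩
    have ht₀ : ∀ γ w, ev t' γ w ∈ d₀ := by
      intro γ w
      refine (mem_d₀ _).2 fun β => ?_
      -- With `γ` and `w` fixed, agreement is known only for points coming from the later stage of
      -- `a`. Weak surjectivity of the transition map extends it to all points of the original
      -- stage, as membership in `d₀` requires.
      refine congrFun ((hpa _ _ φ).eq_of_comp_eq (isLocConst_ev h (ev t' γ w))
        (isLocConst_ev h' (ev t' γ w)) fun β => ?_) β
      have := ConcreteCategory.congr_hom (H (prod.lift β γ ≫ r)) w
      simp only [ev_comp, ev_pull, Category.assoc, hr, hr', prod.lift_fst_assoc,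
        prod.lift_snd_assoc] at this
      rw [ht']
      exact this
    have ht'' : (θ.1 a' x').1 d y = Fam.mk v' (hA'.proj m') t' :=
      ht.trans (Fam.mk_eq f (G.map φ').unop hf (hA'.proj_map φ') fun γ => (ht' γ).symm)
    rw [ht'', Fam.post_mk, Fam.post_mk]
    congr 1
    refine ev_injective fun γ => ?_
    rw [ev_comp, ev_ofHom, ev_comp, ev_ofHom]
    ext w
    exact (Submodule.Quotient.mk_eq_zero _).2 (ht₀ γ w)
  -- At a later stage of `I` the map to `d` lands in `d₀`, where `h` and `h'` agree by definition.
  obtain ⟨d', z, i, hz, hi⟩ := Pro.exists_equalize y _ _ key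
  refine (Fam.mk_eq_mk_iff _ _ _ _).2 ⟨d', z, i, _, hA.proj j, 𝟙 _, hz, by simp, fun β => ?_⟩
  ext v
  rw [Category.comp_id]
  exact (mem_d₀ (i v)).1 ((Submodule.Quotient.mk_eq_zero _).1 (ConcreteCategory.congr_hom hi v)) β

/-- A family over `Y` is determined on the weakly strict terms of a presentation, where
`Fam.eq_of_bind_eq` applies. `Z` plays the role of `Y × X`; only the existence of maps into it is
used. -/
theorem BFam.eq_of_comp_eq {X Y Z : BSet.{u}} (hY : ConditionStarStar Y) {V I U : ProVect k}
    (θ : (bsetAction k).Hom X V I)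
    (hθ : ∀ (c : ModuleCat.{u} k) (g g' : I ⟶ Pro.const.obj c),
      BFam.comp θ g = BFam.comp θ g' → g = g')
    (p : Z ⟶ Y) (q : Z ⟶ X)
    (hZ : ∀ (W : BSet.{u}) (y : W ⟶ Y) (x : W ⟶ X), ∃ z : W ⟶ Z, z ≫ p = y ∧ z ≫ q = x)
    {η η' : (bsetAction k).Hom Y I U}
    (e : (bsetAction k).comp ((bsetAction k).pull q θ) ((bsetAction k).pull p η) =
      (bsetAction k).comp ((bsetAction k).pull q θ) ((bsetAction k).pull p η')) : η = η' := by
  refine BFam.hom_ext fun c y => ?_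
  obtain ⟨pY, hpY⟩ := hY
  refine BFam.eq_of_presents pY.presents fun i => Fam.eq_of_bind_eq θ hθ (hpY i) _ _ ?_
  intro z a' f g x
  obtain ⟨s, hs, hs'⟩ := hZ (Ind.yoneda.obj z) (Ind.yoneda.map f ≫ _) (Ind.yoneda.map g ≫ x)
  have := congrFun (congrFun (congrArg Subtype.val (congrArg (fun t => BFam.comp t y) e)) z) s
  have h : ∀ η : (bsetAction k).Hom Y I U,
      (BFam.comp ((bsetAction k).comp ((bsetAction k).pull q θ) ((bsetAction k).pull p η)) y).1 z s =
        Fam.bind ((η.1 z (s ≫ p)).1 c y) (θ.1 z (s ≫ q)) := fun η => rfl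
  rw [h, h, hs, hs'] at this
  rw [η.2, η'.2] at this
  exact this

open CartesianMonoidalCategory

/-! ### Embeddings and images -/

/-- A family of constant maps over a point determines the map. -/
theorem ofHom_unit_injective {V W : ProVect k} {f g : V ⟶ W}
    (h : (bsetAction k).ofHom (MonoidalCategory.tensorUnit BSet.{u}) f =
      (bsetAction k).ofHom _ g) : f = g := by
  refine Pro.hom_ext fun c y => ?_
  let a : Pro IndProFin.{u} := Pro.const.obj pt
  have e : Fam.mk (f ≫ y) (Pro.toTerminal a) ((vectAction k).ofHom (⊤_ IndProFin.{u}) (𝟙 c)) =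
      Fam.mk (g ≫ y) (Pro.toTerminal a) ((vectAction k).ofHom (⊤_ IndProFin.{u}) (𝟙 c)) :=
    congrFun (congrFun (congrArg Subtype.val (congrArg (fun t => BFam.comp t y) h)) a) (toUnit _)
  obtain ⟨d, z, p, q, hp, hq⟩ := Pro.exists_pair (f ≫ y) (g ≫ y)
  have key : ∀ (r : d ⟶ c) (w : V ⟶ Pro.const.obj c), z ≫ Pro.const.map r = w →
      Fam.mk w (Pro.toTerminal a) ((vectAction k).ofHom (⊤_ IndProFin.{u}) (𝟙 c)) =
        Fam.mk z (Pro.toTerminal a) ((vectAction k).ofHom (⊤_ IndProFin.{u}) r) := fun r w hw =>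
    Fam.mk_eq r (𝟙 _) hw (by simp) fun β => by rw [ev_ofHom, ev_ofHom, Category.comp_id]
  rw [key p _ hp, key q _ hq] at e
  obtain ⟨d', y', i, b, x, j, rfl, hx, H⟩ := (Fam.mk_eq_mk_iff _ _ _ _).1 e
  -- `x` amounts to a point of `b`, at which the equality of constant families can be evaluated; if
  -- `b` had no points, `H` would be vacuous.
  have := H (Pro.const.preimage x)
  rw [ev_ofHom, ev_ofHom] at this
  rw [← hp, ← hq, Category.assoc, Category.assoc, ← Functor.map_comp, ← Functor.map_comp, this]

/-- A map of pro-vector spaces is an embedding if every map from the source to a vector space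
extends to the target. -/
def IsEmb {V W : ProVect k} (m : V ⟶ W) : Prop :=
  ∀ (c : ModuleCat.{u} k) (g : V ⟶ Pro.const.obj c), ∃ y : W ⟶ Pro.const.obj c, m ≫ y = g

theorem IsEmb.hom_ext {V W U : ProVect k} {m : V ⟶ W} (hm : IsEmb m) {f g : U ⟶ V}
    (h : f ≫ m = g ≫ m) : f = g :=
  Pro.hom_ext fun c y => by
    obtain ⟨y, rfl⟩ := hm c y
    rw [← Category.assoc, h, Category.assoc]

theorem IsEmb.family_ext {X : BSet.{u}} {V W U : ProVect k} {m : V ⟶ W} (hm : IsEmb m)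
    {f g : (bsetAction k).Hom X U V} (h : (bsetAction k).comp f ((bsetAction k).ofHom X m) =
      (bsetAction k).comp g ((bsetAction k).ofHom X m)) : f = g :=
  BFam.hom_ext fun c y => by
    obtain ⟨y, rfl⟩ := hm c y
    rw [← BFam.comp_comp_ofHom, h, BFam.comp_comp_ofHom]

theorem exists_retraction {c c' : ModuleCat.{u} k} (i : c ⟶ c') (hi : Function.Injective i) :
    ∃ r : c' ⟶ c, i ≫ r = 𝟙 c := by
  obtain ⟨r, hr⟩ := LinearMap.exists_leftInverse_of_injective i.hom (LinearMap.ker_eq_bot.2 hi)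
  exact ⟨ModuleCat.ofHom r, ModuleCat.hom_ext hr⟩

/-- A family of maps `V ⟶ W` parametrised by `X` factors into an epimorphism and an embedding. -/
theorem exists_image {X : BSet.{u}} {V W : ProVect k} (θ : (bsetAction k).Hom X V W) :
    ∃ (I : ProVect k) (τ : (bsetAction k).Hom X V I) (m : I ⟶ W),
      (∀ (c : ModuleCat.{u} k) (g g' : I ⟶ Pro.const.obj c),
        BFam.comp τ g = BFam.comp τ g' → g = g') ∧
      IsEmb m ∧ (bsetAction k).comp τ ((bsetAction k).ofHom X m) = θ := by
  -- The image corepresents the subfunctor of those families that are `θ` followed by a map out of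
  -- `W`.
  obtain ⟨I, τ, hτ, hS⟩ := BFam.exists_corepresenting X V
    (fun c ξ => ∃ y : W ⟶ Pro.const.obj c, BFam.comp θ y = ξ)
    (by
      obtain ⟨J, _, _, F, ι, hW⟩ := W.exists_presents
      obtain ⟨i⟩ := IsFiltered.nonempty (C := J)
      exact ⟨_, _, hW.proj i, rfl⟩)
    (by
      rintro c c' f _ ⟨y, rfl⟩
      exact ⟨y ≫ Pro.const.map f, BFam.comp_map _ _ _⟩)
    (by
      rintro c c' ζ ⟨y, hy⟩ ⟨y', hy'⟩
      obtain ⟨d, z, p, q, rfl, rfl⟩ := Pro.exists_pair y y'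
      refine ⟨z ≫ Pro.const.map (ModuleCat.ofHom (p.hom.prod q.hom)),
        BFam.post_jointly_injective (f₁ := ModuleCat.ofHom (LinearMap.fst k c c'))
          (f₂ := ModuleCat.ofHom (LinearMap.snd k c c')) (fun v w => Prod.ext) ?_ ?_⟩
      · rw [← BFam.comp_map, ← hy, Category.assoc, ← Functor.map_comp]
        rfl
      · rw [← BFam.comp_map, ← hy', Category.assoc, ← Functor.map_comp]
        rfl)
    (by
      rintro c c₀ i ξ hi ⟨y, hy⟩
      -- Injections of vector spaces split, so a family lying in the subfunctor after `i` already
      -- lies in it.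
      obtain ⟨r, hr⟩ := exists_retraction i hi
      exact ⟨y ≫ Pro.const.map r, by rw [BFam.comp_map, hy, BFam.post_post, hr, BFam.post_id]⟩)
  choose g hg using fun c y => (hS c (BFam.comp θ y)).1 ⟨y, rfl⟩
  obtain ⟨m, hm⟩ := Pro.exists_hom (X := I) (Y := W) (fun c y => g c y)
    (fun c c' f y => hτ _ _ _ (by rw [hg, BFam.comp_map, BFam.comp_map, hg]))
  refine ⟨I, τ, m, hτ, fun c g' => ?_, BFam.hom_ext fun c y => by
    rw [BFam.comp_comp_ofHom, hm, hg]⟩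
  obtain ⟨y, hy⟩ := (hS c (BFam.comp τ g')).2 ⟨g', rfl⟩
  exact ⟨y, hτ _ _ _ (by rw [hm, hg, hy])⟩

/-! ### Generated subrepresentations -/

namespace Rep

/-- Every use of condition (**) passes through this cancellation over `G × G`, with the epimorphic
family in the second factor. -/
theorem eq_of_comp_eq {G : BSet.{u}} (hG : ConditionStarStar G) {V I U : ProVect k}
    {θ : (bsetAction k).Hom G V I} (hθ : ∀ (c : ModuleCat.{u} k) (g g' : I ⟶ Pro.const.obj c),
      BFam.comp θ g = BFam.comp θ g' → g = g') {h h' : (bsetAction k).Hom G I U}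
    (e : (bsetAction k).comp ((bsetAction k).pull (snd G G) θ) ((bsetAction k).pull (fst G G) h) =
      (bsetAction k).comp ((bsetAction k).pull (snd G G) θ)
        ((bsetAction k).pull (fst G G) h')) : h = h' :=
  BFam.eq_of_comp_eq hG θ hθ (fst G G) (snd G G)
    (fun _ y x => ⟨CartesianMonoidalCategory.lift y x, by simp, by simp⟩) e

variable {G : BSet.{u}} [GrpObj G]

/-- The family of maps `v ↦ g (f v)` parametrised by `G`. -/
noncomputable def orbit {V : ProVect k} (M : Rep k G) (f : V ⟶ M.V) : (bsetAction k).Hom G V M.V :=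
  (bsetAction k).comp ((bsetAction k).ofHom G f) M.ρ

theorem pull_mul_orbit {V : ProVect k} (M : Rep k G) (f : V ⟶ M.V) :
    (bsetAction k).pull (MonObj.mul : MonoidalCategory.tensorObj G G ⟶ G) (M.orbit f) =
      (bsetAction k).comp ((bsetAction k).pull (snd G G) (M.orbit f))
        ((bsetAction k).pull (fst G G) M.ρ) := by
  rw [orbit, PseudoAction.pull_comp, M.mul_act, PseudoAction.pull_comp, PseudoAction.pull_ofHom,
    PseudoAction.pull_ofHom, PseudoAction.assoc]

theorem pull_one_orbit {V : ProVect k} (M : Rep k G) (f : V ⟶ M.V) :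
    (bsetAction k).pull (MonObj.one : MonoidalCategory.tensorUnit BSet.{u} ⟶ G) (M.orbit f) =
      (bsetAction k).ofHom _ f := by
  rw [orbit, PseudoAction.pull_comp, M.one_act, PseudoAction.pull_ofHom, PseudoAction.comp_id]

theorem orbit_comp {V : ProVect k} {M N : Rep k G} (f : V ⟶ M.V) (φ : M ⟶ N) :
    (bsetAction k).comp (M.orbit f) ((bsetAction k).ofHom G φ.hom) = N.orbit (f ≫ φ.hom) := by
  rw [orbit, orbit, PseudoAction.assoc, φ.comm, PseudoAction.ofHom_comp, PseudoAction.assoc]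

/-- The representation `M` is generated by the image of `f : V ⟶ M`. -/
def Generates {V : ProVect k} (M : Rep k G) (f : V ⟶ M.V) : Prop :=
  ∀ (c : ModuleCat.{u} k) (g g' : M.V ⟶ Pro.const.obj c),
    BFam.comp (M.orbit f) g = BFam.comp (M.orbit f) g' → g = g'

/-- The structure of a representation on an object with a jointly monic family of maps to
representations through which the action lifts. -/
def ofFamily {κ : Sort*} (M : κ → Rep k G) {I : ProVect k} (m : ∀ j, I ⟶ (M j).V)
    (ext : ∀ {X : BSet.{u}} (f g : (bsetAction k).Hom X I I),
      (∀ j, (bsetAction k).comp f ((bsetAction k).ofHom X (m j)) =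
        (bsetAction k).comp g ((bsetAction k).ofHom X (m j))) → f = g)
    (ρ : (bsetAction k).Hom G I I)
    (hρ : ∀ j, (bsetAction k).comp ρ ((bsetAction k).ofHom G (m j)) =
      (bsetAction k).comp ((bsetAction k).ofHom G (m j)) (M j).ρ) : Rep k G :=
  have h : ∀ {Z : BSet.{u}} (p : Z ⟶ G) (j : κ), (bsetAction k).comp ((bsetAction k).pull p ρ)
      ((bsetAction k).ofHom Z (m j)) =
        (bsetAction k).comp ((bsetAction k).ofHom Z (m j)) ((bsetAction k).pull p (M j).ρ) :=
    fun p j => by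
      rw [← PseudoAction.pull_ofHom _ p, ← PseudoAction.pull_comp, hρ, PseudoAction.pull_comp]
  { V := I
    ρ := ρ
    mul_act := ext _ _ fun j => by
      rw [h, (M j).mul_act]
      refine Eq.symm ((PseudoAction.assoc _ _ _ _).trans ?_)
      rw [h, ← PseudoAction.assoc, ← PseudoAction.assoc, h]
    one_act := ext _ _ fun j => by
      rw [h, (M j).one_act, PseudoAction.comp_id, PseudoAction.id_comp] }

/-- The subrepresentation generated by the image of a map. -/
theorem exists_generated (hG : ConditionStarStar G) {V : ProVect k} (M : Rep k G) (f : V ⟶ M.V) :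
    ∃ (N : Rep k G) (f' : V ⟶ N.V) (m : N ⟶ M), f' ≫ m.hom = f ∧ IsEmb m.hom ∧
      N.Generates f' := by
  obtain ⟨I, τ, m, hτ, hm, hτm⟩ := exists_image (M.orbit f)
  -- Stability of the image: `y (g x)` with `x` in `I` depends only on the restriction of `y` to
  -- `I`. After composition with `τ` it becomes `y (g₁ g₂ (f v))`, which is `m ≫ y` applied to `τ`
  -- at `g₁ g₂`; then `τ` is cancelled.
  have hσ : ∀ {c : ModuleCat.{u} k} (y y' : M.V ⟶ Pro.const.obj c), m ≫ y = m ≫ y' →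
      (bsetAction k).comp ((bsetAction k).comp ((bsetAction k).ofHom G m) M.ρ)
          ((bsetAction k).ofHom G y) =
        (bsetAction k).comp ((bsetAction k).comp ((bsetAction k).ofHom G m) M.ρ)
          ((bsetAction k).ofHom G y') := by
    intro c y y' e
    have key : ∀ y : M.V ⟶ Pro.const.obj c, (bsetAction k).comp ((bsetAction k).pull (snd G G) τ)
        ((bsetAction k).pull (fst G G) ((bsetAction k).comp
          ((bsetAction k).comp ((bsetAction k).ofHom G m) M.ρ) ((bsetAction k).ofHom G y))) =
        (bsetAction k).pull MonObj.mul
          ((bsetAction k).comp τ ((bsetAction k).ofHom G (m ≫ y))) := by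
      intro y
      have h : (bsetAction k).pull MonObj.mul
          ((bsetAction k).comp τ ((bsetAction k).ofHom G (m ≫ y))) =
          (bsetAction k).comp ((bsetAction k).pull MonObj.mul (M.orbit f))
            ((bsetAction k).ofHom _ y) := by
        rw [PseudoAction.ofHom_comp, ← PseudoAction.assoc, hτm, PseudoAction.pull_comp,
          PseudoAction.pull_ofHom]
      rw [h, pull_mul_orbit, ← hτm]
      simp only [PseudoAction.pull_comp, PseudoAction.pull_ofHom, PseudoAction.assoc]
    exact eq_of_comp_eq hG hτ ((key y).trans ((congrArg _ (by rw [e])).trans (key y').symm))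
  have hσ' : ∀ {c : ModuleCat.{u} k} (y y' : M.V ⟶ Pro.const.obj c), m ≫ y = m ≫ y' →
      BFam.comp ((bsetAction k).comp ((bsetAction k).ofHom G m) M.ρ) y =
        BFam.comp ((bsetAction k).comp ((bsetAction k).ofHom G m) M.ρ) y' := fun y y' e => by
    have h := congrArg (fun t => BFam.comp t (𝟙 _)) (hσ y y' e)
    simpa only [BFam.comp_comp_ofHom, Category.comp_id] using h
  choose y hy using hm
  -- The action on `I` is defined on a map out of `I` by extending that map to `M`; `hσ'` makes the
  -- choice of extension irrelevant.
  obtain ⟨ρ, hρ⟩ := BFam.exists_hom (X := G) (V := I) (W := I)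
    (fun c g => BFam.comp ((bsetAction k).comp ((bsetAction k).ofHom G m) M.ρ) (y c g))
    (fun c c' g x => by
      rw [← BFam.comp_map]
      exact hσ' _ _ (by rw [hy, ← Category.assoc, hy]))
  have hρm : (bsetAction k).comp ρ ((bsetAction k).ofHom G m) =
      (bsetAction k).comp ((bsetAction k).ofHom G m) M.ρ := BFam.hom_ext fun c x => by
    rw [BFam.comp_comp_ofHom, hρ]
    exact hσ' _ _ (hy _ _)
  have hm : IsEmb m := fun c g => ⟨y c g, hy c g⟩
  -- Restricting the orbit to the unit of `G` recovers `f`, so `f` lands in `I`.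
  have hf : ∀ {c : ModuleCat.{u} k} (y y' : M.V ⟶ Pro.const.obj c), m ≫ y = m ≫ y' →
      f ≫ y = f ≫ y' := by
    intro c y y' e
    have key : ∀ y : M.V ⟶ Pro.const.obj c, (bsetAction k).ofHom _ (f ≫ y) =
        (bsetAction k).pull MonObj.one
          ((bsetAction k).comp τ ((bsetAction k).ofHom G (m ≫ y))) := by
      intro y
      rw [PseudoAction.ofHom_comp, PseudoAction.ofHom_comp, ← PseudoAction.assoc, hτm,
        PseudoAction.pull_comp, pull_one_orbit, PseudoAction.pull_ofHom]
    exact ofHom_unit_injective ((key y).trans ((congrArg _ (by rw [e])).trans (key y').symm))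
  obtain ⟨f', hf'⟩ := Pro.exists_hom (X := V) (Y := I) (fun c g => f ≫ y c g)
    (fun c c' g x => by
      rw [Category.assoc]
      exact hf _ _ (by rw [hy, ← Category.assoc, hy]))
  have hf'm : f' ≫ m = f := Pro.hom_ext fun c x => by
    rw [Category.assoc, hf']
    exact hf _ _ (hy _ _)
  -- The orbit of `f'` is the epimorphic family `τ`, which is what generation demands.
  have h : (bsetAction k).comp ((bsetAction k).ofHom G f') ρ = τ := hm.family_ext (by
    rw [PseudoAction.assoc, hρm, ← PseudoAction.assoc, ← PseudoAction.ofHom_comp, hf'm, hτm]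
    rfl)
  refine ⟨ofFamily (fun _ : Unit => M) (fun _ => m) (fun _ _ h => hm.family_ext (h ())) ρ
    fun _ => hρm, f', ⟨m, hρm⟩, hf'm, hm, fun c g g' e => hτ c g g' ?_⟩
  rw [← h]
  exact e

theorem comp_orbit_comp {V : ProVect k} {M N : Rep k G} (f : V ⟶ M.V) (φ : M ⟶ N)
    {c : ModuleCat.{u} k} (y : N.V ⟶ Pro.const.obj c) :
    BFam.comp (N.orbit (f ≫ φ.hom)) y = BFam.comp (M.orbit f) (φ.hom ≫ y) := by
  rw [← orbit_comp, BFam.comp_comp_ofHom]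

/-- Since `M` is generated, the lifts `x` are unique and assemble into a linear map carrying one
orbit to the other. Comparison at the unit gives `f ≫ φ = g`; comparison along multiplication gives
equivariance on the orbit of `f`, which is then cancelled. -/
theorem exists_hom_of_generates (hG : ConditionStarStar G) {V : ProVect k} {M N : Rep k G}
    {f : V ⟶ M.V} {g : V ⟶ N.V} (hf : M.Generates f)
    (h : ∀ (c : ModuleCat.{u} k) (y : N.V ⟶ Pro.const.obj c),
      ∃ x : M.V ⟶ Pro.const.obj c, BFam.comp (M.orbit f) x = BFam.comp (N.orbit g) y) :
    ∃ φ : M ⟶ N, f ≫ φ.hom = g := by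
  choose x hx using h
  obtain ⟨m, hm⟩ := Pro.exists_hom (X := M.V) (Y := N.V) x
    (fun c c' r y => hf _ _ _ (by rw [hx, BFam.comp_map, BFam.comp_map, hx]))
  have hθ : (bsetAction k).comp (M.orbit f) ((bsetAction k).ofHom G m) = N.orbit g :=
    BFam.hom_ext fun c y => by rw [BFam.comp_comp_ofHom, hm, hx]
  have hfg : f ≫ m = g := ofHom_unit_injective (by
    rw [PseudoAction.ofHom_comp, ← pull_one_orbit, ← pull_one_orbit N g, ← hθ,
      PseudoAction.pull_comp, PseudoAction.pull_ofHom])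
  refine ⟨⟨m, eq_of_comp_eq hG hf ?_⟩, hfg⟩
  have e := congrArg ((bsetAction k).pull (MonObj.mul : MonoidalCategory.tensorObj G G ⟶ G)) hθ
  rw [PseudoAction.pull_comp, pull_mul_orbit, pull_mul_orbit, ← hθ] at e
  simpa only [PseudoAction.pull_comp, PseudoAction.pull_ofHom, PseudoAction.assoc] using e

/-- If families parametrised by `G` with values in the quotients of a suitable vector space lift
from `N` to `M`, then so do all families. -/
theorem exists_comp_orbit_bound (V : ProVect k) : ∃ K : ModuleCat.{u} k,
    ∀ (M N : Rep k G) (f : V ⟶ M.V) (g : V ⟶ N.V),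
    (∀ (L : Submodule k K) (y : N.V ⟶ Pro.const.obj (ModuleCat.of k (K ⧸ L))),
      ∃ x : M.V ⟶ Pro.const.obj (ModuleCat.of k (K ⧸ L)),
        BFam.comp (M.orbit f) x = BFam.comp (N.orbit g) y) →
    ∀ (c : ModuleCat.{u} k) (y : N.V ⟶ Pro.const.obj c),
      ∃ x : M.V ⟶ Pro.const.obj c, BFam.comp (M.orbit f) x = BFam.comp (N.orbit g) y := by
  obtain ⟨K, hK⟩ := BFam.exists_bound G V
  refine ⟨K, fun M N f g h c y => ?_⟩
  obtain ⟨L, i, hi, ξ, hξ⟩ := hK c (BFam.comp (N.orbit g) y)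
  -- The family of `y` takes values in `K ⧸ L`, so retracting onto this subspace and including it
  -- again changes nothing.
  obtain ⟨r, hr⟩ := exists_retraction i hi
  obtain ⟨x, hx⟩ := h L (y ≫ Pro.const.map r)
  exact ⟨x ≫ Pro.const.map i, by
    rw [BFam.comp_map, hx, BFam.comp_map, ← hξ, BFam.post_post, BFam.post_post, ← Category.assoc,
      hr, Category.id_comp]⟩

/-- The representations generated by the images of maps from a fixed pro-vector space form a set
up to isomorphism. -/
theorem exists_solutionSet (hG : ConditionStarStar G) (V : ProVect k) :
    ∃ (κ : Type u) (N : κ → Rep k G) (f : ∀ i, V ⟶ (N i).V), ∀ (M : Rep k G) (h : V ⟶ M.V),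
      ∃ (i : κ) (m : N i ⟶ M), f i ≫ m.hom = h ∧ IsEmb m.hom := by
  obtain ⟨K, hK⟩ := exists_comp_orbit_bound (G := G) V
  let Z := Σ L : Submodule k K, BFam k G V (ModuleCat.of k (K ⧸ L))
  -- The invariant of a map `V ⟶ M`: the families valued in quotients of `K` that factor through its
  -- orbit. The invariants form a small set, and one generated representation is chosen for each
  -- that occurs.
  let Q : (Σ M : Rep k G, V ⟶ M.V) → Set Z :=
    fun M => {z | ∃ y, BFam.comp (M.1.orbit M.2) y = z.2}
  have hQ : ∀ M N : Σ M : Rep k G, V ⟶ M.V, Q M = Q N → ∀ (c : ModuleCat.{u} k)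
      (y : N.1.V ⟶ Pro.const.obj c), ∃ x : M.1.V ⟶ Pro.const.obj c,
        BFam.comp (M.1.orbit M.2) x = BFam.comp (N.1.orbit N.2) y := fun M N h =>
    hK M.1 N.1 M.2 N.2 fun L y => by
      have : (⟨L, BFam.comp (N.1.orbit N.2) y⟩ : Z) ∈ Q M := h ▸ ⟨y, rfl⟩
      exact this
  let S : Set (Set Z) :=
    {q | ∃ M : Σ M : Rep k G, V ⟶ M.V, M.1.Generates M.2 ∧ Q M = q}
  choose N hN hNQ using fun q : S => q.2
  refine ⟨Shrink.{u} S, fun i => (N ((equivShrink _).symm i)).1,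
    fun i => (N ((equivShrink _).symm i)).2, fun M h => ?_⟩
  obtain ⟨M', f', m, hm, hm', hgen⟩ := exists_generated hG M h
  obtain ⟨i, hi⟩ := (equivShrink S).symm.surjective ⟨Q ⟨M', f'⟩, ⟨M', f'⟩, hgen, rfl⟩
  have hi : Q (N ((equivShrink S).symm i)) = Q ⟨M', f'⟩ :=
    (hNQ _).trans (congrArg Subtype.val hi)
  have hi' := hN ((equivShrink S).symm i)
  obtain ⟨φ, hφ⟩ := exists_hom_of_generates hG hi' (hQ _ _ hi)
  refine ⟨i, φ ≫ m, ?_, fun c g => ?_⟩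
  · change _ ≫ φ.hom ≫ m.hom = h
    rw [← Category.assoc, hφ, hm]
  -- One inclusion of invariants gave `φ`; the reverse one extends maps from the chosen
  -- representation along `φ`, so `φ ≫ m` is an embedding.
  · obtain ⟨x, hx⟩ := hQ _ _ hi.symm c g
    obtain ⟨y, hy⟩ := hm' c x
    refine ⟨y, hi' _ _ _ ?_⟩
    change BFam.comp _ ((φ.hom ≫ m.hom) ≫ y) = _
    rw [Category.assoc, hy, ← comp_orbit_comp, hφ, hx]

end Rep

/-! ### Formal manipulations of equivariance -/

namespace PseudoAction

variable {A C : Type*} [Category* A] [Category* C] (P : PseudoAction A C) {X : A}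

theorem comp_comp_ofHom_of_comm {T V W : C} {f : T ⟶ V} {g : V ⟶ W} {h : T ⟶ W}
    {ρ : P.Hom X V V} {σ : P.Hom X W W} (w : f ≫ g = h)
    (hg : P.comp ρ (P.ofHom X g) = P.comp (P.ofHom X g) σ) :
    P.comp (P.comp (P.ofHom X f) ρ) (P.ofHom X g) = P.comp (P.ofHom X h) σ := by
  rw [P.assoc, hg, ← P.assoc, ← P.ofHom_comp, w]

/-- If `g` and `f ≫ g` are equivariant, then `f` is equivariant after composition with `g`.
Cancelling `g`, as an embedding or as a jointly monic family of projections, makes `f` equivariant.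
-/
theorem comp_comp_ofHom_eq {T V W : C} {f : T ⟶ V} {g : V ⟶ W} {h : T ⟶ W} {τ : P.Hom X T T}
    {ρ : P.Hom X V V} {σ : P.Hom X W W} (w : f ≫ g = h)
    (hg : P.comp ρ (P.ofHom X g) = P.comp (P.ofHom X g) σ)
    (hh : P.comp τ (P.ofHom X h) = P.comp (P.ofHom X h) σ) :
    P.comp (P.comp τ (P.ofHom X f)) (P.ofHom X g) =
      P.comp (P.comp (P.ofHom X f) ρ) (P.ofHom X g) := by
  rw [P.comp_comp_ofHom_of_comm w hg, P.assoc, ← P.ofHom_comp, w, hh]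

theorem comm_inverse {V W : C} {f : V ⟶ W} {g : W ⟶ V} {ρ : P.Hom X V V} {σ : P.Hom X W W}
    (h : f ≫ g = 𝟙 V) (h' : g ≫ f = 𝟙 W)
    (hf : P.comp ρ (P.ofHom X f) = P.comp (P.ofHom X f) σ) :
    P.comp σ (P.ofHom X g) = P.comp (P.ofHom X g) ρ := by
  rw [← P.comp_id (P.comp (P.ofHom X g) ρ), ← h, P.ofHom_comp, ← P.assoc,
    P.comp_comp_ofHom_of_comm h' hf, P.id_comp]

end PseudoAction

/-! ### Limits of representations -/

section Limits

variable {J : Type u} [Category.{u} J]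

/-- Families of maps to a limit are determined by their components. -/
theorem family_ext_of_isLimit {F : J ⥤ ProVect k} {s : Cone F} (hs : IsLimit s) {X : BSet.{u}}
    {V : ProVect k} {f g : (bsetAction k).Hom X V s.pt}
    (h : ∀ j, (bsetAction k).comp f ((bsetAction k).ofHom X (s.π.app j)) =
      (bsetAction k).comp g ((bsetAction k).ofHom X (s.π.app j))) : f = g := by
  -- Families become ordinary maps out of `X ⊗ V`, to which the universal property of the limit
  -- applies.
  obtain ⟨T, θ, hθ⟩ := BFam.exists_tensor X V
  obtain ⟨a, rfl⟩ := (hθ _).2 f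
  obtain ⟨b, rfl⟩ := (hθ _).2 g
  refine congrArg (fun a => (bsetAction k).comp θ ((bsetAction k).ofHom X a))
    (hs.hom_ext fun j => (hθ _).1 ?_)
  simpa only [PseudoAction.assoc, ← PseudoAction.ofHom_comp] using h j

/-- Compatible families of maps to the objects of a diagram come from a family of maps to the
limit. -/
theorem exists_family_of_isLimit {F : J ⥤ ProVect k} {s : Cone F} (hs : IsLimit s) {X : BSet.{u}}
    {V : ProVect k} (f : ∀ j, (bsetAction k).Hom X V (F.obj j))
    (hf : ∀ {i j : J} (a : i ⟶ j),
      (bsetAction k).comp (f i) ((bsetAction k).ofHom X (F.map a)) = f j) :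
    ∃ g : (bsetAction k).Hom X V s.pt, ∀ j,
      (bsetAction k).comp g ((bsetAction k).ofHom X (s.π.app j)) = f j := by
  obtain ⟨T, θ, hθ⟩ := BFam.exists_tensor X V
  choose t ht using fun j => (hθ (F.obj j)).2 (f j)
  let c : Cone F :=
    { pt := T
      π :=
        { app := t
          naturality := fun i j a => (hθ _).1 (by
            have h := hf a
            rw [← ht, ← ht, PseudoAction.assoc, ← PseudoAction.ofHom_comp] at h
            simpa using h.symm) } }
  refine ⟨(bsetAction k).comp θ ((bsetAction k).ofHom X (hs.lift c)), fun j => ?_⟩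
  rw [PseudoAction.assoc, ← PseudoAction.ofHom_comp, hs.fac]
  exact ht j

namespace Rep

variable {G : BSet.{u}} [GrpObj G]

/-- A limit of the underlying diagram of pro-vector spaces underlies a limit of representations. -/
theorem exists_limitCone (F : J ⥤ Rep k G) :
    ∃ (s : Cone F) (_ : IsLimit s), Nonempty (IsLimit ((forget k G).mapCone s)) := by
  let t := limit.cone (F ⋙ forget k G)
  have ht : IsLimit t := limit.isLimit _
  obtain ⟨ρ, hρ⟩ := exists_family_of_isLimit ht
    (fun j => (bsetAction k).comp ((bsetAction k).ofHom G (t.π.app j)) (F.obj j).ρ)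
    (fun {_ _} a => PseudoAction.comp_comp_ofHom_of_comm _ (t.w a) (F.map a).comm)
  let s : Cone F :=
    { pt := ofFamily (I := t.pt) F.obj t.π.app (fun _ _ h => family_ext_of_isLimit ht h) ρ hρ
      π :=
        { app := fun j => ⟨t.π.app j, hρ j⟩
          naturality := fun i j a => Hom.ext (t.π.naturality a) } }
  refine ⟨s, ?_, ⟨ht⟩⟩
  exact
    { lift := fun c => ⟨ht.lift ((forget k G).mapCone c), family_ext_of_isLimit ht fun j =>
        PseudoAction.comp_comp_ofHom_eq _ (ht.fac _ j) (hρ j) (c.π.app j).comm⟩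
      fac := fun c j => Hom.ext (ht.fac _ j)
      uniq := fun c m hm => Hom.ext (ht.uniq ((forget k G).mapCone c) _ fun j =>
        congrArg Hom.hom (hm j)) }

instance : HasLimitsOfSize.{u, u} (Rep k G) where
  has_limits_of_shape J _ :=
    { has_limit := fun F => by
        obtain ⟨s, hs, -⟩ := exists_limitCone F
        exact ⟨⟨s, hs⟩⟩ }

instance : PreservesLimitsOfSize.{u, u} (forget k G) where
  preservesLimitsOfShape {J} _ :=
    { preservesLimit := fun {F} => by
        obtain ⟨s, hs, ⟨h⟩⟩ := exists_limitCone F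
        exact preservesLimit_of_preserves_limit_cone hs h }

instance : (forget k G).ReflectsIsomorphisms where
  reflects {M N} f hf := by
    obtain ⟨g, hg, hg'⟩ := hf
    exact ⟨⟨g, PseudoAction.comm_inverse _ hg hg' f.comm⟩, Hom.ext hg, Hom.ext hg'⟩

end Rep

end Limits

/-! ### Adjoint functors -/

namespace Rep

variable {G : BSet.{u}} [GrpObj G]

theorem isRightAdjoint_forget (hG : ConditionStarStar G) : (forget k G).IsRightAdjoint :=
  isRightAdjoint_of_preservesLimits_of_solutionSetCondition _ fun V => by
    obtain ⟨κ, N, f, h⟩ := exists_solutionSet hG V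
    refine ⟨κ, N, f, fun M g => ?_⟩
    obtain ⟨i, m, hm, -⟩ := h M g
    exact ⟨i, m, hm⟩

/-- A map of pro-vector spaces is compatible with the actions if its composition with an
equivariant embedding is. -/
theorem exists_hom_of_isEmb {M N L : Rep k G} {f : M.V ⟶ N.V} {m : N ⟶ L} {h : M ⟶ L}
    (hm : IsEmb m.hom) (w : f ≫ m.hom = h.hom) : ∃ φ : M ⟶ N, φ.hom = f :=
  ⟨⟨f, hm.family_ext (PseudoAction.comp_comp_ofHom_eq _ w m.comm h.comm)⟩, rfl⟩

theorem isRightAdjoint_restrict (hG : ConditionStarStar G) {G₁ : BSet.{u}} [GrpObj G₁]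
    (φ : G₁ ⟶ G) [IsMonHom φ] : (restrict k φ).IsRightAdjoint := by
  -- Restriction does not change the underlying pro-vector space, so this composite is `forget k G`,
  -- and `forget k G₁` reflects limits.
  have : PreservesLimitsOfSize.{u, u} (restrict k φ ⋙ forget k G₁) :=
    inferInstanceAs (PreservesLimitsOfSize.{u, u} (forget k G))
  have : ReflectsLimitsOfSize.{u, u} (forget k G₁) := reflectsLimits_of_reflectsIsomorphisms
  have : PreservesLimitsOfSize.{u, u} (restrict k φ) :=
    preservesLimits_of_reflects_of_preserves _ (forget k G₁)
  refine isRightAdjoint_of_preservesLimits_of_solutionSetCondition _ fun A => ?_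
  obtain ⟨κ, N, f, h⟩ := exists_solutionSet hG A.V
  refine ⟨Σ i, (A ⟶ (restrict k φ).obj (N i)), fun i => N i.1, fun i => i.2, fun M g => ?_⟩
  obtain ⟨i, m, hm, hm'⟩ := h M g.hom
  -- The linear map to `N i` is equivariant for `G₁` because its composite with the embedding into
  -- `M` is.
  obtain ⟨ψ, hψ⟩ := exists_hom_of_isEmb (N := (restrict k φ).obj (N i))
    (m := (restrict k φ).map m) (h := g) hm' hm
  exact ⟨⟨i, ψ⟩, m, Hom.ext ((congrArg (· ≫ m.hom) hψ).trans hm)⟩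

theorem isRightAdjoint_const (hG : ConditionStarStar G) (J : Type u) [SmallCategory J] :
    (Functor.const J : Rep k G ⥤ J ⥤ Rep k G).IsRightAdjoint := by
  refine isRightAdjoint_of_preservesLimits_of_solutionSetCondition _ fun A => ?_
  let V := fun j => (A.obj j).V
  -- A cocone on `A` with vertex `M` gives one linear map from the coproduct of the underlying
  -- pro-vector spaces. The subrepresentation it generates contains the images of all legs.
  obtain ⟨κ, N, f, h⟩ := exists_solutionSet hG (∐ V)
  refine ⟨Σ i, (A ⟶ (Functor.const J).obj (N i)), fun i => N i.1, fun i => i.2, fun M g => ?_⟩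
  obtain ⟨i, m, hm, hm'⟩ := h M (Sigma.desc fun j => (g.app j).hom)
  have hj : ∀ j, (Sigma.ι V j ≫ f i) ≫ m.hom = (g.app j).hom := fun j => by
    rw [Category.assoc, hm, Sigma.ι_desc]
  choose ψ hψ using fun j => exists_hom_of_isEmb (M := A.obj j) (h := g.app j) hm' (hj j)
  have hψm : ∀ j, ψ j ≫ m = g.app j := fun j =>
    Hom.ext ((congrArg (· ≫ m.hom) (hψ j)).trans (hj j))
  refine ⟨⟨i, { app := ψ, naturality := fun j j' a => ?_ }⟩, m, ?_⟩
  -- Naturality of the corestricted legs is inherited from the cocone, since it can be tested after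
  -- the embedding.
  · refine Hom.ext (hm'.hom_ext ?_)
    have e : (A.map a ≫ ψ j') ≫ m = (ψ j ≫ 𝟙 (N i)) ≫ m := by
      rw [Category.assoc, hψm, g.naturality, Category.comp_id, hψm]
      exact Category.comp_id _
    exact congrArg Hom.hom e
  · ext j : 2
    exact hψm j

end Rep

end ProRep

theorem mainTheorem8 (k : Type u) [Field k] (G : ProRep.BSet.{u}) [GrpObj G]
    (hG : ProRep.ConditionStarStar G) :
    (ProRep.Rep.forget k G).IsRightAdjoint ∧
    (∀ (G₁ : ProRep.BSet.{u}) [GrpObj G₁] (φ : G₁ ⟶ G) [IsMonHom φ],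
      (ProRep.Rep.restrict k φ).IsRightAdjoint) ∧
    HasColimitsOfSize.{u, u} (ProRep.Rep k G) :=
  ⟨ProRep.Rep.isRightAdjoint_forget hG,
    fun _ _ φ _ => ProRep.Rep.isRightAdjoint_restrict hG φ,
    ⟨fun J _ => hasColimitsOfShape_iff_isRightAdjoint_const.2
      (ProRep.Rep.isRightAdjoint_const hG J)⟩⟩
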